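/- **Setting.** Let $0<\alpha\le 1$ and let $\tau_{\rm acc},\tau_{\rm m},h_{\rm m},\bar h_{\rm acc},l,q_{\rm in}>0$ be such that $\bar h_{\rm mix}:=\frac{\alpha+(1-\alpha)\tau_{\rm acc}/\tau_{\rm m}}{\alpha+(1-\alpha)(\tau_{\rm acc}/\tau_{\rm m})(\bar h_{\rm acc}/h_{\rm m})}\,\bar h_{\rm acc}<1/q_{\rm in}$. Put $\tau_{\rm mix}=\big(\frac{\alpha}{\tau_{\rm acc}}+\frac{1-\alpha}{\tau_{\rm m}}\big)^{-1}$, $\bar v=\frac{l}{1/q_{\rm in}-\bar h_{\rm mix}}$, $\bar\rho=\frac1{l+\bar h_{\rm mix}\bar v}$ and $$c_1=\bar v,\quad c_2=\tfrac1{\tau_{\rm mix}\bar v},\quad c_3=\tfrac{\alpha\bar h_{\rm mix}\bar\rho^2}{\tau_{\rm acc}\bar h_{\rm acc}^2}\big(\tfrac1{\bar\rho}-l\big),\quad c_4=\tfrac{l}{\bar h_{\rm mix}},\quad c_5=\tfrac1{\bar\rho^2\tau_{\rm mix}\bar h_{\rm mix}},\quad c_6=\tfrac{\alpha}{\tau_{\rm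 acc}\bar h_{\rm acc}^2}\big(\tfrac1{\bar\rho}-l\big),\quad c_7=\tfrac{l\bar\rho^2}{\bar v}.$$ Let $D>0$, $k>0$ and assume $(c_1+c_4)D<L$. **Plant.** For $x\in[0,L]$, $s\in[0,D]$, $t\ge0$: $$z_t=-c_1z_x-c_3e^{c_2x}\psi(x,0,t),\qquad v_t=c_4v_x-c_5e^{-c_2x}z-c_6\psi(x,0,t),$$ $$z(0,t)=-c_7v(0,t),\qquad v_t(L,t)=-c_5e^{-c_2L}z(L,t)-c_6\psi(L,0,t),$$ $$\psi_t=\psi_s,\qquad \psi(x,D,t)=u(x,t),\qquad \psi(x,s,0)=\vartheta_0(x,s),\qquad z(x,0)=z_0(x),\qquad v(x,0)=v_0(x).$$ **Control.** Write $u(y,t-r)=\psi(y,D-r,t)$ for $0\le r\le D$, and set $\mathfrak g(x,y,r)=\frac{kc_1c_2}{c_1+c_4}e^{-\frac{c_1c_2}{c_1+c_4}(x-y+c_4r)}$, $\mathfrak k(x,y)=\frac{kc_5}{c_6(c_1+c_4)}e^{-\frac{c_1c_2}{c_1+c_4}x-\frac{c_2c_4}{c_1+c_4}(y+c_1D)}$,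 $\mathfrak c(r)=\frac{c_1+c_4}{c_4}L-\frac{c_1}{c_4}x-c_1r$, $\sigma=D-\frac{x}{c_1}$. The control is defined as follows. If $0\le x\le c_1D$: $$\begin{aligned}u(x,t)=&\int_0^{x/c_1}\!c_1c_2e^{-c_1c_2r}u(x-c_1r,t-r)\,dr-\int_{x/c_1}^{D}\!c_5c_7e^{-c_2x}u\big(c_4(r-\tfrac{x}{c_1}),t-r\big)dr-\int_0^D\!k\,u(x+c_4r,t-r)\,dr\\&+\int_0^D\!\int_{\max\{x-c_1r,\,c_4(r-x/c_1)\}}^{x+c_4r}\!\mathfrak g(x,y,r)u(y,t-r)\,dy\,dr\\&-\int_0^{c_4\sigma}\!\tfrac{c_5(k+c_5c_7)}{c_6(c_1+c_4)}e^{-c_2(x+y)}z(y,t)\,dy-\int_{c_4\sigma}^{x+c_4D}\!\mathfrak k(x,y)z(y,t)\,dy\\&+\tfrac{c_5c_7}{c_6}e^{-c_2x}v(c_4\sigma,t)+\tfrac k{c_6}v(x+c_4D,t)+\int_0^{c_4\sigma}\!\tfrac{c_1c_5c_7(k+c_5c_7)}{c_4c_6(c_1+c_4)}e^{-c_2x}v(y,t)\,dy.\end{aligned}$$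 If $c_1D<x\le L-c_4D$: $$\begin{aligned}u(x,t)=&\int_0^{D}\!c_1c_2e^{-c_1c_2r}u(x-c_1r,t-r)\,dr-\int_0^D\!k\,u(x+c_4r,t-r)\,dr+\int_0^D\!\int_{x-c_1r}^{x+c_4r}\!\mathfrak g(x,y,r)u(y,t-r)\,dy\,dr\\&-\tfrac{c_5}{c_6}e^{-c_2x}z(x-c_1D,t)-\int_{x-c_1D}^{x+c_4D}\!\mathfrak k(x,y)z(y,t)\,dy+\tfrac k{c_6}v(x+c_4D,t).\end{aligned}$$ If $L-c_4D<x\le L$: $$\begin{aligned}u(x,t)=&\int_0^{D}\!c_1c_2e^{-c_1c_2r}u(x-c_1r,t-r)\,dr-\int_0^{(L-x)/c_4}\!k\,u(x+c_4r,t-r)\,dr-\int_{(L-x)/c_4}^{D}\!k\,u(L,t-r)\,dr\\&+\int_0^D\!\int_{x-c_1r}^{\min\{x+c_4r,\,\mathfrak c(r)\}}\!\mathfrak g(x,y,r)u(y,t-r)\,dy\,dr+\int_{(L-x)/c_4}^{D}\!\int_{\mathfrak c(r)}^{L}\!kc_2e^{-c_2(L-y)}u(y,t-r)\,dy\,dr\\&-\tfrac{c_5}{c_6}e^{-c_2x}z(x-c_1D,t)-\int_{\mathfrak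 c(D)}^{L}\!\tfrac{kc_5}{c_1c_6}e^{-c_2L}z(y,t)\,dy-\int_{x-c_1D}^{\mathfrak c(D)}\!\mathfrak k(x,y)z(y,t)\,dy+\tfrac k{c_6}v(L,t).\end{aligned}$$ **Theorem.** There are constants $M,\vartheta>0$, depending only on the parameters above, such that the following holds. Let $z_0,v_0\in H^1(0,L)$ and $\vartheta_0\in L^2((0,L);H^1(0,D))$ with $\vartheta_0(L,\cdot)\in H^1(0,D)$ be compatible, that is, $z_0(0)=-c_7v_0(0)$ and, for almost every $x\in[0,L]$ and for $x=L$, $\vartheta_0(x,D)$ equals the control $u(x,0)$ computed from $(z_0,v_0,\vartheta_0)$. Let $(z,v,\psi)$ be a strong solution of the closed loop (plant and control) with these initial data: $z,v$ are continuous on $[0,L]\times[0,\infty)$ and in $H^1((0,L)\times(0,T))$ for every $T$; $\psi(\cdot,\cdot,t)\in L^2((0,L)\times(0,D))$ for every $t\ge 0$; $\psi,\psi_s,\psi_t\in L^2((0,L)\times(0,D)\times(0,T))$ for every $T$; for almost every $x$ and for $x=L$, $\psi(x,\cdot,\cdot)$ is continuous on $[0,D]\times[0,\infty)$ and in $H^1((0,D)\times(0,T))$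 for every $T$; the partial differential equations hold almost everywhere (for $\psi$: for almost every $x$ and for $x=L$), the relation $\psi(x,D,t)=u(x,t)$ holds for almost every $x$ and for $x=L$, for all $t\ge 0$, and the boundary conditions at $x=0$ and $x=L$ hold for all $t\ge0$ and all $t>0$, respectively. Then, for all $t>0$, $$\|z(\cdot,t)\|_{L^2}^2+\|v(\cdot,t)\|_{L^2}^2+|v(L,t)|^2+\|\psi(\cdot,\cdot,t)\|_{L^2}^2+\|\psi(L,\cdot,t)\|_{L^2}^2\le Me^{-\vartheta t}\Big(\|z_0\|_{L^2}^2+\|v_0\|_{L^2}^2+|v_0(L)|^2+\|\vartheta_0\|_{L^2}^2+\|\vartheta_0(L,\cdot)\|_{L^2}^2\Big).$$ -/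

import Mathlib

open MeasureTheory Set
open scoped Real

noncomputable section

/-- Physical parameters of the mixed ACC / manual traffic model:
`α` the fraction of ACC vehicles, `τacc`, `τm` the time constants of ACC and manual vehicles,
`hm` the time gap of manual vehicles, `hacc` the steady-state time gap of ACC vehicles,
`l` the effective vehicle length, `qin` the constant inflow. -/
structure ARZParams where
  α : ℝ
  τacc : ℝ
  τm : ℝ
  hm : ℝ
  hacc : ℝ
  l : ℝ
  qin : ℝ

namespace ARZParams

variable (P : ARZParams)

/-- Time constant of the mixed traffic. -/
def τmix : ℝ := 1 / (P.α / P.τacc + (1 - P.α) / P.τm)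

/-- Steady-state mixed time gap. -/
def hmix : ℝ :=
  (P.α + (1 - P.α) * (P.τacc / P.τm)) /
    (P.α + (1 - P.α) * (P.τacc / P.τm) * (P.hacc / P.hm)) * P.hacc

/-- Steady-state speed. -/
def vbar : ℝ := P.l / (1 / P.qin - P.hmix)

/-- Steady-state density. -/
def ρbar : ℝ := 1 / (P.l + P.hmix * P.vbar)

def c1 : ℝ := P.vbar
def c2 : ℝ := 1 / (P.τmix * P.vbar)
def c3 : ℝ := P.α * P.hmix * P.ρbar ^ 2 / (P.τacc * P.hacc ^ 2) * (1 / P.ρbar - P.l)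
def c4 : ℝ := P.l / P.hmix
def c5 : ℝ := 1 / (P.ρbar ^ 2 * P.τmix * P.hmix)
def c6 : ℝ := P.α / (P.τacc * P.hacc ^ 2) * (1 / P.ρbar - P.l)
def c7 : ℝ := P.l * P.ρbar ^ 2 / P.vbar

/-- Admissible parameters: positive physical constants, a fraction `0 < α ≤ 1` of ACC vehicles
(without ACC vehicles there is no actuation), and a positive steady-state speed. -/
structure Valid : Prop where
  α_pos : 0 < P.α
  α_le_one : P.α ≤ 1
  τacc_pos : 0 < P.τacc
  τm_pos : 0 < P.τm
  hm_pos : 0 < P.hm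
  hacc_pos : 0 < P.hacc
  l_pos : 0 < P.l
  qin_pos : 0 < P.qin
  hmix_lt : P.hmix < 1 / P.qin

end ARZParams

namespace ARZ

/-! ### Function spaces -/

/-- `f ∈ H¹(0, A)` with weak derivative `g` (`f` is its absolutely continuous representative
on `[0, A]`). -/
def HasH1Deriv (A : ℝ) (f g : ℝ → ℝ) : Prop :=
  MemLp g 2 (volume.restrict (Icc 0 A)) ∧
    ∀ x ∈ Icc 0 A, f x = f 0 + ∫ ξ in (0 : ℝ)..x, g ξ

/-- `f ∈ H¹(0, A)`. -/
def MemH1 (A : ℝ) (f : ℝ → ℝ) : Prop := ∃ g, HasH1Deriv A f g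

/-- A property of positions which holds for almost every `x ∈ [0, L]` and at the outlet `x = L`. -/
def AEAndOutlet (L : ℝ) (p : ℝ → Prop) : Prop :=
  (∀ᵐ x ∂(volume.restrict (Icc 0 L)), p x) ∧ p L

/-- `φ ∈ L²((0, L); H¹(0, D))`, together with an outlet value `φ(L, ·) ∈ H¹(0, D)`. -/
def MemL2H1 (L D : ℝ) (φ : ℝ → ℝ → ℝ) : Prop :=
  ∃ g : ℝ → ℝ → ℝ,
    MemLp (Function.uncurry φ) 2 (volume.restrict (Icc 0 L ×ˢ Icc 0 D)) ∧
    MemLp (Function.uncurry g) 2 (volume.restrict (Icc 0 L ×ˢ Icc 0 D)) ∧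
    AEAndOutlet L fun x => HasH1Deriv D (φ x) (g x)

/-- `f = f(x, t)` is continuous on `[0, A] × [0, ∞)` and lies in `H¹((0, A) × (0, T))` for all `T`,
with weak partial derivatives `f_x = fx` and `f_t = ft` (square integrable, `f` being absolutely
continuous with these derivatives along almost every coordinate line). -/
structure HasStrongDeriv (A : ℝ) (f fx ft : ℝ → ℝ → ℝ) : Prop where
  continuousOn : ContinuousOn (Function.uncurry f) (Icc 0 A ×ˢ Ici 0)
  memLp_fx : ∀ T, MemLp (Function.uncurry fx) 2 (volume.restrict (Icc 0 A ×ˢ Icc 0 T))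
  memLp_ft : ∀ T, MemLp (Function.uncurry ft) 2 (volume.restrict (Icc 0 A ×ˢ Icc 0 T))
  eq_fx : ∀ᵐ t ∂(volume.restrict (Ici (0 : ℝ))), ∀ x ∈ Icc 0 A,
    f x t = f 0 t + ∫ ξ in (0 : ℝ)..x, fx ξ t
  eq_ft : ∀ᵐ x ∂(volume.restrict (Icc 0 A)), ∀ t ∈ Ici (0 : ℝ),
    f x t = f x 0 + ∫ τ in (0 : ℝ)..t, ft x τ

/-! ### The feedback law

Here `z`, `v` are the profiles `z(·, t)`, `v(·, t)` and `φ = ψ(·, ·, t)` is the content of the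
delay line, so that `φ y (D - r) = ψ(y, D - r, t) = u(y, t - r)` is the past actuation
(for `t - r ≤ 0` it is the initial actuator state). Integrals over `τ ∈ [t - D, t]` are written
in the variable `r = t - τ`. -/

section Feedback

variable (P : ARZParams) (L D k : ℝ)

/-- Kernel of the double integrals of the past actuation. -/
def kerG (x y r : ℝ) : ℝ :=
  k * P.c1 * P.c2 / (P.c1 + P.c4) *
    Real.exp (-(P.c1 * P.c2 / (P.c1 + P.c4)) * (x - y + P.c4 * r))

/-- Kernel of the integrals of `z`. -/
def kerK (x y s : ℝ) : ℝ :=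
  k * P.c5 / (P.c6 * (P.c1 + P.c4)) *
    Real.exp (-(P.c1 * P.c2 / (P.c1 + P.c4)) * x
      - P.c2 * P.c4 / (P.c1 + P.c4) * (y + P.c1 * s))

/-- The break point `(c₁ + c₄) / c₄ * L - c₁ / c₄ * x - c₁ r`. -/
def brk (x r : ℝ) : ℝ := (P.c1 + P.c4) / P.c4 * L - P.c1 / P.c4 * x - P.c1 * r

def U1 (φ : ℝ → ℝ → ℝ) (x : ℝ) : ℝ :=
  (∫ r in (0 : ℝ)..(x / P.c1),
      P.c1 * P.c2 * Real.exp (-(P.c1 * P.c2 * r)) * φ (x - P.c1 * r) (D - r))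
  - (∫ r in (x / P.c1)..D,
      P.c5 * P.c7 * Real.exp (-(P.c2 * x)) * φ (P.c4 * (r - x / P.c1)) (D - r))
  - (∫ r in (0 : ℝ)..D, k * φ (x + P.c4 * r) (D - r))
  + ∫ r in (0 : ℝ)..D,
      ∫ y in (max (x - P.c1 * r) (P.c4 * (r - x / P.c1)))..(x + P.c4 * r),
        kerG P k x y r * φ y (D - r)

def U2 (φ : ℝ → ℝ → ℝ) (x : ℝ) : ℝ :=
  (∫ r in (0 : ℝ)..D,
      P.c1 * P.c2 * Real.exp (-(P.c1 * P.c2 * r)) * φ (x - P.c1 * r) (D - r))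
  - (∫ r in (0 : ℝ)..D, k * φ (x + P.c4 * r) (D - r))
  + ∫ r in (0 : ℝ)..D, ∫ y in (x - P.c1 * r)..(x + P.c4 * r),
      kerG P k x y r * φ y (D - r)

def U3 (φ : ℝ → ℝ → ℝ) (x : ℝ) : ℝ :=
  (∫ r in (0 : ℝ)..D,
      P.c1 * P.c2 * Real.exp (-(P.c1 * P.c2 * r)) * φ (x - P.c1 * r) (D - r))
  - (∫ r in (0 : ℝ)..((L - x) / P.c4), k * φ (x + P.c4 * r) (D - r))
  - (∫ r in ((L - x) / P.c4)..D, k * φ L (D - r))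
  + (∫ r in (0 : ℝ)..D, ∫ y in (x - P.c1 * r)..(min (x + P.c4 * r) (brk P L x r)),
      kerG P k x y r * φ y (D - r))
  + ∫ r in ((L - x) / P.c4)..D, ∫ y in (brk P L x r)..L,
      k * P.c2 * Real.exp (-(P.c2 * (L - y))) * φ y (D - r)

def Z1 (z : ℝ → ℝ) (x s : ℝ) : ℝ :=
  (∫ y in (0 : ℝ)..(P.c4 * (s - x / P.c1)),
      P.c5 * (k + P.c5 * P.c7) / (P.c6 * (P.c1 + P.c4)) * Real.exp (-(P.c2 * (x + y))) * z y)
  + ∫ y in (P.c4 * (s - x / P.c1))..(x + P.c4 * s), kerK P k x y s * z y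

def Z2 (z : ℝ → ℝ) (x s : ℝ) : ℝ :=
  P.c5 / P.c6 * Real.exp (-(P.c2 * x)) * z (x - P.c1 * s)
  + ∫ y in (x - P.c1 * s)..(x + P.c4 * s), kerK P k x y s * z y

def Z3 (z : ℝ → ℝ) (x s : ℝ) : ℝ :=
  P.c5 / P.c6 * Real.exp (-(P.c2 * x)) * z (x - P.c1 * s)
  + (∫ y in (brk P L x s)..L,
      k * P.c5 / (P.c1 * P.c6) * Real.exp (-(P.c2 * L)) * z y)
  + ∫ y in (x - P.c1 * s)..(brk P L x s), kerK P k x y s * z y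

def Y1 (v : ℝ → ℝ) (x s : ℝ) : ℝ :=
  - (P.c5 * P.c7 / P.c6 * Real.exp (-(P.c2 * x)) * v (P.c4 * (s - x / P.c1)))
  - k / P.c6 * v (x + P.c4 * s)
  - ∫ y in (0 : ℝ)..(P.c4 * (s - x / P.c1)),
      P.c1 * P.c5 * P.c7 * (k + P.c5 * P.c7) / (P.c4 * P.c6 * (P.c1 + P.c4))
        * Real.exp (-(P.c2 * x)) * v y

def Y2 (v : ℝ → ℝ) (x s : ℝ) : ℝ := -(k / P.c6 * v (x + P.c4 * s))

/-- The three-branch predictor feedback `u(x, t)`. -/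
def control (z v : ℝ → ℝ) (φ : ℝ → ℝ → ℝ) (x : ℝ) : ℝ :=
  if x ≤ P.c1 * D then
    U1 P D k φ x - Z1 P k z x D - Y1 P k v x D
  else if x ≤ L - P.c4 * D then
    U2 P D k φ x - Z2 P k z x D - Y2 P k v x D
  else
    U3 P L D k φ x - Z3 P L k z x D + k / P.c6 * v L

end Feedback

/-! ### The closed loop -/

/-- Initial data `z₀, v₀ ∈ H¹(0, L)`, `ϑ₀ ∈ L²((0, L); H¹(0, D))` compatible with the inlet
condition and with the feedback law. -/
structure CompatibleData (P : ARZParams) (L D k : ℝ) (z₀ v₀ : ℝ → ℝ) (ϑ₀ : ℝ → ℝ → ℝ) :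
    Prop where
  z_mem : MemH1 L z₀
  v_mem : MemH1 L v₀
  ϑ_mem : MemL2H1 L D ϑ₀
  inlet : z₀ 0 = -P.c7 * v₀ 0
  actuator : AEAndOutlet L fun x => ϑ₀ x D = control P L D k z₀ v₀ ϑ₀ x

/-- `(z, v, ψ)` is a (global, strong) solution of the closed loop consisting of the plant and the
feedback law, with initial data `z₀, v₀, ϑ₀`. -/
structure IsClosedLoopSolution (P : ARZParams) (L D k : ℝ) (z₀ v₀ : ℝ → ℝ) (ϑ₀ : ℝ → ℝ → ℝ)
    (z v : ℝ → ℝ → ℝ) (ψ : ℝ → ℝ → ℝ → ℝ) : Prop where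
  /-- `z_t = -c₁ z_x - e^{c₂ x} c₃ ψ(x, 0, t)` -/
  z_eq : ∃ zx zt : ℝ → ℝ → ℝ, HasStrongDeriv L z zx zt ∧
    ∀ᵐ q : ℝ × ℝ ∂(volume.restrict (Icc 0 L ×ˢ Ici 0)),
      zt q.1 q.2 = -P.c1 * zx q.1 q.2 - Real.exp (P.c2 * q.1) * P.c3 * ψ q.1 0 q.2
  /-- `v_t = c₄ v_x - c₅ e^{-c₂ x} z - c₆ ψ(x, 0, t)` -/
  v_eq : ∃ vx vt : ℝ → ℝ → ℝ, HasStrongDeriv L v vx vt ∧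
    ∀ᵐ q : ℝ × ℝ ∂(volume.restrict (Icc 0 L ×ˢ Ici 0)),
      vt q.1 q.2 = P.c4 * vx q.1 q.2 - P.c5 * Real.exp (-(P.c2 * q.1)) * z q.1 q.2
        - P.c6 * ψ q.1 0 q.2
  /-- `z(0, t) = -c₇ v(0, t)` -/
  inlet : ∀ t, 0 ≤ t → z 0 t = -P.c7 * v 0 t
  /-- `v_t(L, t) = -c₅ e^{-c₂ L} z(L, t) - c₆ ψ(L, 0, t)` -/
  outlet : ∀ t, 0 < t →
    HasDerivAt (fun τ => v L τ)
      (-P.c5 * Real.exp (-(P.c2 * L)) * z L t - P.c6 * ψ L 0 t) t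
  /-- `ψ(·, ·, t) ∈ L²` at every time -/
  ψ_memLp : ∀ t, 0 ≤ t →
    MemLp (fun q : ℝ × ℝ => ψ q.1 q.2 t) 2 (volume.restrict (Icc 0 L ×ˢ Icc 0 D))
  /-- `ψ_t = ψ_s`, with `ψ` in `H¹` with respect to `(s, t)` and `L²` with respect to `x` -/
  ψ_eq : ∃ ψs ψt : ℝ → ℝ → ℝ → ℝ,
    (∀ T, MemLp (fun q : ℝ × ℝ × ℝ => ψ q.1 q.2.1 q.2.2) 2
      (volume.restrict (Icc 0 L ×ˢ Icc 0 D ×ˢ Icc 0 T))) ∧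
    (∀ T, MemLp (fun q : ℝ × ℝ × ℝ => ψs q.1 q.2.1 q.2.2) 2
      (volume.restrict (Icc 0 L ×ˢ Icc 0 D ×ˢ Icc 0 T))) ∧
    (∀ T, MemLp (fun q : ℝ × ℝ × ℝ => ψt q.1 q.2.1 q.2.2) 2
      (volume.restrict (Icc 0 L ×ˢ Icc 0 D ×ˢ Icc 0 T))) ∧
    AEAndOutlet L fun x => HasStrongDeriv D (ψ x) (ψs x) (ψt x) ∧
      ∀ᵐ q : ℝ × ℝ ∂(volume.restrict (Icc 0 D ×ˢ Ici 0)), ψt x q.1 q.2 = ψs x q.1 q.2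
  /-- `ψ(x, D, t) = u(x, t)` with the feedback law for `u` -/
  actuator : AEAndOutlet L fun x => ∀ t, 0 ≤ t →
    ψ x D t = control P L D k (fun y => z y t) (fun y => v y t) (fun y s => ψ y s t) x
  z_init : ∀ x ∈ Icc 0 L, z x 0 = z₀ x
  v_init : ∀ x ∈ Icc 0 L, v x 0 = v₀ x
  ψ_init : AEAndOutlet L fun x => ∀ s ∈ Icc 0 D, ψ x s 0 = ϑ₀ x s

/-- `‖z‖² + ‖v‖² + |v(L)|² + ‖φ‖² + ‖φ(L, ·)‖²`, all norms being `L²` norms. -/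
def energy (L D : ℝ) (z v : ℝ → ℝ) (φ : ℝ → ℝ → ℝ) : ℝ :=
  (∫ x in (0 : ℝ)..L, z x ^ 2) + (∫ x in (0 : ℝ)..L, v x ^ 2) + v L ^ 2
    + (∫ x in (0 : ℝ)..L, ∫ s in (0 : ℝ)..D, φ x s ^ 2) + ∫ s in (0 : ℝ)..D, φ L s ^ 2

end ARZ

end

namespace ARZ

/-! ### Fubini on plane regions and along sheared lines -/

/-! Write f(x,t) = ψ(x,0,t) for the actuation that reaches the plant. The delay-free law c₆ f = k v
- c₅ e^{-c₂x} z cancels the coupling in the v-equation, so v decays like e^{-kt} along the lines x +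
c₄t = const and at the outlet. For z it leaves z_t + c₁ z_x = c₁c₂ z - (c₃k/c₆) e^{c₂x} v. This z
grows along x - c₁t = const, but each such line stays in [0, L] for a time at most L/c₁ and starts,
once the initial profile has left, from the decaying value -c₇ v(0,t). Hence the state decays at
rate k, and its squared norms at rate 2k.

The feedback is an exact predictor of this law: c₆ u(x,t) = k v(x,t+D) - c₅ e^{-c₂x} z(x,t+D). To
see this, z and v at (x,t+D) are followed backwards along their characteristics to time t
(`MildPlant.control_middle`, `MildPlant.control_outlet`, `MildPlant.control_inlet`). The equation of
v leaves an integral of z along a v-characteristic. Sweeping the region below that line by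
z-characteristics (`MildPlant.green`), with a weight depending only on the z-label, turns it into z
at time t and a double integral of past actuation. Near the outlet the v-characteristic leaves [0,
L] and the outlet equation takes over. Near the inlet the z-characteristic is reflected into a
v-characteristic, and the remaining integral of z is given by `conservation_law`: c₅ e^{-c₂x} z -
c₁c₂ v has a balance law without actuation and without flux at x = 0. Since f(·,t+D) = u(·,t), the
delay-free law holds from time D on (`IsClosedLoopSolution.actuation_eq`).

On [0, D] the actuation is the initial content of the delay line, and the state is bounded by the
initial energy (`exists_first_interval_bound`); from time D on it decays (`exists_plant_decay`). The
delay line at time t holds f on [t, t+D], which is controlled by the state through the delay-free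
law (`exists_actuation_decay`).

Since the actuation is only L² in x, equations along characteristics are available for almost every
label (`HasStrongDeriv.ae_characteristic`). L² estimates bound the squared state by an integrable
function of the label, plus a constant where necessary, and then change variables affinely.
Pointwise identities in t follow from almost everywhere ones by continuity. -/

theorem measurePreserving_shear (c : ℝ) :
    MeasurePreserving (fun q : ℝ × ℝ => (q.1 + c * q.2, q.2)) volume volume := by
  have h : MeasurePreserving (fun p : ℝ × ℝ => (id p.1, p.2 + c * p.1))
      (volume.prod volume) (volume.prod volume) := by
    refine (MeasurePreserving.id volume).skew_product (g := fun a b => b + c * a) ?_ ?_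
    · simp only [Function.uncurry_def]; fun_prop
    · exact Filter.Eventually.of_forall fun a => (measurePreserving_add_right volume (c * a)).map_eq
  -- The skew product shears the second coordinate; conjugation with the swap shears the first.
  have hs := Measure.measurePreserving_swap (μ := (volume : Measure ℝ)) (ν := (volume : Measure ℝ))
  exact hs.comp (h.comp hs)

theorem integrable_shear (c : ℝ) {g : ℝ × ℝ → ℝ} (hg : Integrable g) :
    Integrable (fun q : ℝ × ℝ => g (q.1 + c * q.2, q.2)) :=
  (measurePreserving_shear c).integrable_comp_of_integrable hg

theorem integral_shear (c : ℝ) {g : ℝ × ℝ → ℝ} (hg : Integrable g) :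
    ∫ q : ℝ × ℝ, g (q.1 + c * q.2, q.2) = ∫ q, g q := by
  have h := measurePreserving_shear c
  have key := integral_map (μ := volume) h.measurable.aemeasurable (f := g)
    (by rw [h.map_eq]; exact hg.aestronglyMeasurable)
  rw [h.map_eq] at key
  exact key.symm

/-- Exchange of the order of integration over a plane region given by strict inequalities in
either order of the variables. -/
theorem integral_swap_region {a b c d : ℝ} {α β lo hi : ℝ → ℝ} {H : ℝ → ℝ → ℝ}
    (hα : Measurable α) (hβ : Measurable β) (hab : a ≤ b) (hcd : c ≤ d)
    (hαβ : ∀ x ∈ Ioo a b, α x ≤ β x) (hlh : ∀ t ∈ Ioo c d, lo t ≤ hi t)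
    (hiff : ∀ x t, (x ∈ Ioo a b ∧ t ∈ Ioo (α x) (β x)) ↔ (t ∈ Ioo c d ∧ x ∈ Ioo (lo t) (hi t)))
    (hint : IntegrableOn (Function.uncurry H) {q | q.1 ∈ Ioo a b ∧ q.2 ∈ Ioo (α q.1) (β q.1)}) :
    ∫ x in a..b, ∫ t in (α x)..(β x), H x t = ∫ t in c..d, ∫ x in (lo t)..(hi t), H x t := by
  -- Both iterated integrals equal the plane integral of the indicator of Ω; passing to open
  -- intervals costs nothing.
  set Ω : Set (ℝ × ℝ) := {q | q.1 ∈ Ioo a b ∧ q.2 ∈ Ioo (α q.1) (β q.1)} with hΩ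
  have hmeas : MeasurableSet Ω := by
    refine (measurableSet_Ioo.preimage measurable_fst).inter
      ((measurableSet_lt (hα.comp measurable_fst) measurable_snd).inter
        (measurableSet_lt measurable_snd (hβ.comp measurable_fst)))
  have hi' : Integrable (Function.uncurry fun x t => Ω.indicator (Function.uncurry H) (x, t))
      (volume.prod volume) := by
    exact (integrable_indicator_iff hmeas).2 hint
  have key := integral_integral_swap hi'
  have h1 : ∫ x in a..b, ∫ t in (α x)..(β x), H x t
      = ∫ x, ∫ t, Ω.indicator (Function.uncurry H) (x, t) := by
    rw [intervalIntegral.integral_of_le hab, integral_Ioc_eq_integral_Ioo,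
      ← integral_indicator measurableSet_Ioo]
    congr 1; ext x
    by_cases hx : x ∈ Ioo a b
    · rw [indicator_of_mem hx, intervalIntegral.integral_of_le (hαβ x hx),
        integral_Ioc_eq_integral_Ioo, ← integral_indicator measurableSet_Ioo]
      congr 1; ext t
      by_cases ht : t ∈ Ioo (α x) (β x)
      · rw [indicator_of_mem ht, indicator_of_mem (show (x, t) ∈ Ω from ⟨hx, ht⟩)]; rfl
      · rw [indicator_of_notMem ht, indicator_of_notMem (fun h => ht h.2)]
    · rw [indicator_of_notMem hx]
      have : ∀ t, Ω.indicator (Function.uncurry H) (x, t) = 0 := fun t =>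
        indicator_of_notMem (fun h => hx h.1) _
      simp [this]
  have h2 : ∫ t in c..d, ∫ x in (lo t)..(hi t), H x t
      = ∫ t, ∫ x, Ω.indicator (Function.uncurry H) (x, t) := by
    rw [intervalIntegral.integral_of_le hcd, integral_Ioc_eq_integral_Ioo,
      ← integral_indicator measurableSet_Ioo]
    congr 1; ext t
    by_cases ht : t ∈ Ioo c d
    · rw [indicator_of_mem ht, intervalIntegral.integral_of_le (hlh t ht),
        integral_Ioc_eq_integral_Ioo, ← integral_indicator measurableSet_Ioo]
      congr 1; ext x
      by_cases hx : x ∈ Ioo (lo t) (hi t)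
      · rw [indicator_of_mem hx,
          indicator_of_mem (show (x, t) ∈ Ω from (hiff x t).2 ⟨ht, hx⟩)]; rfl
      · rw [indicator_of_notMem hx, indicator_of_notMem (show (x, t) ∉ Ω from fun h => hx ((hiff x t).1 h).2)]
    · rw [indicator_of_notMem ht]
      have : ∀ x, Ω.indicator (Function.uncurry H) (x, t) = 0 := fun x =>
        indicator_of_notMem (show (x, t) ∉ Ω from fun h => ht ((hiff x t).1 h).1) _
      simp [this]
  rw [h1, h2, key]

/-- The restriction of an integrable function on a rectangle to almost every vertical line. -/
theorem ae_intervalIntegrable_right {A : ℝ} {g : ℝ → ℝ → ℝ}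
    (hg : ∀ T, IntegrableOn (Function.uncurry g) (Icc 0 A ×ˢ Icc 0 T)) :
    ∀ᵐ x ∂(volume.restrict (Icc 0 A)), ∀ t₁ ∈ Ici (0 : ℝ), ∀ t₂ ∈ Ici (0 : ℝ),
      IntervalIntegrable (g x) volume t₁ t₂ := by
  -- Integer horizons exhaust the half-strip, so one null set of positions serves for all times.
  have h : ∀ n : ℕ, ∀ᵐ x ∂(volume.restrict (Icc 0 A)), IntegrableOn (g x) (Icc 0 (n : ℝ)) := by
    intro n
    have := hg n
    rw [IntegrableOn, Measure.volume_eq_prod, ← Measure.prod_restrict] at this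
    exact this.prod_right_ae
  filter_upwards [ae_all_iff.2 h] with x hx t₁ h₁ t₂ h₂
  obtain ⟨n, hn⟩ := exists_nat_ge (max t₁ t₂)
  refine ((hx n).mono_set ?_).intervalIntegrable
  intro s hs
  rw [mem_uIcc] at hs
  simp only [mem_Ici, max_le_iff, mem_Icc] at *
  rcases hs with h | h <;> constructor <;> linarith

theorem ae_intervalIntegrable_left {A : ℝ} {g : ℝ → ℝ → ℝ}
    (hg : ∀ T, IntegrableOn (Function.uncurry g) (Icc 0 A ×ˢ Icc 0 T)) :
    ∀ᵐ t ∂(volume.restrict (Ici (0 : ℝ))), ∀ x₁ ∈ Icc 0 A, ∀ x₂ ∈ Icc 0 A,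
      IntervalIntegrable (fun x => g x t) volume x₁ x₂ := by
  have h : ∀ n : ℕ, ∀ᵐ t ∂(volume : Measure ℝ), t ∈ Icc 0 (n : ℝ) →
      IntegrableOn (fun x => g x t) (Icc 0 A) := by
    intro n
    rw [← ae_restrict_iff' measurableSet_Icc]
    have := hg n
    rw [IntegrableOn, Measure.volume_eq_prod, ← Measure.prod_restrict] at this
    exact this.prod_left_ae
  rw [ae_restrict_iff' measurableSet_Ici]
  filter_upwards [ae_all_iff.2 h] with t ht ht0 x₁ h₁ x₂ h₂
  obtain ⟨n, hn⟩ := exists_nat_ge t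
  exact ((ht n ⟨ht0, hn⟩).mono_set (uIcc_subset_Icc h₁ h₂)).intervalIntegrable

theorem HasStrongDeriv.integrableOn_fx {A : ℝ} {f fx ft : ℝ → ℝ → ℝ}
    (h : HasStrongDeriv A f fx ft) (T : ℝ) :
    IntegrableOn (Function.uncurry fx) (Icc 0 A ×ˢ Icc 0 T) := by
  have : IsFiniteMeasure (volume.restrict (Icc 0 A ×ˢ Icc 0 T) : Measure (ℝ × ℝ)) :=
    ⟨by simpa using (isCompact_Icc.prod isCompact_Icc).measure_lt_top⟩
  exact (h.memLp_fx T).integrable (by norm_num)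

theorem HasStrongDeriv.integrableOn_ft {A : ℝ} {f fx ft : ℝ → ℝ → ℝ}
    (h : HasStrongDeriv A f fx ft) (T : ℝ) :
    IntegrableOn (Function.uncurry ft) (Icc 0 A ×ˢ Icc 0 T) := by
  have : IsFiniteMeasure (volume.restrict (Icc 0 A ×ˢ Icc 0 T) : Measure (ℝ × ℝ)) :=
    ⟨by simpa using (isCompact_Icc.prod isCompact_Icc).measure_lt_top⟩
  exact (h.memLp_ft T).integrable (by norm_num)

theorem HasStrongDeriv.sub_eq_ft {A : ℝ} {f fx ft : ℝ → ℝ → ℝ} (h : HasStrongDeriv A f fx ft) :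
    ∀ᵐ x ∂(volume.restrict (Icc 0 A)), ∀ t₁ ∈ Ici (0 : ℝ), ∀ t₂ ∈ Ici (0 : ℝ),
      ∫ τ in t₁..t₂, ft x τ = f x t₂ - f x t₁ := by
  filter_upwards [h.eq_ft, ae_intervalIntegrable_right h.integrableOn_ft] with x hx hi t₁ h₁ t₂ h₂
  rw [hx t₂ h₂, hx t₁ h₁, ← intervalIntegral.integral_interval_sub_left
    (hi 0 self_mem_Ici t₂ h₂) (hi 0 self_mem_Ici t₁ h₁)]
  ring

theorem HasStrongDeriv.sub_eq_fx {A : ℝ} {f fx ft : ℝ → ℝ → ℝ} (h : HasStrongDeriv A f fx ft) :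
    ∀ᵐ t ∂(volume.restrict (Ici (0 : ℝ))), ∀ x₁ ∈ Icc 0 A, ∀ x₂ ∈ Icc 0 A,
      ∫ ξ in x₁..x₂, fx ξ t = f x₂ t - f x₁ t := by
  filter_upwards [h.eq_fx, ae_intervalIntegrable_left h.integrableOn_fx] with t ht hi x₁ h₁ x₂ h₂
  have h0 : (0 : ℝ) ∈ Icc 0 A := ⟨le_rfl, h₁.1.trans h₁.2⟩
  rw [ht x₂ h₂, ht x₁ h₁, ← intervalIntegral.integral_interval_sub_left
    (hi 0 h0 x₂ h₂) (hi 0 h0 x₁ h₁)]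
  ring

end ARZ

/-! ### The transport theorem for integrals with a moving endpoint. -/

namespace ARZ

theorem continuousOn_comp_path {A : ℝ} {f : ℝ → ℝ → ℝ}
    (hf : ContinuousOn (Function.uncurry f) (Icc 0 A ×ˢ Ici 0)) {s : Set ℝ} {p q : ℝ → ℝ}
    (hp : ContinuousOn p s) (hq : ContinuousOn q s) (hps : ∀ r ∈ s, p r ∈ Icc 0 A)
    (hqs : ∀ r ∈ s, 0 ≤ q r) : ContinuousOn (fun r => f (p r) (q r)) s :=
  hf.comp (hp.prodMk hq) fun r hr => ⟨hps r hr, hqs r hr⟩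

/-- The transport theorem for the integral over `[0, b + c t]`. -/
theorem integral_moving_endpoint {A b c t₁ t₂ : ℝ} {f ft : ℝ → ℝ → ℝ} (hc : c ≠ 0)
    (hcont : ContinuousOn (Function.uncurry f) (Icc 0 A ×ˢ Ici 0))
    (hint : ∀ T, IntegrableOn (Function.uncurry ft) (Icc 0 A ×ˢ Icc 0 T))
    (hft : ∀ᵐ x ∂(volume.restrict (Icc 0 A)), ∀ t₁ ∈ Ici (0 : ℝ), ∀ t₂ ∈ Ici (0 : ℝ),
      ∫ τ in t₁..t₂, ft x τ = f x t₂ - f x t₁)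
    (h0 : 0 ≤ t₁) (h12 : t₁ ≤ t₂) (hb₁ : b + c * t₁ ∈ Icc 0 A) (hb₂ : b + c * t₂ ∈ Icc 0 A) :
    (∫ t in t₁..t₂, ∫ x in (0 : ℝ)..(b + c * t), ft x t) + c * ∫ t in t₁..t₂, f (b + c * t) t
      = (∫ x in (0 : ℝ)..(b + c * t₂), f x t₂) - ∫ x in (0 : ℝ)..(b + c * t₁), f x t₁ := by
  rw [ae_restrict_iff' measurableSet_Icc] at hft
  -- The moving endpoint is a graph over x: it passes x at time (x - b)/c.
  have hsub : c * ∫ t in t₁..t₂, f (b + c * t) t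
      = ∫ x in (b + c * t₁)..(b + c * t₂), f x ((x - b) / c) := by
    rw [← intervalIntegral.smul_integral_comp_add_mul, smul_eq_mul]
    congr 2; ext t; congr 1; field_simp; ring
  rw [hsub]
  have hcpath : ∀ {u w : ℝ} {q : ℝ → ℝ}, u ∈ Icc 0 A → w ∈ Icc 0 A → Continuous q →
      (∀ x ∈ uIcc u w, 0 ≤ q x) → IntervalIntegrable (fun x => f x (q x)) volume u w := by
    intro u w q hu hw hq hq0
    exact (continuousOn_comp_path hcont continuousOn_id hq.continuousOn
      (fun x hx => uIcc_subset_Icc hu hw hx) hq0).intervalIntegrable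
  have hA : (0 : ℝ) ∈ Icc 0 A := ⟨le_rfl, hb₁.1.trans hb₁.2⟩
  -- After exchanging the integrals, a position x leaves the domain at min t₂ ((x - b)/c) if c < 0
  -- and enters it at max t₁ ((x - b)/c) if c > 0.
  rcases lt_or_gt_of_ne hc with hneg | hpos
  · have hb : b + c * t₂ ≤ b + c * t₁ := by nlinarith
    have hdiv : ∀ x t : ℝ, t < (x - b) / c ↔ x < b + c * t := fun x t => by
      rw [lt_div_iff_of_neg hneg]; constructor <;> intro h <;> linarith
    have hdiv' : ∀ x t : ℝ, t ≤ (x - b) / c ↔ x ≤ b + c * t := fun x t => by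
      rw [le_div_iff_of_neg hneg]; constructor <;> intro h <;> linarith
    have hdiv'' : ∀ x t : ℝ, (x - b) / c ≤ t ↔ b + c * t ≤ x := fun x t => by
      rw [div_le_iff_of_neg hneg]; constructor <;> intro h <;> linarith
    have hswap := integral_swap_region (a := 0) (b := b + c * t₁) (c := t₁) (d := t₂)
      (α := fun _ => t₁) (β := fun x => min t₂ ((x - b) / c)) (lo := fun _ => 0)
      (hi := fun t => b + c * t) (H := ft) (by fun_prop) (by fun_prop) hb₁.1 h12
      (fun x hx => le_min h12 ((hdiv' _ _).2 hx.2.le))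
      (fun t ht => by have := hb₂.1; nlinarith [ht.2])
      (fun x t => by
        simp only [mem_Ioo, lt_min_iff, hdiv]
        constructor
        · rintro ⟨⟨h1, h2⟩, h3, h4, h5⟩; exact ⟨⟨h3, h4⟩, h1, h5⟩
        · rintro ⟨⟨h3, h4⟩, h1, h5⟩; exact ⟨⟨h1, by nlinarith⟩, h3, h4, h5⟩)
      ((hint t₂).mono_set (by
        rintro ⟨x, t⟩ ⟨⟨h1, h2⟩, h3, h4⟩
        rw [lt_min_iff] at h4
        exact ⟨⟨h1.le, h2.le.trans hb₁.2⟩, h0.trans h3.le, h4.1.le⟩))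
    rw [← hswap]
    have h1 : ∫ x in (0 : ℝ)..(b + c * t₁), ∫ t in t₁..(min t₂ ((x - b) / c)), ft x t
        = ∫ x in (0 : ℝ)..(b + c * t₁), (f x (min t₂ ((x - b) / c)) - f x t₁) := by
      refine intervalIntegral.integral_congr_ae ?_
      filter_upwards [hft] with x hx hx'
      rw [uIoc_of_le hb₁.1] at hx'
      exact hx ⟨hx'.1.le, hx'.2.trans hb₁.2⟩ t₁ h0 _
        (le_min (h0.trans h12) (h0.trans ((hdiv' _ _).2 hx'.2)))
    have hmin : ∀ x ∈ uIcc 0 (b + c * t₁), 0 ≤ min t₂ ((x - b) / c) := fun x hx => by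
      rw [uIcc_of_le hb₁.1] at hx
      exact le_min (h0.trans h12) (h0.trans ((hdiv' _ _).2 hx.2))
    have hq : Continuous fun x : ℝ => min t₂ ((x - b) / c) := by fun_prop
    rw [h1, intervalIntegral.integral_sub (hcpath hA hb₁ hq hmin)
      (hcpath hA hb₁ continuous_const fun _ _ => h0),
      ← intervalIntegral.integral_add_adjacent_intervals (b := b + c * t₂)
        (hcpath hA hb₂ hq fun x hx => hmin x (uIcc_subset_uIcc_left (by
          rw [uIcc_of_le hb₁.1]; exact ⟨hb₂.1, hb⟩) hx))
        (hcpath hb₂ hb₁ hq fun x hx => hmin x (uIcc_subset_uIcc_right (by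
          rw [uIcc_of_le hb₁.1]; exact ⟨hb₂.1, hb⟩) hx))]
    have h2 : ∫ x in (0 : ℝ)..(b + c * t₂), f x (min t₂ ((x - b) / c))
        = ∫ x in (0 : ℝ)..(b + c * t₂), f x t₂ :=
      intervalIntegral.integral_congr fun x hx => by
        rw [uIcc_of_le hb₂.1] at hx
        simp only [min_eq_left ((hdiv' _ _).2 hx.2)]
    have h3 : ∫ x in (b + c * t₂)..(b + c * t₁), f x (min t₂ ((x - b) / c))
        = ∫ x in (b + c * t₂)..(b + c * t₁), f x ((x - b) / c) :=
      intervalIntegral.integral_congr fun x hx => by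
        rw [uIcc_of_le hb] at hx
        simp only [min_eq_right ((hdiv'' _ _).2 hx.1)]
    rw [h2, h3, intervalIntegral.integral_symm (b + c * t₁) (b + c * t₂)]
    ring
  · have hb : b + c * t₁ ≤ b + c * t₂ := by nlinarith
    have hdiv : ∀ x t : ℝ, (x - b) / c < t ↔ x < b + c * t := fun x t => by
      rw [div_lt_iff₀ hpos]; constructor <;> intro h <;> linarith
    have hdiv' : ∀ x t : ℝ, (x - b) / c ≤ t ↔ x ≤ b + c * t := fun x t => by
      rw [div_le_iff₀ hpos]; constructor <;> intro h <;> linarith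
    have hdiv'' : ∀ x t : ℝ, t ≤ (x - b) / c ↔ b + c * t ≤ x := fun x t => by
      rw [le_div_iff₀ hpos]; constructor <;> intro h <;> linarith
    have hswap := integral_swap_region (a := 0) (b := b + c * t₂) (c := t₁) (d := t₂)
      (α := fun x => max t₁ ((x - b) / c)) (β := fun _ => t₂) (lo := fun _ => 0)
      (hi := fun t => b + c * t) (H := ft) (by fun_prop) (by fun_prop) hb₂.1 h12
      (fun x hx => max_le h12 ((hdiv' _ _).2 hx.2.le))
      (fun t ht => by have := hb₁.1; nlinarith [ht.1])
      (fun x t => by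
        simp only [mem_Ioo, max_lt_iff, hdiv]
        constructor
        · rintro ⟨⟨h1, h2⟩, ⟨h3, h4⟩, h5⟩; exact ⟨⟨h3, h5⟩, h1, h4⟩
        · rintro ⟨⟨h3, h5⟩, h1, h4⟩; exact ⟨⟨h1, by nlinarith⟩, ⟨h3, h4⟩, h5⟩)
      ((hint t₂).mono_set (by
        rintro ⟨x, t⟩ ⟨⟨h1, h2⟩, h3, h4⟩
        rw [max_lt_iff] at h3
        exact ⟨⟨h1.le, h2.le.trans hb₂.2⟩, h0.trans h3.1.le, h4.le⟩))
    rw [← hswap]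
    have h1 : ∫ x in (0 : ℝ)..(b + c * t₂), ∫ t in (max t₁ ((x - b) / c))..t₂, ft x t
        = ∫ x in (0 : ℝ)..(b + c * t₂), (f x t₂ - f x (max t₁ ((x - b) / c))) := by
      refine intervalIntegral.integral_congr_ae ?_
      filter_upwards [hft] with x hx hx'
      rw [uIoc_of_le hb₂.1] at hx'
      exact hx ⟨hx'.1.le, hx'.2.trans hb₂.2⟩ _ (h0.trans (le_max_left _ _)) t₂ (h0.trans h12)
    have hmax : ∀ x : ℝ, 0 ≤ max t₁ ((x - b) / c) := fun x => h0.trans (le_max_left _ _)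
    have hq : Continuous fun x : ℝ => max t₁ ((x - b) / c) := by fun_prop
    rw [h1, intervalIntegral.integral_sub
      (hcpath hA hb₂ continuous_const fun _ _ => h0.trans h12) (hcpath hA hb₂ hq fun x _ => hmax x),
      ← intervalIntegral.integral_add_adjacent_intervals (b := b + c * t₁)
        (hcpath hA hb₁ hq fun x _ => hmax x) (hcpath hb₁ hb₂ hq fun x _ => hmax x)]
    have h2 : ∫ x in (0 : ℝ)..(b + c * t₁), f x (max t₁ ((x - b) / c))
        = ∫ x in (0 : ℝ)..(b + c * t₁), f x t₁ :=
      intervalIntegral.integral_congr fun x hx => by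
        rw [uIcc_of_le hb₁.1] at hx
        simp only [max_eq_left ((hdiv' _ _).2 hx.2)]
    have h3 : ∫ x in (b + c * t₁)..(b + c * t₂), f x (max t₁ ((x - b) / c))
        = ∫ x in (b + c * t₁)..(b + c * t₂), f x ((x - b) / c) :=
      intervalIntegral.integral_congr fun x hx => by
        rw [uIcc_of_le hb] at hx
        simp only [max_eq_right ((hdiv'' _ _).2 hx.1)]
    rw [h2, h3]
    ring

end ARZ

/-! ### Integration of a transport equation along characteristics, for fixed times. -/

namespace ARZ

theorem intervalIntegrable_region_fst {a b : ℝ} {α β : ℝ → ℝ} {H : ℝ → ℝ → ℝ}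
    (hα : Measurable α) (hβ : Measurable β) (hab : a ≤ b) (hαβ : ∀ x ∈ Ioo a b, α x ≤ β x)
    (hint : IntegrableOn (Function.uncurry H) {q | q.1 ∈ Ioo a b ∧ q.2 ∈ Ioo (α q.1) (β q.1)}) :
    IntervalIntegrable (fun x => ∫ t in (α x)..(β x), H x t) volume a b := by
  set Ω : Set (ℝ × ℝ) := {q | q.1 ∈ Ioo a b ∧ q.2 ∈ Ioo (α q.1) (β q.1)} with hΩ
  have hmeas : MeasurableSet Ω := by
    refine (measurableSet_Ioo.preimage measurable_fst).inter
      ((measurableSet_lt (hα.comp measurable_fst) measurable_snd).inter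
        (measurableSet_lt measurable_snd (hβ.comp measurable_fst)))
  have hi' : Integrable (Ω.indicator (Function.uncurry H)) (volume.prod volume) :=
    (integrable_indicator_iff hmeas).2 hint
  rw [intervalIntegrable_iff_integrableOn_Ioo_of_le hab]
  refine (hi'.integral_prod_left.integrableOn (s := Ioo a b)).congr_fun ?_ measurableSet_Ioo
  intro x hx
  simp only
  rw [intervalIntegral.integral_of_le (hαβ x hx), integral_Ioc_eq_integral_Ioo,
    ← integral_indicator measurableSet_Ioo]
  congr 1; ext t
  by_cases ht : t ∈ Ioo (α x) (β x)
  · rw [indicator_of_mem ht, indicator_of_mem (show (x, t) ∈ Ω from ⟨hx, ht⟩)]; rfl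
  · rw [indicator_of_notMem ht, indicator_of_notMem (show (x, t) ∉ Ω from fun h => ht h.2)]

theorem intervalIntegrable_region_snd {c d : ℝ} {lo hi : ℝ → ℝ} {H : ℝ → ℝ → ℝ}
    (hlo : Measurable lo) (hhi : Measurable hi) (hcd : c ≤ d) (hlh : ∀ t ∈ Ioo c d, lo t ≤ hi t)
    (hint : IntegrableOn (Function.uncurry H) {q | q.2 ∈ Ioo c d ∧ q.1 ∈ Ioo (lo q.2) (hi q.2)}) :
    IntervalIntegrable (fun t => ∫ x in (lo t)..(hi t), H x t) volume c d := by
  refine intervalIntegrable_region_fst (H := fun t x => H x t) hlo hhi hcd hlh ?_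
  have h := (Measure.measurePreserving_swap (μ := (volume : Measure ℝ))
    (ν := (volume : Measure ℝ))).integrableOn_comp_preimage
    (MeasurableEquiv.prodComm.measurableEmbedding) (f := Function.uncurry H)
    (s := {q | q.2 ∈ Ioo c d ∧ q.1 ∈ Ioo (lo q.2) (hi q.2)})
  exact h.2 hint

/-- An integrable function on a rectangle, in the coordinates `(x - c t, t)`. -/
theorem integrableOn_shear {A T : ℝ} (c : ℝ) {g : ℝ → ℝ → ℝ}
    (hg : IntegrableOn (Function.uncurry g) (Icc 0 A ×ˢ Icc 0 T)) :
    IntegrableOn (fun q : ℝ × ℝ => g (q.1 + c * q.2) q.2)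
      {q | q.1 + c * q.2 ∈ Icc 0 A ∧ q.2 ∈ Icc 0 T} := by
  have hm : MeasurableSet {q : ℝ × ℝ | q.1 + c * q.2 ∈ Icc 0 A ∧ q.2 ∈ Icc 0 T} :=
    (measurableSet_Icc.preimage (f := fun q : ℝ × ℝ => q.1 + c * q.2) (by fun_prop)).inter
      (measurableSet_Icc.preimage measurable_snd)
  have h := integrable_shear c
    ((integrable_indicator_iff (measurableSet_Icc.prod measurableSet_Icc)).2 hg)
  rw [← integrable_indicator_iff hm]
  exact h

/-- In the coordinates (x - ct, t) the characteristics are vertical, so Fubini applies; integer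
horizons give one null set of labels for all times. -/
theorem ae_intervalIntegrable_line {A : ℝ} (c : ℝ) {g : ℝ → ℝ → ℝ}
    (hg : ∀ T, IntegrableOn (Function.uncurry g) (Icc 0 A ×ˢ Icc 0 T)) :
    ∀ᵐ l : ℝ, ∀ t₁ t₂ : ℝ, 0 ≤ t₁ → t₁ ≤ t₂ → l + c * t₁ ∈ Icc 0 A → l + c * t₂ ∈ Icc 0 A →
      IntervalIntegrable (fun τ => g (l + c * τ) τ) volume t₁ t₂ := by
  have h : ∀ n : ℕ, ∀ᵐ l : ℝ,
      IntegrableOn (fun τ => g (l + c * τ) τ) {τ | l + c * τ ∈ Icc 0 A ∧ τ ∈ Icc 0 (n : ℝ)} := by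
    intro n
    have hm : MeasurableSet {q : ℝ × ℝ | q.1 + c * q.2 ∈ Icc 0 A ∧ q.2 ∈ Icc 0 (n : ℝ)} :=
      (measurableSet_Icc.preimage (f := fun q : ℝ × ℝ => q.1 + c * q.2) (by fun_prop)).inter
        (measurableSet_Icc.preimage measurable_snd)
    have h1 := ((integrable_indicator_iff hm).2 (integrableOn_shear c (hg n))).prod_right_ae
    filter_upwards [h1] with l hl
    have hm' : MeasurableSet {τ : ℝ | l + c * τ ∈ Icc 0 A ∧ τ ∈ Icc 0 (n : ℝ)} :=
      (measurableSet_Icc.preimage (f := fun τ : ℝ => l + c * τ) (by fun_prop)).inter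
        measurableSet_Icc
    rw [← integrable_indicator_iff hm']
    exact hl
  filter_upwards [ae_all_iff.2 h] with l hl t₁ t₂ h0 h12 hl₁ hl₂
  obtain ⟨n, hn⟩ := exists_nat_ge t₂
  rw [intervalIntegrable_iff_integrableOn_Icc_of_le h12]
  refine (hl n).mono_set fun τ hτ => ⟨?_, h0.trans hτ.1, hτ.2.trans hn⟩
  rcases le_total 0 c with hc | hc
  · exact ⟨hl₁.1.trans (by nlinarith [hτ.1]), le_trans (by nlinarith [hτ.2]) hl₂.2⟩
  · exact ⟨hl₂.1.trans (by nlinarith [hτ.2]), le_trans (by nlinarith [hτ.1]) hl₁.2⟩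

theorem mem_Icc_line {A c l t₁ t₂ τ : ℝ} (h₁ : l + c * t₁ ∈ Icc 0 A) (h₂ : l + c * t₂ ∈ Icc 0 A)
    (hτ : τ ∈ Icc t₁ t₂) : l + c * τ ∈ Icc 0 A := by
  rcases le_total 0 c with hc | hc
  · exact ⟨h₁.1.trans (by nlinarith [hτ.1]), le_trans (by nlinarith [hτ.2]) h₂.2⟩
  · exact ⟨h₂.1.trans (by nlinarith [hτ.2]), le_trans (by nlinarith [hτ.1]) h₁.2⟩

theorem ae_ae_time_space {A : ℝ} {p : ℝ × ℝ → Prop}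
    (h : ∀ᵐ q ∂(volume.restrict (Icc 0 A ×ˢ Ici (0 : ℝ))), p q) :
    ∀ᵐ t ∂(volume.restrict (Ici (0 : ℝ))), ∀ᵐ x ∂(volume.restrict (Icc 0 A)), p (x, t) := by
  rw [Measure.volume_eq_prod, ← Measure.prod_restrict] at h
  have h' := (Measure.measurePreserving_swap (μ := volume.restrict (Ici (0 : ℝ)))
    (ν := volume.restrict (Icc 0 A))).quasiMeasurePreserving.ae h
  exact Measure.ae_ae_of_ae_prod h'

/-- If `f_t + c f_x = G`, then `f` is the integral of `G` along almost every characteristic, as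
far as a fixed pair of times is concerned. -/
theorem HasStrongDeriv.characteristic_fixed {A c t₁ t₂ : ℝ} (hc : c ≠ 0) {f fx ft G : ℝ → ℝ → ℝ}
    (h : HasStrongDeriv A f fx ft)
    (hGint : ∀ T, IntegrableOn (Function.uncurry G) (Icc 0 A ×ˢ Icc 0 T))
    (hG : ∀ᵐ q : ℝ × ℝ ∂(volume.restrict (Icc 0 A ×ˢ Ici 0)),
      ft q.1 q.2 = -c * fx q.1 q.2 + G q.1 q.2) (h0 : 0 ≤ t₁) (h12 : t₁ ≤ t₂) :
    ∀ᵐ l : ℝ, l + c * t₁ ∈ Icc 0 A → l + c * t₂ ∈ Icc 0 A →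
      ∫ τ in t₁..t₂, G (l + c * τ) τ = f (l + c * t₂) t₂ - f (l + c * t₁) t₁ := by
  -- The labels whose characteristic lies in [0, A] at both times form the interval [p, q].
  set p := max (-(c * t₁)) (-(c * t₂)) with hp
  set q := min (A - c * t₁) (A - c * t₂) with hq
  have hJ : ∀ l, l ∈ Icc p q ↔ (l + c * t₁ ∈ Icc 0 A ∧ l + c * t₂ ∈ Icc 0 A) := by
    intro l
    simp only [hp, hq, mem_Icc, max_le_iff, le_min_iff]
    constructor
    · rintro ⟨⟨h1, h2⟩, h3, h4⟩; refine ⟨⟨?_, ?_⟩, ?_, ?_⟩ <;> linarith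
    · rintro ⟨⟨h1, h2⟩, h3, h4⟩; refine ⟨⟨?_, ?_⟩, ?_, ?_⟩ <;> linarith
  rcases lt_or_ge q p with hqp | hpq
  · refine Filter.Eventually.of_forall fun l h1 h2 => ?_
    have := (hJ l).2 ⟨h1, h2⟩
    exact absurd (this.1.trans this.2) (not_le.2 hqp)
  have hpJ := (hJ p).1 ⟨le_rfl, hpq⟩
  have hqJ := (hJ q).1 ⟨hpq, le_rfl⟩
  have hA : (0 : ℝ) ∈ Icc 0 A := ⟨le_rfl, hpJ.1.1.trans hpJ.1.2⟩
  have hdom : ∀ b ∈ Icc p q, ∀ t ∈ Icc t₁ t₂, b + c * t ∈ Icc 0 A := fun b hb t ht =>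
    mem_Icc_line ((hJ b).1 hb).1 ((hJ b).1 hb).2 ht
  -- the label coordinates
  have hlab : IntegrableOn (fun s : ℝ × ℝ => G (s.1 + c * s.2) s.2) (Icc p q ×ˢ Icc t₁ t₂) :=
    (integrableOn_shear c (hGint t₂)).mono_set fun s hs =>
      ⟨hdom _ hs.1 _ hs.2, h0.trans hs.2.1, hs.2.2⟩
  have hGline : IntervalIntegrable (fun l => ∫ τ in t₁..t₂, G (l + c * τ) τ) volume p q := by
    refine intervalIntegrable_region_fst (α := fun _ => t₁) (β := fun _ => t₂)
      (H := fun l τ => G (l + c * τ) τ) (by fun_prop) (by fun_prop) hpq (fun _ _ => h12) ?_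
    exact hlab.mono_set fun s hs => ⟨Ioo_subset_Icc_self hs.1, Ioo_subset_Icc_self hs.2⟩
  have hfline : ∀ t ∈ Icc t₁ t₂, ContinuousOn (fun l => f (l + c * t) t) (Icc p q) := fun t ht =>
    continuousOn_comp_path h.continuousOn (by fun_prop) (by fun_prop)
      (fun l hl => hdom l hl t ht) fun _ _ => h0.trans ht.1
  have hT1 : t₁ ∈ Icc t₁ t₂ := ⟨le_rfl, h12⟩
  have hT2 : t₂ ∈ Icc t₁ t₂ := ⟨h12, le_rfl⟩
  -- Φ is the defect of the claimed identity. Its primitive vanishes on [p, q], so Φ vanishes almost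
  -- everywhere by Lebesgue differentiation.
  set Φ : ℝ → ℝ := fun l => (f (l + c * t₂) t₂ - f (l + c * t₁) t₁)
    - ∫ τ in t₁..t₂, G (l + c * τ) τ with hΦ
  have hfi : ∀ t ∈ Icc t₁ t₂, ∀ b ∈ Icc p q,
      IntervalIntegrable (fun l => f (l + c * t) t) volume p b := fun t ht b hb =>
    ((hfline t ht).mono (by rw [uIcc_of_le hb.1]; exact Icc_subset_Icc_right hb.2)).intervalIntegrable
  have hsub : ∀ b ∈ Icc p q, uIcc p b ⊆ uIcc p q := fun b hb => by
    rw [uIcc_of_le hb.1, uIcc_of_le hpq]; exact Icc_subset_Icc_right hb.2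
  have hΦi : IntervalIntegrable Φ volume p q :=
    ((hfi _ hT2 q ⟨hpq, le_rfl⟩).sub (hfi _ hT1 q ⟨hpq, le_rfl⟩)).sub hGline
  have hzero : ∀ b ∈ Icc p q, ∫ l in p..b, Φ l = 0 := by
    intro b hb
    have hbJ := (hJ b).1 hb
    have hend : ∀ b ∈ Icc p q, _ := fun b hb => integral_moving_endpoint (b := b) hc
      h.continuousOn h.integrableOn_ft h.sub_eq_ft h0 h12 ((hJ b).1 hb).1 ((hJ b).1 hb).2
    have e1 := hend b hb
    have e2 := hend p ⟨le_rfl, hpq⟩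
    have hreg : ∀ b ∈ Icc p q,
        IntervalIntegrable (fun t => ∫ x in (0 : ℝ)..(b + c * t), ft x t) volume t₁ t₂ := by
      intro b hb
      refine intervalIntegrable_region_snd (lo := fun _ => 0) (hi := fun t => b + c * t)
        (by fun_prop) (by fun_prop) h12
        (fun t ht => (hdom b hb t (Ioo_subset_Icc_self ht)).1)
        ((h.integrableOn_ft t₂).mono_set ?_)
      rintro ⟨x, t⟩ ⟨ht, hx⟩
      exact ⟨⟨hx.1.le, hx.2.le.trans (hdom b hb t (Ioo_subset_Icc_self ht)).2⟩,
        h0.trans ht.1.le, ht.2.le⟩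
    have hfl : ∀ b ∈ Icc p q, IntervalIntegrable (fun t => f (b + c * t) t) volume t₁ t₂ := by
      intro b hb
      refine ContinuousOn.intervalIntegrable ?_
      rw [uIcc_of_le h12]
      exact continuousOn_comp_path h.continuousOn (by fun_prop) continuousOn_id
        (fun t ht => hdom b hb t ht) fun t ht => h0.trans ht.1
    have hpm : p ∈ Icc p q := ⟨le_rfl, hpq⟩
    -- The difference of the transport identities with endpoints b + ct and p + ct lives on the
    -- strip between these lines, where the equation replaces f_t + c f_x by G.
    have hL : (∫ l in p..b, ∫ τ in t₁..t₂, G (l + c * τ) τ)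
        = ∫ t in t₁..t₂, (((∫ x in (0 : ℝ)..(b + c * t), ft x t) + c * f (b + c * t) t)
          - ((∫ x in (0 : ℝ)..(p + c * t), ft x t) + c * f (p + c * t) t)) := by
      rw [integral_swap_region (α := fun _ => t₁) (β := fun _ => t₂) (c := t₁) (d := t₂)
        (lo := fun _ => p) (hi := fun _ => b)
        (H := fun l τ => G (l + c * τ) τ) (by fun_prop) (by fun_prop) hb.1 h12 (fun _ _ => h12)
        (fun _ _ => hb.1) (fun x t => and_comm) (hlab.mono_set fun s hs =>
          ⟨⟨hs.1.1.le, hs.1.2.le.trans hb.2⟩, Ioo_subset_Icc_self hs.2⟩)]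
      refine intervalIntegral.integral_congr_ae ?_
      have a1 := (ae_restrict_iff' measurableSet_Ici).1 (ae_ae_time_space hG)
      have a2 := (ae_restrict_iff' measurableSet_Ici).1 h.sub_eq_fx
      have a3 := (ae_restrict_iff' measurableSet_Ici).1
        (ae_intervalIntegrable_left h.integrableOn_ft)
      have a4 := (ae_restrict_iff' measurableSet_Ici).1
        (ae_intervalIntegrable_left h.integrableOn_fx)
      filter_upwards [a1, a2, a3, a4] with t b1 b2 b3 b4 ht
      rw [uIoc_of_le h12] at ht
      have ht' : t ∈ Icc t₁ t₂ := ⟨ht.1.le, ht.2⟩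
      have ht0 : t ∈ Ici (0 : ℝ) := h0.trans ht'.1
      have hbd := hdom b hb t ht'
      have hpd := hdom p hpm t ht'
      rw [add_sub_add_comm, intervalIntegral.integral_interval_sub_left (b3 ht0 0 hA _ hbd)
        (b3 ht0 0 hA _ hpd), ← mul_sub, ← b2 ht0 _ hpd _ hbd,
        intervalIntegral.integral_comp_add_right (fun x => G x t),
        ← intervalIntegral.integral_const_mul,
        ← intervalIntegral.integral_add (b3 ht0 _ hpd _ hbd) ((b4 ht0 _ hpd _ hbd).const_mul c)]
      refine intervalIntegral.integral_congr_ae ?_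
      filter_upwards [(ae_restrict_iff' measurableSet_Icc).1 (b1 ht0)] with x hx hx'
      have := hx (uIcc_subset_Icc hpd hbd (uIoc_subset_uIcc hx'))
      linarith
    rw [intervalIntegral.integral_sub ((hreg b hb).add ((hfl b hb).const_mul c))
      ((hreg p hpm).add ((hfl p hpm).const_mul c)),
      intervalIntegral.integral_add (hreg b hb) ((hfl b hb).const_mul c),
      intervalIntegral.integral_add (hreg p hpm) ((hfl p hpm).const_mul c),
      intervalIntegral.integral_const_mul, intervalIntegral.integral_const_mul, e1, e2] at hL
    have hsp : ∀ t ∈ Icc t₁ t₂, (∫ x in (0 : ℝ)..(b + c * t), f x t)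
        - ∫ x in (0 : ℝ)..(p + c * t), f x t = ∫ l in p..b, f (l + c * t) t := by
      intro t ht
      have hcx : ∀ u ∈ Icc 0 A, ∀ w ∈ Icc 0 A, IntervalIntegrable (fun x => f x t) volume u w :=
        fun u hu w hw => (continuousOn_comp_path h.continuousOn continuousOn_id
          continuousOn_const (fun x hx => uIcc_subset_Icc hu hw hx)
          fun _ _ => h0.trans ht.1).intervalIntegrable
      rw [intervalIntegral.integral_interval_sub_left (hcx 0 hA _ (hdom b hb t ht))
        (hcx 0 hA _ (hdom p hpm t ht)), intervalIntegral.integral_comp_add_right (fun x => f x t)]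
    have s1 := hsp t₁ hT1
    have s2 := hsp t₂ hT2
    rw [hΦ, intervalIntegral.integral_sub ((hfi _ hT2 b hb).sub (hfi _ hT1 b hb))
      (hGline.mono_set (hsub b hb)),
      intervalIntegral.integral_sub (hfi _ hT2 b hb) (hfi _ hT1 b hb), hL]
    linarith
  have hae := hΦi.ae_hasDerivAt_integral
  -- At an endpoint the primitive is known to vanish on one side only, so its derivative is not
  -- determined there.
  have hne : ∀ᵐ l : ℝ, l ≠ p ∧ l ≠ q := by
    have h₁ : ∀ᵐ x : ℝ, x ≠ p := by simp [ae_iff, measure_singleton]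
    have h₂ : ∀ᵐ x : ℝ, x ≠ q := by simp [ae_iff, measure_singleton]
    exact h₁.and h₂
  filter_upwards [hae, hne] with l hl hlne h1 h2
  have hlJ := (hJ l).2 ⟨h1, h2⟩
  have hd := hl (by rwa [uIcc_of_le hpq]) p left_mem_uIcc
  have hlo : l ∈ Ioo p q := ⟨lt_of_le_of_ne hlJ.1 hlne.1.symm, lt_of_le_of_ne hlJ.2 hlne.2⟩
  have hd0 : HasDerivAt (fun x => ∫ t in p..x, Φ t) 0 l := by
    refine (hasDerivAt_const l (0 : ℝ)).congr_of_eventuallyEq ?_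
    filter_upwards [Ioo_mem_nhds hlo.1 hlo.2] with x hx
    exact hzero x (Ioo_subset_Icc_self hx)
  have := hd.unique hd0
  simp only [hΦ] at this
  linarith

end ARZ

/-! ### Characteristics for all times, transport in the delay line, and integration by parts. -/

namespace ARZ

/-- If `f_t + c f_x = G`, then `f` is the integral of `G` along almost every characteristic. -/
theorem HasStrongDeriv.ae_characteristic {A c : ℝ} (hc : c ≠ 0) {f fx ft G : ℝ → ℝ → ℝ}
    (h : HasStrongDeriv A f fx ft)
    (hGint : ∀ T, IntegrableOn (Function.uncurry G) (Icc 0 A ×ˢ Icc 0 T))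
    (hG : ∀ᵐ q : ℝ × ℝ ∂(volume.restrict (Icc 0 A ×ˢ Ici 0)),
      ft q.1 q.2 = -c * fx q.1 q.2 + G q.1 q.2) :
    ∀ᵐ l : ℝ, ∀ t₁ t₂ : ℝ, 0 ≤ t₁ → t₁ ≤ t₂ → l + c * t₁ ∈ Icc 0 A → l + c * t₂ ∈ Icc 0 A →
      IntervalIntegrable (fun τ => G (l + c * τ) τ) volume t₁ t₂ ∧
      ∫ τ in t₁..t₂, G (l + c * τ) τ = f (l + c * t₂) t₂ - f (l + c * t₁) t₁ := by
  -- Rational times are countable, hence one null set of labels suffices for all of them.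
  have hQ : ∀ᵐ l : ℝ, ∀ r₁ r₂ : ℚ, (0 : ℝ) ≤ r₁ → (r₁ : ℝ) ≤ r₂ → l + c * r₁ ∈ Icc 0 A →
      l + c * r₂ ∈ Icc 0 A →
      ∫ τ in (r₁ : ℝ)..r₂, G (l + c * τ) τ = f (l + c * r₂) r₂ - f (l + c * r₁) r₁ := by
    rw [ae_all_iff]; intro r₁
    rw [ae_all_iff]; intro r₂
    by_cases hr : (0 : ℝ) ≤ r₁ ∧ (r₁ : ℝ) ≤ r₂
    · filter_upwards [h.characteristic_fixed hc hGint hG hr.1 hr.2] with l hl _ _ h1 h2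
      exact hl h1 h2
    · exact Filter.Eventually.of_forall fun l h1 h2 => absurd ⟨h1, h2⟩ hr
  filter_upwards [hQ, ae_intervalIntegrable_line c hGint] with l hl hli t₁ t₂ h0 h12 h1 h2
  refine ⟨hli t₁ t₂ h0 h12 h1 h2, ?_⟩
  rcases h12.eq_or_lt with rfl | hlt
  · simp
  have hdom : ∀ τ ∈ Icc t₁ t₂, l + c * τ ∈ Icc 0 A := fun τ hτ => mem_Icc_line h1 h2 hτ
  have hline := hli t₁ t₂ h0 h12 h1 h2
  have hsubint : ∀ a ∈ Icc t₁ t₂, ∀ b ∈ Icc t₁ t₂,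
      IntervalIntegrable (fun τ => G (l + c * τ) τ) volume a b := fun a ha b hb =>
    hline.mono_set (by rw [uIcc_of_le h12]; exact uIcc_subset_Icc ha hb)
  -- g takes one value at all rational times in the open interval and is continuous, hence constant
  -- on the closed one.
  set g : ℝ → ℝ := fun τ => f (l + c * τ) τ - ∫ σ in t₁..τ, G (l + c * σ) σ with hg
  have hgc : ContinuousOn g (Icc t₁ t₂) := by
    refine (continuousOn_comp_path h.continuousOn (by fun_prop) continuousOn_id hdom
      fun τ hτ => h0.trans hτ.1).sub ?_
    have := intervalIntegral.continuousOn_primitive_interval' hline left_mem_uIcc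
    rwa [uIcc_of_le h12] at this
  set s : Set ℝ := Ioo t₁ t₂ ∩ range ((↑) : ℚ → ℝ) with hs
  obtain ⟨r₀, hr₀⟩ := exists_rat_btwn hlt
  have hgs : EqOn g (fun _ => g r₀) s := by
    have main : ∀ r₁ r₂ : ℚ, (r₁ : ℝ) ∈ Icc t₁ t₂ → (r₂ : ℝ) ∈ Icc t₁ t₂ → (r₁ : ℝ) ≤ r₂ →
        g r₁ = g r₂ := by
      intro r₁ r₂ m1 m2 hle
      have e := hl r₁ r₂ (h0.trans m1.1) hle (hdom _ m1) (hdom _ m2)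
      have e' := intervalIntegral.integral_interval_sub_left
        (hsubint t₁ ⟨le_rfl, h12⟩ _ m2) (hsubint t₁ ⟨le_rfl, h12⟩ _ m1)
      simp only [hg]
      linarith
    rintro _ ⟨hx, r, rfl⟩
    rcases le_total (r : ℝ) r₀ with hle | hle
    · exact main r r₀ (Ioo_subset_Icc_self hx) (Ioo_subset_Icc_self hr₀) hle
    · exact (main r₀ r (Ioo_subset_Icc_self hr₀) (Ioo_subset_Icc_self hx) hle).symm
  have hcl : Icc t₁ t₂ ⊆ closure s := by
    rw [← closure_Ioo hlt.ne]
    refine closure_minimal ?_ isClosed_closure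
    exact Rat.denseRange_cast.open_subset_closure_inter isOpen_Ioo
  have hconst := hgs.of_subset_closure hgc continuousOn_const
    (inter_subset_left.trans Ioo_subset_Icc_self) hcl
  have e1 := hconst (show t₁ ∈ Icc t₁ t₂ from ⟨le_rfl, h12⟩)
  have e2 := hconst (show t₂ ∈ Icc t₁ t₂ from ⟨h12, le_rfl⟩)
  simp only [hg, intervalIntegral.integral_same] at e1 e2
  linarith

/-- A solution of `f_t = f_s` is transported along the lines `s + t = const`. -/
theorem HasStrongDeriv.transport {D : ℝ} {f fs ft : ℝ → ℝ → ℝ}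
    (h : HasStrongDeriv D f fs ft)
    (heq : ∀ᵐ q : ℝ × ℝ ∂(volume.restrict (Icc 0 D ×ˢ Ici 0)), ft q.1 q.2 = fs q.1 q.2)
    {s t : ℝ} (hs : s ∈ Icc 0 D) (ht : 0 ≤ t) : f s t = f 0 (s + t) := by
  -- The equation is transport at speed -1 without source; continuity of f removes the exceptional
  -- labels.
  have hch := h.ae_characteristic (c := -1) (by norm_num) (G := fun _ _ => 0)
    (fun T => integrableOn_zero) (by filter_upwards [heq] with q hq; rw [hq]; ring)
  have hD : (0 : ℝ) ∈ Icc 0 D := ⟨le_rfl, hs.1.trans hs.2⟩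
  have hEq : EqOn (fun l => f s (l - s)) (fun l => f 0 l) (Ici s) := by
    refine Measure.eqOn_of_ae_eq (μ := volume) ?_ ?_ ?_ ?_
    · rw [Filter.EventuallyEq, ae_restrict_iff' measurableSet_Ici]
      filter_upwards [hch] with l hl hls
      have hls' : 0 ≤ l - s := sub_nonneg.2 hls
      have := (hl (l - s) l hls' (by linarith [hs.1]) (by
        have e : l + -1 * (l - s) = s := by ring
        rwa [e]) (by
        have e : l + -1 * l = 0 := by ring
        rwa [e])).2
      have e : l + -1 * (l - s) = s := by ring
      have e' : l + -1 * l = 0 := by ring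
      rw [e, e', intervalIntegral.integral_zero] at this
      linarith
    · exact continuousOn_comp_path h.continuousOn continuousOn_const (by fun_prop) (fun _ _ => hs)
        fun l hl => sub_nonneg.2 hl
    · exact continuousOn_comp_path h.continuousOn continuousOn_const continuousOn_id
        (fun _ _ => hD) fun l hl => hs.1.trans hl
    · rw [interior_Ici, closure_Ioi]
  have := hEq (show s + t ∈ Ici s by simp only [mem_Ici]; linarith)
  simpa using this

/-- Integration by parts of an indefinite integral against a continuously differentiable weight. -/
theorem integral_weight_mul {b z₀ : ℝ} {w w' g z : ℝ → ℝ} (hw : ∀ x, HasDerivAt w (w' x) x)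
    (hw' : Continuous w') (hg : IntervalIntegrable g volume 0 b)
    (hz : ∀ x ∈ uIcc 0 b, z x = z₀ + ∫ ξ in (0 : ℝ)..x, g ξ) :
    ∫ x in (0 : ℝ)..b, w x * g x = w b * z b - w 0 * z 0 - ∫ x in (0 : ℝ)..b, w' x * z x := by
  have hwc : Continuous w := continuous_iff_continuousAt.2 fun x => (hw x).continuousAt
  have hF : ∀ x, ∫ ξ in (0 : ℝ)..x, w' ξ = w x - w 0 := fun x =>
    intervalIntegral.integral_eq_sub_of_hasDerivAt (fun y _ => hw y)
      (hw'.intervalIntegrable _ _)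
  have acw := (hw'.intervalIntegrable (μ := volume) 0 b).absolutelyContinuousOnInterval_intervalIntegral
    (c := 0) (by simp)
  have acg := hg.absolutelyContinuousOnInterval_intervalIntegral (c := 0) (by simp)
  -- The product formula is applied to w - w 0 and z - z₀, which vanish at 0; the constants w 0 and
  -- z₀ are restored afterwards.
  have key := acw.integral_mul_deriv_eq_deriv_mul acg
  have hz0 : z 0 = z₀ := by simpa using hz 0 left_mem_uIcc
  have hzb := hz b right_mem_uIcc
  have hGc : ContinuousOn (fun x => ∫ ξ in (0 : ℝ)..x, g ξ) (uIcc 0 b) :=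
    intervalIntegral.continuousOn_primitive_interval' hg left_mem_uIcc
  have e1 : ∫ x in (0 : ℝ)..b, (∫ ξ in (0 : ℝ)..x, w' ξ) * deriv (fun x => ∫ ξ in (0 : ℝ)..x, g ξ) x
      = ∫ x in (0 : ℝ)..b, (w x * g x - w 0 * g x) := by
    refine intervalIntegral.integral_congr_ae ?_
    filter_upwards [hg.ae_hasDerivAt_integral] with x hx hx'
    have := hx (uIoc_subset_uIcc hx') 0 left_mem_uIcc
    rw [this.deriv, hF]; ring
  have e2 : ∫ x in (0 : ℝ)..b, deriv (fun x => ∫ ξ in (0 : ℝ)..x, w' ξ) x * (∫ ξ in (0 : ℝ)..x, g ξ)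
      = ∫ x in (0 : ℝ)..b, (w' x * z x - w' x * z₀) := by
    refine intervalIntegral.integral_congr fun x hx => ?_
    have : (fun x => ∫ ξ in (0 : ℝ)..x, w' ξ) = fun x => w x - w 0 := funext hF
    simp only [this, ((hw x).sub_const _).deriv]
    rw [hz x hx]; ring
  have hzc : ContinuousOn z (uIcc 0 b) := (continuousOn_const.add hGc).congr fun x hx => hz x hx
  have i1 : IntervalIntegrable (fun x => w' x * z x) volume 0 b :=
    (hw'.continuousOn.mul hzc).intervalIntegrable
  have i2 : IntervalIntegrable (fun x => w' x * z₀) volume 0 b :=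
    (hw'.mul continuous_const).intervalIntegrable _ _
  rw [e1, e2, intervalIntegral.integral_sub (hg.continuousOn_mul hwc.continuousOn)
    (hg.const_mul _), intervalIntegral.integral_sub i1 i2,
    intervalIntegral.integral_const_mul, intervalIntegral.integral_mul_const, hF, hF] at key
  simp only [intervalIntegral.integral_same, mul_zero, sub_zero] at key
  have hgb : ∫ ξ in (0 : ℝ)..b, g ξ = z b - z₀ := by rw [hzb]; ring
  rw [hgb] at key
  rw [hz0]
  linarith

end ARZ

/-! ### Signs of the coefficients and the two relations between them. -/

namespace ARZParams

variable {P : ARZParams}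

namespace Valid

theorem mix_num_pos (hP : P.Valid) : 0 < P.α + (1 - P.α) * (P.τacc / P.τm) := by
  have h := hP.α_le_one
  have := div_pos hP.τacc_pos hP.τm_pos
  nlinarith [hP.α_pos]

theorem hmix_pos (hP : P.Valid) : 0 < P.hmix := by
  have h1 := hP.mix_num_pos
  have h2 : 0 < P.α + (1 - P.α) * (P.τacc / P.τm) * (P.hacc / P.hm) := by
    have h := hP.α_le_one
    have a := div_pos hP.τacc_pos hP.τm_pos
    have b := div_pos hP.hacc_pos hP.hm_pos
    have := mul_nonneg (mul_nonneg (sub_nonneg.2 h) a.le) b.le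
    linarith [hP.α_pos]
  exact mul_pos (div_pos h1 h2) hP.hacc_pos

theorem τmix_pos (hP : P.Valid) : 0 < P.τmix := by
  refine one_div_pos.2 (add_pos_of_pos_of_nonneg (div_pos hP.α_pos hP.τacc_pos) ?_)
  exact div_nonneg (sub_nonneg.2 hP.α_le_one) hP.τm_pos.le

theorem vbar_pos (hP : P.Valid) : 0 < P.vbar := div_pos hP.l_pos (sub_pos.2 hP.hmix_lt)

theorem ρbar_pos (hP : P.Valid) : 0 < P.ρbar :=
  one_div_pos.2 (add_pos hP.l_pos (mul_pos hP.hmix_pos hP.vbar_pos))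

theorem spacing_pos (hP : P.Valid) : 0 < 1 / P.ρbar - P.l := by
  have := mul_pos hP.hmix_pos hP.vbar_pos
  simp only [ρbar, one_div_one_div]
  linarith

theorem c1_pos (hP : P.Valid) : 0 < P.c1 := hP.vbar_pos

theorem c2_pos (hP : P.Valid) : 0 < P.c2 := one_div_pos.2 (mul_pos hP.τmix_pos hP.vbar_pos)

theorem c4_pos (hP : P.Valid) : 0 < P.c4 := div_pos hP.l_pos hP.hmix_pos

theorem c5_pos (hP : P.Valid) : 0 < P.c5 := by
  have := hP.ρbar_pos; have := hP.τmix_pos; have := hP.hmix_pos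
  unfold c5; positivity

theorem c6_pos (hP : P.Valid) : 0 < P.c6 := by
  have h1 := hP.spacing_pos; have := hP.α_pos; have := hP.τacc_pos; have := hP.hacc_pos
  unfold c6; exact mul_pos (by positivity) h1

/-- This relation removes the actuation from the balance of c₅ e^{-c₂x} z - c₁c₂ v, and makes c₁c₂
the growth rate of z under the delay-free law. -/
theorem c3_mul_c5 (hP : P.Valid) : P.c3 * P.c5 = P.c1 * P.c2 * P.c6 := by
  have h1 := hP.ρbar_pos.ne'; have h2 := hP.τmix_pos.ne'; have h3 := hP.hmix_pos.ne'
  have h4 := hP.vbar_pos.ne'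
  have h5 := hP.τacc_pos.ne'; have h6 := hP.hacc_pos.ne'
  unfold c1 c2 c3 c5 c6
  generalize 1 / P.ρbar - P.l = w
  field_simp

/-- This relation makes the flux c₁ (c₅ e^{-c₂x} z + c₂c₄ v) vanish at the inlet, where z = -c₇ v.
-/
theorem c5_mul_c7 (hP : P.Valid) : P.c5 * P.c7 = P.c2 * P.c4 := by
  have h1 := hP.ρbar_pos.ne'; have h2 := hP.τmix_pos.ne'; have h3 := hP.hmix_pos.ne'
  have h4 := hP.vbar_pos.ne'
  unfold c2 c4 c5 c7
  field_simp

end Valid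

end ARZParams

/-! ### The integrated plant and its conservation law. -/

namespace ARZ

/-- The integrated form of the plant: `z`, `v` are continuous and obtained by integration along
the characteristics, with the actuation `f(x, t) = ψ(x, 0, t)` as forcing. -/
structure MildPlant (P : ARZParams) (L : ℝ) (z v f : ℝ → ℝ → ℝ) : Prop where
  z_cont : ContinuousOn (Function.uncurry z) (Icc 0 L ×ˢ Ici 0)
  v_cont : ContinuousOn (Function.uncurry v) (Icc 0 L ×ˢ Ici 0)
  f_outlet_cont : ContinuousOn (f L) (Ici 0)
  f_memLp : ∀ T, MemLp (Function.uncurry f) 2 (volume.restrict (Icc 0 L ×ˢ Icc 0 T))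
  z_char : ∀ᵐ l : ℝ, ∀ t₁ t₂ : ℝ, 0 ≤ t₁ → t₁ ≤ t₂ →
    l + P.c1 * t₁ ∈ Icc 0 L → l + P.c1 * t₂ ∈ Icc 0 L →
      IntervalIntegrable (fun τ => -(P.c3 * Real.exp (P.c2 * (l + P.c1 * τ)) *
        f (l + P.c1 * τ) τ)) volume t₁ t₂ ∧
      ∫ τ in t₁..t₂, -(P.c3 * Real.exp (P.c2 * (l + P.c1 * τ)) * f (l + P.c1 * τ) τ)
        = z (l + P.c1 * t₂) t₂ - z (l + P.c1 * t₁) t₁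
  v_char : ∀ᵐ l : ℝ, ∀ t₁ t₂ : ℝ, 0 ≤ t₁ → t₁ ≤ t₂ →
    l + -P.c4 * t₁ ∈ Icc 0 L → l + -P.c4 * t₂ ∈ Icc 0 L →
      IntervalIntegrable (fun τ => -(P.c5 * Real.exp (-(P.c2 * (l + -P.c4 * τ))) *
        z (l + -P.c4 * τ) τ + P.c6 * f (l + -P.c4 * τ) τ)) volume t₁ t₂ ∧
      ∫ τ in t₁..t₂, -(P.c5 * Real.exp (-(P.c2 * (l + -P.c4 * τ))) * z (l + -P.c4 * τ) τ
        + P.c6 * f (l + -P.c4 * τ) τ) = v (l + -P.c4 * t₂) t₂ - v (l + -P.c4 * t₁) t₁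
  inlet : ∀ t, 0 ≤ t → z 0 t = -P.c7 * v 0 t
  outlet : ∀ t₁ t₂ : ℝ, 0 ≤ t₁ → t₁ ≤ t₂ →
    ∫ τ in t₁..t₂, -(P.c5 * Real.exp (-(P.c2 * L)) * z L τ + P.c6 * f L τ) = v L t₂ - v L t₁
  conservation : ∀ t₁ t₂ : ℝ, 0 ≤ t₁ → t₁ ≤ t₂ → P.c4 * (t₂ - t₁) ≤ L →
    ∫ y in (0 : ℝ)..(P.c4 * (t₂ - t₁)), (P.c5 * Real.exp (-(P.c2 * y)) * z y t₁
        - P.c1 * P.c2 * v y t₁)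
      = (P.c1 + P.c4) * ∫ t in t₁..t₂, P.c5 * Real.exp (-(P.c2 * (P.c4 * (t₂ - t)))) *
          z (P.c4 * (t₂ - t)) t

theorem isCompact_rect (A T : ℝ) : IsCompact (Icc (0 : ℝ) A ×ˢ Icc (0 : ℝ) T) :=
  isCompact_Icc.prod isCompact_Icc

theorem integrableOn_rect_of_memLp {A T : ℝ} {g : ℝ → ℝ → ℝ}
    (h : MemLp (Function.uncurry g) 2 (volume.restrict (Icc 0 A ×ˢ Icc 0 T))) :
    IntegrableOn (Function.uncurry g) (Icc 0 A ×ˢ Icc 0 T) := by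
  have : IsFiniteMeasure (volume.restrict (Icc 0 A ×ˢ Icc 0 T) : Measure (ℝ × ℝ)) :=
    ⟨by simpa using (isCompact_rect A T).measure_lt_top⟩
  exact h.integrable (by norm_num)

theorem memLp_rect_of_continuousOn {A T : ℝ} {g : ℝ × ℝ → ℝ}
    (h : ContinuousOn g (Icc 0 A ×ˢ Ici 0)) :
    MemLp g 2 (volume.restrict (Icc 0 A ×ˢ Icc 0 T)) := by
  have h' : ContinuousOn g (Icc 0 A ×ˢ Icc 0 T) := h.mono (prod_mono le_rfl Icc_subset_Ici_self)
  have : IsFiniteMeasure (volume.restrict (Icc 0 A ×ˢ Icc 0 T) : Measure (ℝ × ℝ)) :=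
    ⟨by simpa using (isCompact_rect A T).measure_lt_top⟩
  obtain ⟨C, hC⟩ := (isCompact_rect A T).exists_bound_of_continuousOn h'
  have hm : MeasurableSet (Icc (0 : ℝ) A ×ˢ Icc (0 : ℝ) T) := measurableSet_Icc.prod measurableSet_Icc
  refine MemLp.of_bound (h'.aestronglyMeasurable hm) C ?_
  rw [ae_restrict_iff' hm]
  exact Filter.Eventually.of_forall hC

variable {P : ARZParams} {L D k : ℝ} {z₀ v₀ : ℝ → ℝ} {ϑ₀ : ℝ → ℝ → ℝ} {z v : ℝ → ℝ → ℝ}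
  {ψ : ℝ → ℝ → ℝ → ℝ}

/-- The density w = c₅ e^{-c₂x} z - c₁c₂ v satisfies w_t + (c₁c₅ e^{-c₂x} z + c₁c₂c₄ v)_x = 0: the
actuation cancels by `c3_mul_c5`, and the flux is zero at x = 0 by `c5_mul_c7`. On integrating over
the triangle below the v-characteristic that ends at (0, t₂), the contributions of v on the slanted
side cancel and only z remains there. -/
theorem conservation_law (hP : P.Valid) (hL : 0 ≤ L) {z v zx zt vx vt f : ℝ → ℝ → ℝ}
    (hz : HasStrongDeriv L z zx zt) (hv : HasStrongDeriv L v vx vt)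
    (hzeq : ∀ᵐ q : ℝ × ℝ ∂(volume.restrict (Icc 0 L ×ˢ Ici 0)),
      zt q.1 q.2 = -P.c1 * zx q.1 q.2 - Real.exp (P.c2 * q.1) * P.c3 * f q.1 q.2)
    (hveq : ∀ᵐ q : ℝ × ℝ ∂(volume.restrict (Icc 0 L ×ˢ Ici 0)),
      vt q.1 q.2 = P.c4 * vx q.1 q.2 - P.c5 * Real.exp (-(P.c2 * q.1)) * z q.1 q.2
        - P.c6 * f q.1 q.2)
    (inlet : ∀ t, 0 ≤ t → z 0 t = -P.c7 * v 0 t) {t₁ t₂ : ℝ} (h0 : 0 ≤ t₁) (h12 : t₁ ≤ t₂)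
    (hle : P.c4 * (t₂ - t₁) ≤ L) :
    ∫ y in (0 : ℝ)..(P.c4 * (t₂ - t₁)), (P.c5 * Real.exp (-(P.c2 * y)) * z y t₁
        - P.c1 * P.c2 * v y t₁)
      = (P.c1 + P.c4) * ∫ t in t₁..t₂, P.c5 * Real.exp (-(P.c2 * (P.c4 * (t₂ - t)))) *
          z (P.c4 * (t₂ - t)) t := by
  have hc4 := hP.c4_pos
  have e₁ : P.c4 * t₂ + -P.c4 * t₁ = P.c4 * (t₂ - t₁) := by ring
  have e₂ : P.c4 * t₂ + -P.c4 * t₂ = 0 := by ring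
  have hd : ∀ t ∈ Icc t₁ t₂, P.c4 * t₂ + -P.c4 * t ∈ Icc 0 L := fun t ht =>
    ⟨by nlinarith [ht.2], by nlinarith [ht.1]⟩
  have hL0 : (0 : ℝ) ∈ Icc 0 L := ⟨le_rfl, hL⟩
  have hint : ∀ T, IntegrableOn (Function.uncurry fun x t =>
      P.c5 * Real.exp (-(P.c2 * x)) * zt x t - P.c1 * P.c2 * vt x t) (Icc 0 L ×ˢ Icc 0 T) :=
    fun T => (IntegrableOn.continuousOn_mul (g := fun q : ℝ × ℝ => P.c5 * Real.exp (-(P.c2 * q.1)))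
      (by fun_prop) (hz.integrableOn_ft T) (isCompact_rect L T)).sub
      ((hv.integrableOn_ft T).const_mul _)
  have key := integral_moving_endpoint (A := L) (b := P.c4 * t₂) (c := -P.c4) (t₁ := t₁) (t₂ := t₂)
    (f := fun x t => P.c5 * Real.exp (-(P.c2 * x)) * z x t - P.c1 * P.c2 * v x t)
    (ft := fun x t => P.c5 * Real.exp (-(P.c2 * x)) * zt x t - P.c1 * P.c2 * vt x t)
    (neg_ne_zero.2 hc4.ne')
    ((ContinuousOn.mul (f := fun q : ℝ × ℝ => P.c5 * Real.exp (-(P.c2 * q.1))) (by fun_prop)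
      hz.continuousOn).sub (continuousOn_const.mul hv.continuousOn)) hint
    (by
      filter_upwards [hz.sub_eq_ft, hv.sub_eq_ft, ae_intervalIntegrable_right hz.integrableOn_ft,
        ae_intervalIntegrable_right hv.integrableOn_ft] with x a1 a2 a3 a4 s₁ hs₁ s₂ hs₂
      rw [intervalIntegral.integral_sub ((a3 _ hs₁ _ hs₂).const_mul _)
        ((a4 _ hs₁ _ hs₂).const_mul _), intervalIntegral.integral_const_mul,
        intervalIntegral.integral_const_mul, a1 _ hs₁ _ hs₂, a2 _ hs₁ _ hs₂]
      ring)
    h0 h12 (hd _ ⟨le_rfl, h12⟩) (hd _ ⟨h12, le_rfl⟩)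
  rw [e₁, e₂, intervalIntegral.integral_same, zero_sub] at key
  have hcz : ContinuousOn (fun t => z (P.c4 * t₂ + -P.c4 * t) t) (uIcc t₁ t₂) := by
    rw [uIcc_of_le h12]
    exact continuousOn_comp_path hz.continuousOn (by fun_prop) continuousOn_id hd
      fun t ht => h0.trans ht.1
  have hcv : ContinuousOn (fun t => v (P.c4 * t₂ + -P.c4 * t) t) (uIcc t₁ t₂) := by
    rw [uIcc_of_le h12]
    exact continuousOn_comp_path hv.continuousOn (by fun_prop) continuousOn_id hd
      fun t ht => h0.trans ht.1
  -- The inner integral is minus the flux through the slanted side.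
  have hin : (∫ t in t₁..t₂, ∫ x in (0 : ℝ)..(P.c4 * t₂ + -P.c4 * t),
      (P.c5 * Real.exp (-(P.c2 * x)) * zt x t - P.c1 * P.c2 * vt x t))
      = ∫ t in t₁..t₂, (-P.c1 * (P.c5 * Real.exp (-(P.c2 * (P.c4 * t₂ + -P.c4 * t))) *
          z (P.c4 * t₂ + -P.c4 * t) t)
          - P.c1 * P.c2 * P.c4 * v (P.c4 * t₂ + -P.c4 * t) t) := by
    refine intervalIntegral.integral_congr_ae ?_
    have a1 := (ae_restrict_iff' measurableSet_Ici).1 (ae_ae_time_space hzeq)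
    have a2 := (ae_restrict_iff' measurableSet_Ici).1 (ae_ae_time_space hveq)
    have a3 := (ae_restrict_iff' measurableSet_Ici).1 hz.eq_fx
    have a4 := (ae_restrict_iff' measurableSet_Ici).1 hv.sub_eq_fx
    have a5 := (ae_restrict_iff' measurableSet_Ici).1
      (ae_intervalIntegrable_left hz.integrableOn_fx)
    have a6 := (ae_restrict_iff' measurableSet_Ici).1
      (ae_intervalIntegrable_left hv.integrableOn_fx)
    filter_upwards [a1, a2, a3, a4, a5, a6] with t b1 b2 b3 b4 b5 b6 ht
    rw [uIoc_of_le h12] at ht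
    have ht' : t ∈ Icc t₁ t₂ := ⟨ht.1.le, ht.2⟩
    have ht0 : t ∈ Ici (0 : ℝ) := h0.trans ht'.1
    have hb := hd t ht'
    set b := P.c4 * t₂ + -P.c4 * t with hbdef
    have hsub : uIcc 0 b ⊆ Icc 0 L := uIcc_subset_Icc hL0 hb
    have hparts := integral_weight_mul (w := fun x => Real.exp (-(P.c2 * x)))
      (w' := fun x => Real.exp (-(P.c2 * x)) * -P.c2) (g := fun x => zx x t) (z := fun x => z x t)
      (b := b) (z₀ := z 0 t)
      (fun x => by
        have := ((hasDerivAt_id x).const_mul P.c2).neg.exp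
        simpa using this) (by fun_prop) (b5 ht0 0 hL0 b hb)
      (fun x hx => b3 ht0 x (hsub hx))
    have hvx := b4 ht0 0 hL0 b hb
    have hzc : ContinuousOn (fun x => z x t) (uIcc 0 b) :=
      continuousOn_comp_path hz.continuousOn continuousOn_id continuousOn_const
        (fun x hx => hsub hx) fun _ _ => ht0
    have hwz : IntervalIntegrable (fun x => Real.exp (-(P.c2 * x)) * zx x t) volume 0 b :=
      (b5 ht0 0 hL0 b hb).continuousOn_mul (by fun_prop)
    have hwz' : IntervalIntegrable (fun x => Real.exp (-(P.c2 * x)) * -P.c2 * z x t) volume 0 b :=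
      ((by fun_prop : Continuous fun x => Real.exp (-(P.c2 * x)) * -P.c2).continuousOn.mul
        hzc).intervalIntegrable
    have hpde : ∫ x in (0 : ℝ)..b, (P.c5 * Real.exp (-(P.c2 * x)) * zt x t - P.c1 * P.c2 * vt x t)
        = ∫ x in (0 : ℝ)..b, (-P.c1 * P.c5 * (Real.exp (-(P.c2 * x)) * zx x t
          + Real.exp (-(P.c2 * x)) * -P.c2 * z x t) + -(P.c1 * P.c2 * P.c4) * vx x t) := by
      refine intervalIntegral.integral_congr_ae ?_
      filter_upwards [(ae_restrict_iff' measurableSet_Icc).1 (b1 ht0),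
        (ae_restrict_iff' measurableSet_Icc).1 (b2 ht0)] with x h1 h2 hx
      have hxm := hsub (uIoc_subset_uIcc hx)
      have g1 := h1 hxm
      have g2 := h2 hxm
      have he : Real.exp (-(P.c2 * x)) * Real.exp (P.c2 * x) = 1 := by
        rw [← Real.exp_add]; simp
      rw [g1, g2]
      have hr := hP.c3_mul_c5
      linear_combination (-(P.c5 * P.c3 * f x t)) * he - f x t * hr
    rw [hpde, intervalIntegral.integral_add ((hwz.add hwz').const_mul _)
      ((b6 ht0 0 hL0 b hb).const_mul _), intervalIntegral.integral_const_mul,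
      intervalIntegral.integral_const_mul, intervalIntegral.integral_add hwz hwz', hparts, hvx,
      inlet t ht0]
    have h57 := hP.c5_mul_c7
    simp only [mul_zero, neg_zero, Real.exp_zero, one_mul]
    linear_combination (-P.c1 * v 0 t) * h57
  have hi1 : IntervalIntegrable (fun t => P.c5 * Real.exp (-(P.c2 * (P.c4 * t₂ + -P.c4 * t))) *
      z (P.c4 * t₂ + -P.c4 * t) t) volume t₁ t₂ :=
    (((by fun_prop : Continuous fun t : ℝ =>
      P.c5 * Real.exp (-(P.c2 * (P.c4 * t₂ + -P.c4 * t)))).continuousOn).mul hcz).intervalIntegrable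
  have hi2 : IntervalIntegrable (fun t => v (P.c4 * t₂ + -P.c4 * t) t) volume t₁ t₂ :=
    hcv.intervalIntegrable
  rw [hin, intervalIntegral.integral_sub (hi1.const_mul _) (hi2.const_mul _),
    intervalIntegral.integral_sub hi1 (hi2.const_mul _), intervalIntegral.integral_const_mul,
    intervalIntegral.integral_const_mul, intervalIntegral.integral_const_mul] at key
  have hshape : ∀ t, P.c4 * (t₂ - t) = P.c4 * t₂ + -P.c4 * t := fun t => by ring
  simp only [hshape] at key ⊢
  linarith

end ARZ

/-! ### From strong solutions to the integrated plant. -/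

namespace ARZ

variable {P : ARZParams} {L D k : ℝ} {z₀ v₀ : ℝ → ℝ} {ϑ₀ : ℝ → ℝ → ℝ} {z v : ℝ → ℝ → ℝ}
  {ψ : ℝ → ℝ → ℝ → ℝ}

namespace IsClosedLoopSolution

theorem transport (h : IsClosedLoopSolution P L D k z₀ v₀ ϑ₀ z v ψ) :
    AEAndOutlet L fun x => ∀ s ∈ Icc 0 D, ∀ t, 0 ≤ t → ψ x s t = ψ x 0 (s + t) := by
  obtain ⟨ψs, ψt, -, -, -, h1, h2⟩ := h.ψ_eq
  refine ⟨?_, fun s hs t ht => h2.1.transport h2.2 hs ht⟩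
  filter_upwards [h1] with x hx s hs t ht
  exact hx.1.transport hx.2 hs ht

theorem actuation_continuousOn (h : IsClosedLoopSolution P L D k z₀ v₀ ϑ₀ z v ψ) (hD : 0 ≤ D) :
    AEAndOutlet L fun x => ContinuousOn (ψ x 0) (Ici 0) := by
  obtain ⟨ψs, ψt, -, -, -, h1, h2⟩ := h.ψ_eq
  have main : ∀ x, HasStrongDeriv D (ψ x) (ψs x) (ψt x) → ContinuousOn (ψ x 0) (Ici 0) :=
    fun x hx => continuousOn_comp_path hx.continuousOn continuousOn_const continuousOn_id
      (fun _ _ => ⟨le_rfl, hD⟩) fun t ht => ht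
  refine ⟨?_, main L h2.1⟩
  filter_upwards [h1] with x hx
  exact main x hx.1

/-- The equation of v expresses c₆ ψ(x,0,t) through c₄ v_x - v_t and a continuous term, so square
integrability in (x,t) of the trace at s = 0 is inherited from v_x and v_t. -/
theorem actuation_memLp (h : IsClosedLoopSolution P L D k z₀ v₀ ϑ₀ z v ψ) (hP : P.Valid) (T : ℝ) :
    MemLp (Function.uncurry fun x t => ψ x 0 t) 2 (volume.restrict (Icc 0 L ×ˢ Icc 0 T)) := by
  obtain ⟨zx, zt, hz, -⟩ := h.z_eq
  obtain ⟨vx, vt, hv, hveq⟩ := h.v_eq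
  have hc6 := hP.c6_pos.ne'
  have hw : MemLp (fun q : ℝ × ℝ => P.c5 * Real.exp (-(P.c2 * q.1)) * z q.1 q.2) 2
      (volume.restrict (Icc 0 L ×ˢ Icc 0 T)) :=
    memLp_rect_of_continuousOn ((ContinuousOn.mul
      (f := fun q : ℝ × ℝ => P.c5 * Real.exp (-(P.c2 * q.1))) (by fun_prop) hz.continuousOn))
  refine (((((hv.memLp_fx T).const_mul P.c4).sub hw).sub (hv.memLp_ft T)).const_mul
    P.c6⁻¹).ae_eq ?_
  filter_upwards [ae_restrict_of_ae_restrict_of_subset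
    (prod_mono le_rfl Icc_subset_Ici_self) hveq] with q hq
  simp only [Pi.sub_apply, Function.uncurry_def]
  rw [hq]
  field_simp
  ring

theorem mildPlant (h : IsClosedLoopSolution P L D k z₀ v₀ ϑ₀ z v ψ) (hP : P.Valid) (hL : 0 ≤ L)
    (hD : 0 ≤ D) : MildPlant P L z v fun x t => ψ x 0 t := by
  have hfm := h.actuation_memLp hP
  have hfc := (h.actuation_continuousOn hD).2
  obtain ⟨zx, zt, hz, hzeq⟩ := h.z_eq
  obtain ⟨vx, vt, hv, hveq⟩ := h.v_eq
  have hfi := fun T => integrableOn_rect_of_memLp (hfm T)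
  have hLm : L ∈ Icc 0 L := ⟨hL, le_rfl⟩
  refine ⟨hz.continuousOn, hv.continuousOn, hfc, hfm, ?_, ?_, h.inlet, ?_, ?_⟩
  · refine hz.ae_characteristic (G := fun x t => -(P.c3 * Real.exp (P.c2 * x) * ψ x 0 t))
      hP.c1_pos.ne' (fun T => ?_) ?_
    · exact (IntegrableOn.continuousOn_mul (g := fun q : ℝ × ℝ => P.c3 * Real.exp (P.c2 * q.1))
        (by fun_prop) (hfi T) (isCompact_rect L T)).neg
    · filter_upwards [hzeq] with q hq
      rw [hq]; ring
  · refine hv.ae_characteristic (G := fun x t => -(P.c5 * Real.exp (-(P.c2 * x)) * z x t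
      + P.c6 * ψ x 0 t)) (neg_ne_zero.2 hP.c4_pos.ne') (fun T => ?_) ?_
    · refine (IntegrableOn.add ?_ ((hfi T).const_mul _)).neg
      exact integrableOn_rect_of_memLp (g := fun x t => P.c5 * Real.exp (-(P.c2 * x)) * z x t)
        (memLp_rect_of_continuousOn ((ContinuousOn.mul
          (f := fun q : ℝ × ℝ => P.c5 * Real.exp (-(P.c2 * q.1))) (by fun_prop) hz.continuousOn)))
    · filter_upwards [hveq] with q hq
      rw [hq]; ring
  -- The outlet condition is a classical derivative for positive times only; continuity up to the
  -- endpoints covers t₁ = 0.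
  · intro t₁ t₂ h0 h12
    have hs : Icc t₁ t₂ ⊆ Ici 0 := fun t ht => h0.trans ht.1
    have hzL : ContinuousOn (fun t => z L t) (Icc t₁ t₂) :=
      continuousOn_comp_path hz.continuousOn continuousOn_const continuousOn_id
        (fun _ _ => hLm) fun t ht => hs ht
    have hvL : ContinuousOn (fun t => v L t) (Icc t₁ t₂) :=
      continuousOn_comp_path hv.continuousOn continuousOn_const continuousOn_id
        (fun _ _ => hLm) fun t ht => hs ht
    refine intervalIntegral.integral_eq_sub_of_hasDerivAt_of_le h12 hvL (fun t ht => ?_) ?_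
    · refine (h.outlet t (h0.trans_lt ht.1)).congr_deriv ?_
      ring
    · refine ContinuousOn.intervalIntegrable ?_
      rw [uIcc_of_le h12]
      exact ((continuousOn_const.mul hzL).add (continuousOn_const.mul (hfc.mono hs))).neg
  · intro t₁ t₂ h0 h12 hle
    exact conservation_law (f := fun x t => ψ x 0 t) hP hL hz hv hzeq hveq h.inlet h0 h12 hle

end IsClosedLoopSolution

end ARZ

/-! ### Backward characteristics and Green's formula. -/

namespace ARZ

/-- The integrated equation of `z` holds along the characteristic `x - c₁ t = l`. -/
def ZGood (P : ARZParams) (L : ℝ) (z f : ℝ → ℝ → ℝ) (l : ℝ) : Prop :=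
  ∀ t₁ t₂ : ℝ, 0 ≤ t₁ → t₁ ≤ t₂ → l + P.c1 * t₁ ∈ Icc 0 L → l + P.c1 * t₂ ∈ Icc 0 L →
    IntervalIntegrable (fun τ => -(P.c3 * Real.exp (P.c2 * (l + P.c1 * τ)) *
      f (l + P.c1 * τ) τ)) volume t₁ t₂ ∧
    ∫ τ in t₁..t₂, -(P.c3 * Real.exp (P.c2 * (l + P.c1 * τ)) * f (l + P.c1 * τ) τ)
      = z (l + P.c1 * t₂) t₂ - z (l + P.c1 * t₁) t₁

/-- The integrated equation of `v` holds along the characteristic `x + c₄ t = l`. -/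
def VGood (P : ARZParams) (L : ℝ) (z v f : ℝ → ℝ → ℝ) (l : ℝ) : Prop :=
  ∀ t₁ t₂ : ℝ, 0 ≤ t₁ → t₁ ≤ t₂ → l + -P.c4 * t₁ ∈ Icc 0 L → l + -P.c4 * t₂ ∈ Icc 0 L →
    IntervalIntegrable (fun τ => -(P.c5 * Real.exp (-(P.c2 * (l + -P.c4 * τ))) *
      z (l + -P.c4 * τ) τ + P.c6 * f (l + -P.c4 * τ) τ)) volume t₁ t₂ ∧
    ∫ τ in t₁..t₂, -(P.c5 * Real.exp (-(P.c2 * (l + -P.c4 * τ))) * z (l + -P.c4 * τ) τ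
      + P.c6 * f (l + -P.c4 * τ) τ) = v (l + -P.c4 * t₂) t₂ - v (l + -P.c4 * t₁) t₁

/-- Affine reparametrizations preserve almost everywhere properties. -/
theorem ae_comp_affine {p : ℝ → Prop} (h : ∀ᵐ x : ℝ, p x) {a : ℝ} (ha : a ≠ 0) (b : ℝ) :
    ∀ᵐ x : ℝ, p (b + a * x) := by
  have h1 : Measure.QuasiMeasurePreserving (fun x : ℝ => a * x) volume volume :=
    ⟨by fun_prop, by
      rw [Real.map_volume_mul_left ha]
      exact Measure.smul_absolutelyContinuous⟩
  have h2 := (measurePreserving_add_left (volume : Measure ℝ) b).quasiMeasurePreserving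
  exact (h2.comp h1).ae h

namespace MildPlant

variable {P : ARZParams} {L : ℝ} {z v f : ℝ → ℝ → ℝ}

theorem ae_zGood (h : MildPlant P L z v f) : ∀ᵐ l : ℝ, ZGood P L z f l := h.z_char

theorem ae_vGood (h : MildPlant P L z v f) : ∀ᵐ l : ℝ, VGood P L z v f l := h.v_char

end MildPlant

variable {P : ARZParams} {L : ℝ} {z v f : ℝ → ℝ → ℝ}

/-- The integrated equation of `z`, backwards from the point `(m - c₁ ρ, T - ρ)`. -/
theorem ZGood.backward {m T ρ R : ℝ} (h : ZGood P L z f (m - P.c1 * T)) (hρR : ρ ≤ R) (hRT : R ≤ T)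
    (h1 : m - P.c1 * ρ ∈ Icc 0 L) (h2 : m - P.c1 * R ∈ Icc 0 L) :
    IntervalIntegrable (fun r => P.c3 * Real.exp (P.c2 * (m - P.c1 * r)) *
      f (m - P.c1 * r) (T - r)) volume ρ R ∧
    z (m - P.c1 * ρ) (T - ρ) = z (m - P.c1 * R) (T - R)
      - ∫ r in ρ..R, P.c3 * Real.exp (P.c2 * (m - P.c1 * r)) * f (m - P.c1 * r) (T - r) := by
  have e : ∀ r, m - P.c1 * T + P.c1 * (T - r) = m - P.c1 * r := fun r => by ring
  obtain ⟨hi, he⟩ := h (T - R) (T - ρ) (by linarith) (by linarith) (by rwa [e]) (by rwa [e])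
  rw [e, e] at he
  have hi' := hi.comp_sub_left T
  simp only [e, sub_sub_cancel] at hi'
  rw [← intervalIntegral.integral_comp_sub_left (fun τ => -(P.c3 * Real.exp (P.c2 *
    (m - P.c1 * T + P.c1 * τ)) * f (m - P.c1 * T + P.c1 * τ) τ)) T] at he
  simp only [e, intervalIntegral.integral_neg] at he
  refine ⟨hi'.symm.neg.congr fun r _ => ?_, by linarith⟩
  simp

/-- The integrated equation of `v`, backwards from the point `(m + c₄ ρ, T - ρ)`. -/
theorem VGood.backward (hc6 : P.c6 ≠ 0) {m T ρ R : ℝ}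
    (hz : ContinuousOn (Function.uncurry z) (Icc 0 L ×ˢ Ici 0))
    (h : VGood P L z v f (m + P.c4 * T)) (hρR : ρ ≤ R) (hRT : R ≤ T)
    (h1 : m + P.c4 * ρ ∈ Icc 0 L) (h2 : m + P.c4 * R ∈ Icc 0 L) :
    IntervalIntegrable (fun r => f (m + P.c4 * r) (T - r)) volume ρ R ∧
    v (m + P.c4 * ρ) (T - ρ) = v (m + P.c4 * R) (T - R)
      - (∫ r in ρ..R, P.c5 * Real.exp (-(P.c2 * (m + P.c4 * r))) * z (m + P.c4 * r) (T - r))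
      - P.c6 * ∫ r in ρ..R, f (m + P.c4 * r) (T - r) := by
  have e : ∀ r, m + P.c4 * T + -P.c4 * (T - r) = m + P.c4 * r := fun r => by ring
  obtain ⟨hi, he⟩ := h (T - R) (T - ρ) (by linarith) (by linarith) (by rwa [e]) (by rwa [e])
  rw [e, e] at he
  have hi' := hi.comp_sub_left T
  simp only [e, sub_sub_cancel] at hi'
  have hi2 : IntervalIntegrable (fun r => P.c5 * Real.exp (-(P.c2 * (m + P.c4 * r))) *
      z (m + P.c4 * r) (T - r) + P.c6 * f (m + P.c4 * r) (T - r)) volume ρ R := by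
    refine hi'.symm.neg.congr fun r _ => ?_
    simp
  have hzi : IntervalIntegrable (fun r => P.c5 * Real.exp (-(P.c2 * (m + P.c4 * r))) *
      z (m + P.c4 * r) (T - r)) volume ρ R := by
    refine ContinuousOn.intervalIntegrable ?_
    rw [uIcc_of_le hρR]
    refine ContinuousOn.mul (by fun_prop) (continuousOn_comp_path hz (by fun_prop) (by fun_prop)
      (fun r hr => mem_Icc_line h1 h2 hr) fun r hr => by linarith [hr.2])
  -- Integrability is known for the total forcing; its z-part is continuous, and division by c₆
  -- isolates f.
  have hfi : IntervalIntegrable (fun r => f (m + P.c4 * r) (T - r)) volume ρ R := by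
    have := (hi2.sub hzi).const_mul P.c6⁻¹
    refine this.congr (fun r _ => ?_)
    field_simp
    ring
  rw [← intervalIntegral.integral_comp_sub_left (fun τ => -(P.c5 * Real.exp (-(P.c2 *
    (m + P.c4 * T + -P.c4 * τ))) * z (m + P.c4 * T + -P.c4 * τ) τ
      + P.c6 * f (m + P.c4 * T + -P.c4 * τ) τ)) T] at he
  simp only [e, intervalIntegral.integral_neg] at he
  rw [intervalIntegral.integral_add hzi (hfi.const_mul _),
    intervalIntegral.integral_const_mul] at he
  exact ⟨hfi, by linarith⟩

/-- Green's formula for `z` on a region swept by characteristics: the characteristic with label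
`m` joins `(m - c₁ ρ(m), T - ρ(m))` to `(m - c₁ R(m), T - R(m))`. -/
theorem MildPlant.green (h : MildPlant P L z v f)
    {m₁ m₂ ra rb T : ℝ} {ρ R lo hi w : ℝ → ℝ}
    (hρ : Continuous ρ) (hR : Continuous R) (hw : Continuous w)
    (hm : m₁ ≤ m₂) (hr : ra ≤ rb) (hρR : ∀ m ∈ Icc m₁ m₂, ρ m ≤ R m)
    (hRT : ∀ m ∈ Icc m₁ m₂, R m ≤ T) (hρ0 : ∀ m ∈ Icc m₁ m₂, 0 ≤ ρ m)
    (hd1 : ∀ m ∈ Icc m₁ m₂, m - P.c1 * ρ m ∈ Icc 0 L)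
    (hd2 : ∀ m ∈ Icc m₁ m₂, m - P.c1 * R m ∈ Icc 0 L)
    (hlh : ∀ r ∈ Ioo ra rb, lo r ≤ hi r)
    (hiff : ∀ m r, (m ∈ Ioo m₁ m₂ ∧ r ∈ Ioo (ρ m) (R m)) ↔
      (r ∈ Ioo ra rb ∧ m ∈ Ioo (lo r) (hi r))) :
    ∫ m in m₁..m₂, w m * z (m - P.c1 * ρ m) (T - ρ m)
      = (∫ m in m₁..m₂, w m * z (m - P.c1 * R m) (T - R m))
        - ∫ r in ra..rb, ∫ y in (lo r - P.c1 * r)..(hi r - P.c1 * r),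
            w (y + P.c1 * r) * (P.c3 * Real.exp (P.c2 * y) * f y (T - r)) := by
  have hline : ∀ q : ℝ → ℝ, Continuous q → (∀ m ∈ Icc m₁ m₂, q m ≤ T) →
      (∀ m ∈ Icc m₁ m₂, m - P.c1 * q m ∈ Icc 0 L) →
      IntervalIntegrable (fun m => w m * z (m - P.c1 * q m) (T - q m)) volume m₁ m₂ := by
    intro q hq hqT hqd
    refine ContinuousOn.intervalIntegrable ?_
    rw [uIcc_of_le hm]
    exact hw.continuousOn.mul (continuousOn_comp_path h.z_cont (by fun_prop) (by fun_prop) hqd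
      fun m hm => sub_nonneg.2 (hqT m hm))
  set H : ℝ → ℝ → ℝ := fun m r =>
    w m * (P.c3 * Real.exp (P.c2 * (m - P.c1 * r)) * f (m - P.c1 * r) (T - r)) with hH
  -- integrability of the source on the region
  have hint : IntegrableOn (Function.uncurry H)
      {q | q.1 ∈ Ioo m₁ m₂ ∧ q.2 ∈ Ioo (ρ q.1) (R q.1)} := by
    have h1 := integrableOn_shear P.c1 (integrableOn_rect_of_memLp (h.f_memLp T))
    -- the reflection of time and the translation of the label
    have hmp : MeasurePreserving (fun q : ℝ × ℝ => (q.1 - P.c1 * T, T - q.2)) volume volume :=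
      (measurePreserving_sub_right (volume : Measure ℝ) (P.c1 * T)).prod
        (Measure.measurePreserving_sub_left (volume : Measure ℝ) T)
    have hmeas : MeasurableSet {q : ℝ × ℝ | q.1 + P.c1 * q.2 ∈ Icc 0 L ∧ q.2 ∈ Icc 0 T} :=
      (measurableSet_Icc.preimage (f := fun q : ℝ × ℝ => q.1 + P.c1 * q.2) (by fun_prop)).inter
        (measurableSet_Icc.preimage measurable_snd)
    have h2 := hmp.integrable_comp_of_integrable ((integrable_indicator_iff hmeas).2 h1)
    have h3 : IntegrableOn (fun q : ℝ × ℝ => f (q.1 - P.c1 * q.2) (T - q.2))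
        {q : ℝ × ℝ | q.1 - P.c1 * q.2 ∈ Icc 0 L ∧ q.2 ∈ Icc 0 T} := by
      have hmeas' : MeasurableSet {q : ℝ × ℝ | q.1 - P.c1 * q.2 ∈ Icc 0 L ∧ q.2 ∈ Icc 0 T} :=
        (measurableSet_Icc.preimage (f := fun q : ℝ × ℝ => q.1 - P.c1 * q.2) (by fun_prop)).inter
          (measurableSet_Icc.preimage measurable_snd)
      rw [← integrable_indicator_iff hmeas']
      refine h2.congr (Filter.Eventually.of_forall fun q => ?_)
      have e : q.1 - P.c1 * T + P.c1 * (T - q.2) = q.1 - P.c1 * q.2 := by ring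
      have eset : (q.1 - P.c1 * T, T - q.2) ∈
          {q : ℝ × ℝ | q.1 + P.c1 * q.2 ∈ Icc 0 L ∧ q.2 ∈ Icc 0 T} ↔
          q ∈ {q : ℝ × ℝ | q.1 - P.c1 * q.2 ∈ Icc 0 L ∧ q.2 ∈ Icc 0 T} := by
        simp only [mem_ofPred_eq, e, mem_Icc]
        constructor
        · rintro ⟨a, b, c⟩; exact ⟨a, by linarith, by linarith⟩
        · rintro ⟨a, b, c⟩; exact ⟨a, by linarith, by linarith⟩
      simp only [Function.comp_apply, indicator, eset, e]
    have hK : IsCompact (Icc m₁ m₂ ×ˢ Icc (0 : ℝ) T) := isCompact_Icc.prod isCompact_Icc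
    have h4 : IntegrableOn (fun q : ℝ × ℝ => f (q.1 - P.c1 * q.2) (T - q.2))
        {q | q.1 ∈ Ioo m₁ m₂ ∧ q.2 ∈ Ioo (ρ q.1) (R q.1)} := h3.mono_set fun q hq => by
      have hq1 := Ioo_subset_Icc_self hq.1
      refine ⟨?_, (hρ0 _ hq1).trans hq.2.1.le, hq.2.2.le.trans (hRT _ hq1)⟩
      have := mem_Icc_line (l := q.1) (c := -P.c1) (A := L) (τ := q.2) (t₁ := ρ q.1) (t₂ := R q.1)
        (by convert hd1 _ hq1 using 1; ring) (by convert hd2 _ hq1 using 1; ring)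
        (Ioo_subset_Icc_self hq.2)
      convert this using 1; ring
    have hwc : ContinuousOn (fun q : ℝ × ℝ => w q.1 * (P.c3 * Real.exp (P.c2 * (q.1 - P.c1 * q.2))))
        (Icc m₁ m₂ ×ˢ Icc (0 : ℝ) T) := by fun_prop
    have h5 := IntegrableOn.continuousOn_mul_of_subset hwc h4 hK
      (by
        have hρm := hρ.measurable; have hRm := hR.measurable
        exact (measurableSet_Ioo.preimage measurable_fst).inter
          ((measurableSet_lt (hρm.comp measurable_fst) measurable_snd).inter
            (measurableSet_lt measurable_snd (hRm.comp measurable_fst))))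
      (fun q hq => ⟨Ioo_subset_Icc_self hq.1, (hρ0 _ (Ioo_subset_Icc_self hq.1)).trans hq.2.1.le,
        hq.2.2.le.trans (hRT _ (Ioo_subset_Icc_self hq.1))⟩)
    refine h5.congr (Filter.Eventually.of_forall fun q => ?_)
    simp only [hH, Function.uncurry_def]
    ring
  have hswap := integral_swap_region (H := H) hρ.measurable hR.measurable hm hr
    (fun m hm => hρR m (Ioo_subset_Icc_self hm)) hlh hiff hint
  have hHi := intervalIntegrable_region_fst (H := H) hρ.measurable hR.measurable hm
    (fun m hm => hρR m (Ioo_subset_Icc_self hm)) hint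
  have hshift : ∫ r in ra..rb, ∫ y in (lo r - P.c1 * r)..(hi r - P.c1 * r),
        w (y + P.c1 * r) * (P.c3 * Real.exp (P.c2 * y) * f y (T - r))
      = ∫ r in ra..rb, ∫ m in (lo r)..(hi r), H m r := by
    congr 1; ext r
    rw [← intervalIntegral.integral_comp_sub_right (fun y => w (y + P.c1 * r) *
      (P.c3 * Real.exp (P.c2 * y) * f y (T - r)))]
    simp only [sub_add_cancel, hH]
  rw [hshift, ← hswap, ← intervalIntegral.integral_sub (hline R hR hRT hd2) hHi]
  refine intervalIntegral.integral_congr_ae ?_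
  -- For each good label this is the backward equation multiplied by w m; the weight is constant
  -- along the characteristic and comes out of the inner integral.
  have hg := ae_comp_affine h.ae_zGood one_ne_zero (-(P.c1 * T))
  filter_upwards [hg] with m hgm hm'
  rw [uIoc_of_le hm] at hm'
  have hmI : m ∈ Icc m₁ m₂ := Ioc_subset_Icc_self hm'
  have hgm' : ZGood P L z f (m - P.c1 * T) := by convert hgm using 1; ring
  obtain ⟨-, he⟩ := hgm'.backward (hρR m hmI) (hRT m hmI) (hd1 m hmI) (hd2 m hmI)
  rw [he, mul_sub]
  simp only [hH]
  rw [intervalIntegral.integral_const_mul]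

end ARZ

/-! ### The kernels of the feedback as label weights; the predictor away from the boundary. -/

namespace ARZ

/-- The weight of the characteristic `x + c₁ t = m` in the representation of the integral of `z`
along the `v`-characteristic through `x`. -/
noncomputable def labelWeight (P : ARZParams) (k x m : ℝ) : ℝ :=
  k * P.c5 / (P.c1 + P.c4) *
    Real.exp (-(P.c1 * P.c2 / (P.c1 + P.c4)) * x - P.c2 * P.c4 / (P.c1 + P.c4) * m)

section Weights

variable {P : ARZParams} (hP : P.Valid) (k x : ℝ)
include hP

/-- Where the swept region ends at the present time, the weight is the kernel of the z-integral in
the feedback, up to c₆. -/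
theorem labelWeight_base (y s : ℝ) :
    labelWeight P k x (y + P.c1 * s) = P.c6 * kerK P k x y s := by
  have h1 := hP.c1_pos; have h4 := hP.c4_pos; have h6 := hP.c6_pos.ne'
  have hs : P.c1 + P.c4 ≠ 0 := (add_pos h1 h4).ne'
  unfold labelWeight kerK
  field_simp

/-- Inside the swept region, weight times source of z is the kernel of the double integral of past
actuation; the coefficient comes from `c3_mul_c5`. -/
theorem labelWeight_source (y r u : ℝ) :
    labelWeight P k x (y + P.c1 * r) * (P.c3 * Real.exp (P.c2 * y) * u)
      = P.c6 * (kerG P k x y r * u) := by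
  have h1 := hP.c1_pos; have h4 := hP.c4_pos
  have hs : P.c1 + P.c4 ≠ 0 := (add_pos h1 h4).ne'
  have he : -(P.c1 * P.c2 / (P.c1 + P.c4)) * (x - y + P.c4 * r)
      = (-(P.c1 * P.c2 / (P.c1 + P.c4)) * x - P.c2 * P.c4 / (P.c1 + P.c4) * (y + P.c1 * r))
        + P.c2 * y := by
    field_simp; ring
  unfold labelWeight kerG
  rw [he, Real.exp_add]
  generalize Real.exp (-(P.c1 * P.c2 / (P.c1 + P.c4)) * x
    - P.c2 * P.c4 / (P.c1 + P.c4) * (y + P.c1 * r)) = E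
  have h := hP.c3_mul_c5
  field_simp
  linear_combination k * E * u * h

/-- This identity dictates the weight: the point x + c₄r of the v-characteristic has label m = x +
(c₁+c₄)r, so dm = (c₁+c₄) dr. -/
theorem labelWeight_side (r : ℝ) :
    (P.c1 + P.c4) * labelWeight P k x (x + (P.c1 + P.c4) * r)
      = k * (P.c5 * Real.exp (-(P.c2 * (x + P.c4 * r)))) := by
  have h1 := hP.c1_pos; have h4 := hP.c4_pos
  have hs : P.c1 + P.c4 ≠ 0 := (add_pos h1 h4).ne'
  have he : -(P.c1 * P.c2 / (P.c1 + P.c4)) * x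
      - P.c2 * P.c4 / (P.c1 + P.c4) * (x + (P.c1 + P.c4) * r) = -(P.c2 * (x + P.c4 * r)) := by
    field_simp; ring
  unfold labelWeight
  rw [he]
  field_simp

/-- On the reflected characteristic y = c₄(r - x/c₁) the same weight again gives c₅ e^{-c₂y}, up to
the factor k e^{-c₂x}. Hence the integral left there is the one in the conservation law. -/
theorem labelWeight_inlet (r : ℝ) :
    (P.c1 + P.c4) * labelWeight P k x ((P.c1 + P.c4) * r - P.c4 * (x / P.c1))
      = k * Real.exp (-(P.c2 * x)) * (P.c5 * Real.exp (-(P.c2 * (P.c4 * (r - x / P.c1))))) := by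
  have h1 := hP.c1_pos; have h4 := hP.c4_pos
  have hs : P.c1 + P.c4 ≠ 0 := (add_pos h1 h4).ne'
  have he : -(P.c1 * P.c2 / (P.c1 + P.c4)) * x
      - P.c2 * P.c4 / (P.c1 + P.c4) * ((P.c1 + P.c4) * r - P.c4 * (x / P.c1))
      = -(P.c2 * x) + -(P.c2 * (P.c4 * (r - x / P.c1))) := by
    field_simp; ring
  unfold labelWeight
  rw [he, Real.exp_add]
  field_simp

end Weights

theorem continuous_labelWeight (P : ARZParams) (k x : ℝ) : Continuous (labelWeight P k x) := by
  unfold labelWeight; fun_prop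

variable {P : ARZParams} {L D k : ℝ} {z v f : ℝ → ℝ → ℝ}

/-- Since e^{-c₁c₂r} = e^{-c₂x} e^{c₂(x - c₁r)}, the first integral of the feedback is the
accumulated source of z along its characteristic. -/
theorem ZGood.source_integral (hP : P.Valid) {x T d : ℝ} (h : ZGood P L z f (x - P.c1 * T))
    (hd : 0 ≤ d) (hdT : d ≤ T) (h1 : x ∈ Icc 0 L) (h2 : x - P.c1 * d ∈ Icc 0 L) :
    P.c6 * ∫ r in (0 : ℝ)..d, P.c1 * P.c2 * Real.exp (-(P.c1 * P.c2 * r)) * f (x - P.c1 * r) (T - r)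
      = P.c5 * Real.exp (-(P.c2 * x)) * (z (x - P.c1 * d) (T - d) - z x T) := by
  obtain ⟨-, he⟩ := h.backward hd hdT (by simpa using h1) h2
  rw [mul_zero, sub_zero, sub_zero] at he
  rw [he, ← intervalIntegral.integral_const_mul, sub_sub_cancel,
    ← intervalIntegral.integral_const_mul]
  congr 1; ext r
  have hE : Real.exp (-(P.c1 * P.c2 * r)) = Real.exp (-(P.c2 * x)) *
      Real.exp (P.c2 * (x - P.c1 * r)) := by
    rw [← Real.exp_add]; congr 1; ring
  rw [hE]
  linear_combination (-(Real.exp (-(P.c2 * x)) * Real.exp (P.c2 * (x - P.c1 * r)) *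
    f (x - P.c1 * r) (T - r))) * hP.c3_mul_c5

theorem labelWeight_integral_side (hP : P.Valid) (x T a b : ℝ) :
    ∫ m in (x + (P.c1 + P.c4) * a)..(x + (P.c1 + P.c4) * b), labelWeight P k x m *
        z (m - P.c1 * ((m - x) / (P.c1 + P.c4))) (T - (m - x) / (P.c1 + P.c4))
      = k * ∫ r in a..b, P.c5 * Real.exp (-(P.c2 * (x + P.c4 * r))) * z (x + P.c4 * r) (T - r) := by
  have hs : P.c1 + P.c4 ≠ 0 := (add_pos hP.c1_pos hP.c4_pos).ne'
  rw [← intervalIntegral.smul_integral_comp_add_mul, smul_eq_mul,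
    ← intervalIntegral.integral_const_mul, ← intervalIntegral.integral_const_mul]
  congr 1; ext r
  have e : (x + (P.c1 + P.c4) * r - x) / (P.c1 + P.c4) = r := by field_simp; ring
  rw [e, ← mul_assoc, labelWeight_side hP, show x + (P.c1 + P.c4) * r - P.c1 * r = x + P.c4 * r by
    ring]
  ring

theorem labelWeight_integral_base (hP : P.Valid) (x t a b : ℝ) :
    ∫ m in (a + P.c1 * D)..(b + P.c1 * D), labelWeight P k x m * z (m - P.c1 * D) (t + D - D)
      = P.c6 * ∫ y in a..b, kerK P k x y D * z y t := by
  rw [← intervalIntegral.integral_comp_add_right, ← intervalIntegral.integral_const_mul]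
  congr 1; ext y
  rw [labelWeight_base hP, add_sub_cancel_right, add_sub_cancel_right]
  ring

theorem labelWeight_integral_source (hP : P.Valid) (x t ra rb : ℝ) (A B A' B' : ℝ → ℝ)
    (hA : ∀ r, A r = A' r) (hB : ∀ r, B r = B' r) :
    ∫ r in ra..rb, ∫ y in (A r)..(B r), labelWeight P k x (y + P.c1 * r) *
        (P.c3 * Real.exp (P.c2 * y) * f y (t + D - r))
      = P.c6 * ∫ r in ra..rb, ∫ y in (A' r)..(B' r), kerG P k x y r * f y (t + (D - r)) := by
  rw [← intervalIntegral.integral_const_mul]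
  congr 1; ext r
  rw [hA, hB, ← intervalIntegral.integral_const_mul]
  congr 1; ext y
  rw [labelWeight_source hP, add_sub_assoc]

/-- Both characteristics through (x, t+D) reach time t inside [0, L]. The one of z gives z(x,t+D)
directly; the one of v leaves an integral of z along it, which Green's formula with `labelWeight`
converts into z at time t and past actuation. -/
theorem MildPlant.control_middle (h : MildPlant P L z v f) (hP : P.Valid) (hD : 0 ≤ D) {x t : ℝ}
    (ht : 0 ≤ t) (hx1 : P.c1 * D ≤ x) (hx2 : x ≤ L - P.c4 * D)
    (gz : ZGood P L z f (x - P.c1 * (t + D))) (gv : VGood P L z v f (x + P.c4 * (t + D))) :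
    P.c6 * (U2 P D k (fun y s => f y (t + s)) x - Z2 P k (fun y => z y t) x D
      - Y2 P k (fun y => v y t) x D)
      = k * v x (t + D) - P.c5 * Real.exp (-(P.c2 * x)) * z x (t + D) := by
  have h1 := hP.c1_pos; have h4 := hP.c4_pos; have h6 := hP.c6_pos
  have hs : 0 < P.c1 + P.c4 := add_pos h1 h4
  have h1D : 0 ≤ P.c1 * D := mul_nonneg h1.le hD
  have h4D : 0 ≤ P.c4 * D := mul_nonneg h4.le hD
  have hxm : x ∈ Icc 0 L := ⟨by linarith, by linarith⟩
  have hZ := gz.source_integral hP hD (by linarith) hxm ⟨by linarith, by linarith⟩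
  obtain ⟨-, hV⟩ := gv.backward h6.ne' h.z_cont hD (by linarith) (by simpa using hxm)
    ⟨by linarith, by linarith⟩
  -- The label m meets the v-characteristic at r = (m - x)/(c₁+c₄) and the time t at r = D.
  have hG := h.green (w := labelWeight P k x) (T := t + D) (m₁ := x + (P.c1 + P.c4) * 0)
    (m₂ := x + (P.c1 + P.c4) * D) (ra := 0) (rb := D) (ρ := fun m => (m - x) / (P.c1 + P.c4))
    (R := fun _ => D) (lo := fun _ => x) (hi := fun r => x + (P.c1 + P.c4) * r)
    (by fun_prop) (by fun_prop) (continuous_labelWeight P k x) (by nlinarith) hD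
    (fun m hm => by rw [div_le_iff₀ hs]; nlinarith [hm.2]) (fun m _ => by linarith)
    (fun m hm => div_nonneg (by nlinarith [hm.1]) hs.le)
    (fun m hm => by
      have e : m - P.c1 * ((m - x) / (P.c1 + P.c4)) = x + P.c4 * ((m - x) / (P.c1 + P.c4)) := by
        field_simp; ring
      have a1 : 0 ≤ (m - x) / (P.c1 + P.c4) := div_nonneg (by nlinarith [hm.1]) hs.le
      have a2 : (m - x) / (P.c1 + P.c4) ≤ D := by rw [div_le_iff₀ hs]; nlinarith [hm.2]
      rw [e]
      exact ⟨by nlinarith [hxm.1], by nlinarith⟩)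
    (fun m hm => ⟨by linarith [hm.1], by linarith [hm.2]⟩)
    (fun r hr => by nlinarith [hr.1])
    (fun m r => by
      simp only [mem_Ioo, div_lt_iff₀ hs]
      constructor
      · rintro ⟨⟨a, b⟩, c, d⟩
        exact ⟨⟨by nlinarith, d⟩, by linarith, by linarith⟩
      · rintro ⟨⟨a, b⟩, c, d⟩
        exact ⟨⟨by linarith, by nlinarith⟩, by linarith, b⟩)
  rw [labelWeight_integral_side hP,
    show x + (P.c1 + P.c4) * 0 = (x - P.c1 * D) + P.c1 * D by ring,
    show x + (P.c1 + P.c4) * D = (x + P.c4 * D) + P.c1 * D by ring,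
    labelWeight_integral_base hP,
    labelWeight_integral_source hP x t 0 D _ _ (fun r => x - P.c1 * r) (fun r => x + P.c4 * r)
      (fun _ => rfl) (fun r => by ring)] at hG
  unfold U2 Z2 Y2
  simp only [mul_zero, add_zero, sub_zero, add_sub_cancel_right] at hZ hV hG
  simp only [add_sub_assoc] at hZ hV hG
  rw [intervalIntegral.integral_const_mul]
  have e1 : P.c6 * (P.c5 / P.c6 * Real.exp (-(P.c2 * x)) * z (x - P.c1 * D) t)
      = P.c5 * Real.exp (-(P.c2 * x)) * z (x - P.c1 * D) t := by field_simp
  have e2 : P.c6 * (k / P.c6 * v (x + P.c4 * D) t) = k * v (x + P.c4 * D) t := by field_simp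
  linear_combination hZ - k * hV + hG - e1 + e2

end ARZ

/-! ### The predictor near the outlet and near the inlet. -/

namespace ARZ

variable {P : ARZParams} {L D k : ℝ} {z v f : ℝ → ℝ → ℝ}

set_option maxHeartbeats 1600000 in
-- Followed backwards, the v-characteristic meets the outlet at r₁ = (L - x)/c₄, and the outlet
-- equation continues down to time t. The integrals of z along the characteristic and along x = L
-- are swept by two families of z-characteristics; the line separating them passes through (L,
-- t+D-r₁) and is traced by `brk`.
theorem MildPlant.control_outlet (h : MildPlant P L z v f) (hP : P.Valid) (hD : 0 ≤ D) {x t : ℝ}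
    (ht : 0 ≤ t) (hx1 : P.c1 * D ≤ x) (hx2 : L - P.c4 * D ≤ x) (hxL : x ≤ L)
    (gz : ZGood P L z f (x - P.c1 * (t + D))) (gv : VGood P L z v f (x + P.c4 * (t + D))) :
    P.c6 * (U3 P L D k (fun y s => f y (t + s)) x - Z3 P L k (fun y => z y t) x D
      + k / P.c6 * v L t)
      = k * v x (t + D) - P.c5 * Real.exp (-(P.c2 * x)) * z x (t + D) := by
  have h1 := hP.c1_pos; have h4 := hP.c4_pos; have h6 := hP.c6_pos
  have hs : 0 < P.c1 + P.c4 := add_pos h1 h4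
  have h1D : 0 ≤ P.c1 * D := mul_nonneg h1.le hD
  set r₁ := (L - x) / P.c4 with hr₁
  have hr1x : P.c4 * r₁ = L - x := by rw [hr₁]; field_simp
  have hr0 : 0 ≤ r₁ := div_nonneg (by linarith) h4.le
  have hrD : r₁ ≤ D := by rw [hr₁, div_le_iff₀ h4]; linarith
  have hbrk : ∀ r, brk P L x r = L + P.c1 * r₁ - P.c1 * r := fun r => by
    unfold brk; rw [hr₁]; field_simp; ring
  have hmb : x + (P.c1 + P.c4) * r₁ = L + P.c1 * r₁ := by linarith
  have hxm : x ∈ Icc 0 L := ⟨by linarith, hxL⟩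
  have hZ := gz.source_integral hP hD (by linarith) hxm ⟨by linarith, by linarith⟩
  obtain ⟨-, hV⟩ := gv.backward h6.ne' h.z_cont hr0 (by linarith) (by simpa using hxm)
    ⟨by linarith [hxm.1], by linarith⟩
  have hO := h.outlet t (t + D - r₁) ht (by linarith)
  have c1r : P.c1 * r₁ ≤ P.c1 * D := by nlinarith
  -- characteristics which leave through the `v`-characteristic
  have hG := h.green (w := labelWeight P k x) (T := t + D) (m₁ := x + (P.c1 + P.c4) * 0)
    (m₂ := x + (P.c1 + P.c4) * r₁) (ra := 0) (rb := D) (ρ := fun m => (m - x) / (P.c1 + P.c4))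
    (R := fun _ => D) (lo := fun _ => x)
    (hi := fun r => min (x + (P.c1 + P.c4) * r) (x + (P.c1 + P.c4) * r₁))
    (by fun_prop) (by fun_prop) (continuous_labelWeight P k x) (by nlinarith) hD
    (fun m hm => by rw [div_le_iff₀ hs]; nlinarith [hm.2]) (fun m _ => by linarith)
    (fun m hm => div_nonneg (by nlinarith [hm.1]) hs.le)
    (fun m hm => by
      have e : m - P.c1 * ((m - x) / (P.c1 + P.c4)) = x + P.c4 * ((m - x) / (P.c1 + P.c4)) := by
        field_simp; ring
      have a1 : 0 ≤ (m - x) / (P.c1 + P.c4) := div_nonneg (by nlinarith [hm.1]) hs.le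
      have a2 : (m - x) / (P.c1 + P.c4) ≤ r₁ := by rw [div_le_iff₀ hs]; nlinarith [hm.2]
      rw [e]
      exact ⟨by nlinarith [hxm.1], by nlinarith⟩)
    (fun m hm => ⟨by linarith [hm.1], by linarith [hm.2]⟩)
    (fun r hr => le_min (by nlinarith [hr.1]) (by nlinarith))
    (fun m r => by
      simp only [mem_Ioo, div_lt_iff₀ hs, lt_min_iff]
      constructor
      · rintro ⟨⟨a, b⟩, c, d⟩
        exact ⟨⟨by nlinarith, d⟩, by linarith, by linarith, b⟩
      · rintro ⟨⟨a, b⟩, c, d, e⟩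
        exact ⟨⟨by linarith, e⟩, by linarith, b⟩)
  rw [labelWeight_integral_side hP,
    show x + (P.c1 + P.c4) * 0 = (x - P.c1 * D) + P.c1 * D by ring,
    show x + (P.c1 + P.c4) * r₁ = brk P L x D + P.c1 * D by rw [hbrk]; linarith,
    labelWeight_integral_base hP,
    labelWeight_integral_source hP x t 0 D _ _ (fun r => x - P.c1 * r)
      (fun r => min (x + P.c4 * r) (brk P L x r))
      (fun _ => by ring) (fun r => by
        rw [← min_sub_sub_right, hbrk, hbrk]
        congr 1 <;> ring)] at hG
  -- characteristics which leave through the outlet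
  have hG' := h.green (w := fun _ => k * P.c5 / P.c1 * Real.exp (-(P.c2 * L))) (T := t + D)
    (m₁ := L + P.c1 * r₁)
    (m₂ := L + P.c1 * D) (ra := r₁) (rb := D) (ρ := fun m => (m - L) / P.c1)
    (R := fun _ => D) (lo := fun _ => L + P.c1 * r₁) (hi := fun r => L + P.c1 * r)
    (by fun_prop) (by fun_prop) (by fun_prop) (by linarith) hrD
    (fun m hm => by rw [div_le_iff₀ h1]; nlinarith [hm.2]) (fun m _ => by linarith)
    (fun m hm => div_nonneg (by nlinarith [hm.1]) h1.le)
    (fun m hm => by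
      have e : m - P.c1 * ((m - L) / P.c1) = L := by field_simp; ring
      rw [e]; exact ⟨by linarith [hxm.1], le_rfl⟩)
    (fun m hm => ⟨by nlinarith [hm.1], by linarith [hm.2]⟩)
    (fun r hr => by nlinarith [hr.1])
    (fun m r => by
      simp only [mem_Ioo, div_lt_iff₀ h1]
      constructor
      · rintro ⟨⟨a, b⟩, c, d⟩
        exact ⟨⟨by nlinarith, d⟩, by linarith, by linarith⟩
      · rintro ⟨⟨a, b⟩, c, d⟩
        exact ⟨⟨by linarith, by nlinarith⟩, by linarith, b⟩)
  -- At the outlet m = L + c₁r, so dm = c₁ dr; this is the origin of the divisor c₁ in the constant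
  -- weight.
  have hside : ∫ m in (L + P.c1 * r₁)..(L + P.c1 * D), k * P.c5 / P.c1 * Real.exp (-(P.c2 * L)) *
        z (m - P.c1 * ((m - L) / P.c1)) (t + D - (m - L) / P.c1)
      = k * (P.c5 * Real.exp (-(P.c2 * L)) * ∫ r in r₁..D, z L (t + D - r)) := by
    rw [← intervalIntegral.smul_integral_comp_add_mul, smul_eq_mul,
      intervalIntegral.integral_const_mul]
    have e : ∀ r, (L + P.c1 * r - L) / P.c1 = r := fun r => by field_simp; ring
    simp only [e, add_sub_cancel_right]
    field_simp
  have hbase : ∫ m in (L + P.c1 * r₁)..(L + P.c1 * D), k * P.c5 / P.c1 * Real.exp (-(P.c2 * L)) *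
        z (m - P.c1 * D) (t + D - D)
      = P.c6 * ∫ y in (brk P L x D)..L, k * P.c5 / (P.c1 * P.c6) * Real.exp (-(P.c2 * L)) * z y t := by
    rw [show L + P.c1 * r₁ = brk P L x D + P.c1 * D by rw [hbrk]; ring,
      ← intervalIntegral.integral_comp_add_right, ← intervalIntegral.integral_const_mul]
    congr 1; ext y
    simp only [add_sub_cancel_right]
    field_simp
  have hsource : ∫ r in r₁..D, ∫ y in (L + P.c1 * r₁ - P.c1 * r)..(L + P.c1 * r - P.c1 * r),
        k * P.c5 / P.c1 * Real.exp (-(P.c2 * L)) *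
        (P.c3 * Real.exp (P.c2 * y) * f y (t + D - r))
      = P.c6 * ∫ r in r₁..D, ∫ y in (brk P L x r)..L,
        k * P.c2 * Real.exp (-(P.c2 * (L - y))) * f y (t + (D - r)) := by
    rw [← intervalIntegral.integral_const_mul]
    congr 1; ext r
    rw [hbrk, add_sub_cancel_right, ← intervalIntegral.integral_const_mul]
    congr 1; ext y
    have hE : Real.exp (-(P.c2 * (L - y))) = Real.exp (-(P.c2 * L)) * Real.exp (P.c2 * y) := by
      rw [← Real.exp_add]; congr 1; ring
    rw [hE, add_sub_assoc]
    have hr := hP.c3_mul_c5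
    field_simp
    linear_combination k * f y (t + (D - r)) * hr
  rw [hside, hbase, hsource] at hG'
  -- the outlet equation, backwards in time
  have hLm : L ∈ Icc 0 L := ⟨by linarith [hxm.1], le_rfl⟩
  have hzL : IntervalIntegrable (fun r => z L (t + D - r)) volume r₁ D := by
    refine ContinuousOn.intervalIntegrable ?_
    rw [uIcc_of_le hrD]
    exact continuousOn_comp_path h.z_cont continuousOn_const (by fun_prop) (fun _ _ => hLm)
      fun r hr => by linarith [hr.2]
  have hfL : IntervalIntegrable (fun r => f L (t + D - r)) volume r₁ D := by
    refine ContinuousOn.intervalIntegrable ?_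
    rw [uIcc_of_le hrD]
    exact h.f_outlet_cont.comp (f := fun r => t + D - r) (by fun_prop)
      fun r hr => by simp only [mem_Ici]; linarith [hr.2]
  rw [show t = t + D - D by ring, show t + D - D + D - r₁ = t + D - r₁ by ring,
    ← intervalIntegral.integral_comp_sub_left (fun τ => -(P.c5 * Real.exp (-(P.c2 * L)) * z L τ
      + P.c6 * f L τ)) (t + D), intervalIntegral.integral_neg,
    intervalIntegral.integral_add (hzL.const_mul _) (hfL.const_mul _),
    intervalIntegral.integral_const_mul, intervalIntegral.integral_const_mul] at hO
  have eL : x + P.c4 * r₁ = L := by linarith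
  unfold U3 Z3
  rw [← hr₁]
  simp only [mul_zero, add_zero, sub_zero, add_sub_cancel_right, eL] at hZ hV hG hO
  simp only [add_sub_assoc] at hZ hV hG hO hG' ⊢
  rw [intervalIntegral.integral_const_mul, intervalIntegral.integral_const_mul]
  have e1 : P.c6 * (P.c5 / P.c6 * Real.exp (-(P.c2 * x)) * z (x - P.c1 * D) t)
      = P.c5 * Real.exp (-(P.c2 * x)) * z (x - P.c1 * D) t := by field_simp
  have e2 : P.c6 * (k / P.c6 * v L t) = k * v L t := by field_simp
  linear_combination hZ - k * hV + hG + hG' - e1 + e2 + k * hO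

set_option maxHeartbeats 1600000 in
-- Followed backwards, the z-characteristic meets the inlet at r₀ = x/c₁, where z = -c₇ v, and v(0,
-- ·) is then followed along the reflected v-characteristic. The integral of z along that line
-- appears once from Green's formula, with factor k e^{-c₂x}, and once from v, with factor c₅c₇
-- e^{-c₂x}. The conservation law evaluates it from the state at time t.
theorem MildPlant.control_inlet (h : MildPlant P L z v f) (hP : P.Valid)
    (hLD : (P.c1 + P.c4) * D ≤ L) {x t : ℝ}
    (ht : 0 ≤ t) (hx0 : 0 ≤ x) (hx1 : x ≤ P.c1 * D)
    (gz : ZGood P L z f (x - P.c1 * (t + D))) (gv : VGood P L z v f (x + P.c4 * (t + D)))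
    (gv' : VGood P L z v f (-(P.c4 * (x / P.c1)) + P.c4 * (t + D))) :
    P.c6 * (U1 P D k (fun y s => f y (t + s)) x - Z1 P k (fun y => z y t) x D
      - Y1 P k (fun y => v y t) x D)
      = k * v x (t + D) - P.c5 * Real.exp (-(P.c2 * x)) * z x (t + D) := by
  have h1 := hP.c1_pos; have h4 := hP.c4_pos; have h6 := hP.c6_pos
  have hs : 0 < P.c1 + P.c4 := add_pos h1 h4
  set r₀ := x / P.c1 with hr₀
  have hr0x : P.c1 * r₀ = x := by rw [hr₀]; field_simp
  have hr0 : 0 ≤ r₀ := div_nonneg hx0 h1.le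
  have hrD : r₀ ≤ D := by rw [hr₀, div_le_iff₀ h1]; linarith
  have hD : 0 ≤ D := hr0.trans hrD
  have h4D : P.c4 * r₀ ≤ P.c4 * D := by nlinarith
  have h4r : 0 ≤ P.c4 * r₀ := mul_nonneg h4.le hr0
  have hxm : x ∈ Icc 0 L := ⟨hx0, by nlinarith⟩
  have hL : 0 ≤ L := hxm.1.trans hxm.2
  have hZ := gz.source_integral hP hr0 (by linarith) hxm ⟨by linarith, by linarith⟩
  obtain ⟨-, hV⟩ := gv.backward h6.ne' h.z_cont hD (by linarith) (by simpa using hxm)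
    ⟨by nlinarith, by nlinarith⟩
  obtain ⟨-, hV'⟩ := gv'.backward h6.ne' h.z_cont hrD (by linarith) ⟨by linarith, by linarith⟩
    ⟨by linarith, by nlinarith⟩
  have hI := h.inlet (t + D - r₀) (by linarith)
  have hC := h.conservation t (t + D - r₀) ht (by linarith) (by nlinarith)
  set s := P.c1 + P.c4 with hsdef
  -- The label m is met by the v-characteristic at r = (m - x)/s and by the reflected one exactly r₀
  -- later, unless the time t, at r = D, comes first.
  have hG := h.green (w := labelWeight P k x) (T := t + D) (m₁ := x + s * 0)
    (m₂ := x + s * D) (ra := 0) (rb := D) (ρ := fun m => (m - x) / s)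
    (R := fun m => min D ((m - x) / s + r₀)) (lo := fun r => max x (x + s * (r - r₀)))
    (hi := fun r => x + s * r)
    (by fun_prop) (by fun_prop) (continuous_labelWeight P k x) (by nlinarith) hD
    (fun m hm => le_min (by rw [div_le_iff₀ hs]; nlinarith [hm.2]) (by linarith))
    (fun m _ => (min_le_left _ _).trans (by linarith))
    (fun m hm => div_nonneg (by nlinarith [hm.1]) hs.le)
    (fun m hm => by
      have e : m - P.c1 * ((m - x) / s) = x + P.c4 * ((m - x) / s) := by
        rw [hsdef]; field_simp; ring
      have a1 : 0 ≤ (m - x) / s := div_nonneg (by nlinarith [hm.1]) hs.le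
      have a2 : (m - x) / s ≤ D := by rw [div_le_iff₀ hs]; nlinarith [hm.2]
      rw [e]
      exact ⟨by nlinarith [hxm.1], by nlinarith⟩)
    (fun m hm => by
      have e : m - P.c1 * ((m - x) / s) = x + P.c4 * ((m - x) / s) := by
        rw [hsdef]; field_simp; ring
      have a1 : 0 ≤ (m - x) / s := div_nonneg (by nlinarith [hm.1]) hs.le
      have a2 : (m - x) / s ≤ D := by rw [div_le_iff₀ hs]; nlinarith [hm.2]
      have b1 : min D ((m - x) / s + r₀) ≤ (m - x) / s + r₀ := min_le_right _ _
      have b2 : (m - x) / s ≤ min D ((m - x) / s + r₀) := le_min a2 (by linarith)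
      exact ⟨by nlinarith, by nlinarith⟩)
    (fun r hr => max_le (by nlinarith [hr.1]) (by nlinarith))
    (fun m r => by
      have e : r < (m - x) / s + r₀ ↔ x + s * (r - r₀) < m := by
        rw [← sub_lt_iff_lt_add, lt_div_iff₀ hs]
        constructor <;> intro h <;> linarith
      simp only [mem_Ioo, lt_min_iff, max_lt_iff, e, div_lt_iff₀ hs]
      constructor
      · rintro ⟨⟨a, b⟩, c, d, g⟩
        exact ⟨⟨by nlinarith, d⟩, ⟨by linarith, g⟩, by linarith⟩
      · rintro ⟨⟨a, b⟩, ⟨c, g⟩, d⟩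
        exact ⟨⟨by linarith, by nlinarith⟩, by linarith, b, g⟩)
  -- the labels below `ms` end on the reflected characteristic, the others at the initial time
  set ms := x + s * (D - r₀) with hms
  have hmsm : ms ∈ Icc (x + s * 0) (x + s * D) := ⟨by nlinarith, by nlinarith⟩
  have hend : IntervalIntegrable (fun m => labelWeight P k x m *
      z (m - P.c1 * min D ((m - x) / s + r₀)) (t + D - min D ((m - x) / s + r₀))) volume
      (x + s * 0) (x + s * D) := by
    refine ContinuousOn.intervalIntegrable ?_
    rw [uIcc_of_le (hmsm.1.trans hmsm.2)]
    refine (continuous_labelWeight P k x).continuousOn.mul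
      (continuousOn_comp_path h.z_cont (by fun_prop) (by fun_prop) (fun m hm => ?_) fun m _ => ?_)
    · have e : m - P.c1 * ((m - x) / s) = x + P.c4 * ((m - x) / s) := by
        rw [hsdef]; field_simp; ring
      have a1 : 0 ≤ (m - x) / s := div_nonneg (by nlinarith [hm.1]) hs.le
      have a2 : (m - x) / s ≤ D := by rw [div_le_iff₀ hs]; nlinarith [hm.2]
      have b1 : min D ((m - x) / s + r₀) ≤ (m - x) / s + r₀ := min_le_right _ _
      have b2 : (m - x) / s ≤ min D ((m - x) / s + r₀) := le_min a2 (by linarith)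
      exact ⟨by nlinarith, by nlinarith⟩
    · linarith [min_le_left D ((m - x) / s + r₀)]
  have hsplit := intervalIntegral.integral_add_adjacent_intervals
    (hend.mono_set (uIcc_subset_uIcc_left (by rwa [uIcc_of_le (hmsm.1.trans hmsm.2)])))
    (hend.mono_set (uIcc_subset_uIcc_right (by rwa [uIcc_of_le (hmsm.1.trans hmsm.2)])))
  have hlow : ∫ m in (x + s * 0)..ms, labelWeight P k x m *
      z (m - P.c1 * min D ((m - x) / s + r₀)) (t + D - min D ((m - x) / s + r₀))
      = k * Real.exp (-(P.c2 * x)) * ∫ r in r₀..D, P.c5 * Real.exp (-(P.c2 * (P.c4 * (r - r₀)))) *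
          z (P.c4 * (r - r₀)) (t + D - r) := by
    have ea : x + s * 0 = -(P.c4 * r₀) + s * r₀ := by rw [hsdef]; linarith
    have eb : ms = -(P.c4 * r₀) + s * D := by rw [hms, hsdef]; linarith
    rw [ea, eb, ← intervalIntegral.smul_integral_comp_add_mul, smul_eq_mul,
      ← intervalIntegral.integral_const_mul, ← intervalIntegral.integral_const_mul]
    refine intervalIntegral.integral_congr fun r hr => ?_
    rw [uIcc_of_le hrD] at hr
    have e1 : (-(P.c4 * r₀) + s * r - x) / s + r₀ = r := by
      rw [← hr0x, hsdef]; field_simp; ring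
    have e2 := labelWeight_inlet hP k x r
    rw [← hr₀, ← hsdef] at e2
    simp only [e1, min_eq_right hr.2]
    rw [← mul_assoc, show -(P.c4 * r₀) + s * r = s * r - P.c4 * r₀ by ring, e2,
      show s * r - P.c4 * r₀ - P.c1 * r = P.c4 * (r - r₀) by rw [hsdef]; ring]
    ring
  have hup : ∫ m in ms..(x + s * D), labelWeight P k x m *
      z (m - P.c1 * min D ((m - x) / s + r₀)) (t + D - min D ((m - x) / s + r₀))
      = P.c6 * ∫ y in (P.c4 * (D - r₀))..(x + P.c4 * D), kerK P k x y D * z y t := by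
    rw [← labelWeight_integral_base hP, show ms = P.c4 * (D - r₀) + P.c1 * D by
      rw [hms, hsdef]; linarith, show x + s * D = x + P.c4 * D + P.c1 * D by rw [hsdef]; ring]
    refine intervalIntegral.integral_congr fun m hm => ?_
    rw [uIcc_of_le (by nlinarith)] at hm
    have e1 : D ≤ (m - x) / s + r₀ := by
      rw [← sub_le_iff_le_add, le_div_iff₀ hs, hsdef]
      nlinarith [hm.1]
    simp only [min_eq_left e1]
  rw [← hsplit, hlow, hup, labelWeight_integral_side hP,
    labelWeight_integral_source hP x t 0 D _ _
      (fun r => max (x - P.c1 * r) (P.c4 * (r - r₀))) (fun r => x + P.c4 * r)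
      (fun r => by
        rw [← max_sub_sub_right]
        congr 1
        rw [hsdef]; linarith) (fun r => by rw [hsdef]; ring)] at hG
  -- the conservation law below the reflected characteristic
  have eCt : t + D - r₀ - t = D - r₀ := by ring
  rw [eCt, show (∫ τ in t..(t + D - r₀), P.c5 * Real.exp (-(P.c2 * (P.c4 * (t + D - r₀ - τ)))) *
      z (P.c4 * (t + D - r₀ - τ)) τ) = ∫ r in r₀..D, P.c5 * Real.exp (-(P.c2 * (P.c4 * (r - r₀)))) *
      z (P.c4 * (r - r₀)) (t + D - r) by
    have := intervalIntegral.integral_comp_sub_left (fun τ => P.c5 *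
      Real.exp (-(P.c2 * (P.c4 * (t + D - r₀ - τ)))) * z (P.c4 * (t + D - r₀ - τ)) τ) (t + D)
      (a := r₀) (b := D)
    rw [add_sub_cancel_right] at this
    rw [← this]
    congr 1; ext r
    rw [show t + D - r₀ - (t + D - r) = r - r₀ by ring]] at hC
  have hcx : ∀ {g : ℝ → ℝ → ℝ}, ContinuousOn (Function.uncurry g) (Icc 0 L ×ˢ Ici 0) →
      ContinuousOn (fun y => g y t) (uIcc 0 (P.c4 * (D - r₀))) := fun hg =>
    continuousOn_comp_path hg continuousOn_id continuousOn_const (fun y hy => by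
      rw [uIcc_of_le (by nlinarith)] at hy
      exact ⟨hy.1, hy.2.trans (by nlinarith)⟩) fun _ _ => ht
  have hiz : IntervalIntegrable (fun y => P.c5 * Real.exp (-(P.c2 * y)) * z y t) volume 0
      (P.c4 * (D - r₀)) := (ContinuousOn.mul (by fun_prop) (hcx h.z_cont)).intervalIntegrable
  rw [intervalIntegral.integral_sub hiz ((hcx h.v_cont).intervalIntegrable.const_mul _),
    intervalIntegral.integral_const_mul] at hC
  have hZ1 : P.c6 * ∫ y in (0 : ℝ)..(P.c4 * (D - r₀)),
      P.c5 * (k + P.c5 * P.c7) / (P.c6 * s) * Real.exp (-(P.c2 * (x + y))) * z y t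
      = (k + P.c5 * P.c7) / s * Real.exp (-(P.c2 * x)) *
        ∫ y in (0 : ℝ)..(P.c4 * (D - r₀)), P.c5 * Real.exp (-(P.c2 * y)) * z y t := by
    rw [← intervalIntegral.integral_const_mul, ← intervalIntegral.integral_const_mul]
    congr 1; ext y
    rw [show -(P.c2 * (x + y)) = -(P.c2 * x) + -(P.c2 * y) by ring, Real.exp_add]
    field_simp
  have hf2 : ∫ r in r₀..D, P.c5 * P.c7 * Real.exp (-(P.c2 * x)) * f (P.c4 * (r - r₀)) (t + (D - r))
      = P.c5 * P.c7 * Real.exp (-(P.c2 * x)) *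
        ∫ r in r₀..D, f (P.c4 * (r - r₀)) (t + (D - r)) := intervalIntegral.integral_const_mul _ _
  unfold U1 Z1 Y1
  rw [← hr₀, ← hsdef, hf2, intervalIntegral.integral_const_mul, intervalIntegral.integral_const_mul]
  have eline : ∀ r, -(P.c4 * r₀) + P.c4 * r = P.c4 * (r - r₀) := fun r => by ring
  simp only [eline] at hV'
  simp only [mul_zero, add_zero, sub_zero, add_sub_cancel_right, sub_self, hr0x] at hZ hV hG hV'
  simp only [add_sub_assoc] at hZ hV hG hC hV' hI ⊢
  rw [hI] at hZ
  generalize (∫ y in (0 : ℝ)..(P.c4 * (D - r₀)), P.c5 * Real.exp (-(P.c2 * y)) * z y t) = A at *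
  generalize (∫ y in (0 : ℝ)..(P.c4 * (D - r₀)), v y t) = B at *
  have hs' := hs.ne'
  have hA : A = s * (∫ r in r₀..D, P.c5 * Real.exp (-(P.c2 * (P.c4 * (r - r₀)))) *
      z (P.c4 * (r - r₀)) (t + (D - r))) + P.c1 * P.c2 * B := by linarith
  have e1 : (k + P.c5 * P.c7) / s * Real.exp (-(P.c2 * x)) * A
      = (k + P.c5 * P.c7) * Real.exp (-(P.c2 * x)) *
        (∫ r in r₀..D, P.c5 * Real.exp (-(P.c2 * (P.c4 * (r - r₀)))) *
        z (P.c4 * (r - r₀)) (t + (D - r)))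
        + P.c1 * P.c2 * (k + P.c5 * P.c7) / s * Real.exp (-(P.c2 * x)) * B := by
    rw [hA]; field_simp
  -- By `c5_mul_c7`, c₁c₅c₇/c₄ = c₁c₂: the v-integral in the feedback is the one left over by the
  -- conservation law.
  have e2 : P.c6 * (P.c1 * P.c5 * P.c7 * (k + P.c5 * P.c7) / (P.c4 * P.c6 * s) *
      Real.exp (-(P.c2 * x)) * B)
      = P.c1 * P.c2 * (k + P.c5 * P.c7) / s * Real.exp (-(P.c2 * x)) * B := by
    have h57 := hP.c5_mul_c7
    have h4' := h4.ne'
    field_simp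
    linear_combination B * (P.c5 * P.c7 + k) * h57
  have e3 : P.c6 * (P.c5 * P.c7 / P.c6 * Real.exp (-(P.c2 * x)) * v (P.c4 * (D - r₀)) t)
      = P.c5 * P.c7 * Real.exp (-(P.c2 * x)) * v (P.c4 * (D - r₀)) t := by field_simp
  have e4 : P.c6 * (k / P.c6 * v (x + P.c4 * D) t) = k * v (x + P.c4 * D) t := by field_simp
  linear_combination hZ - k * hV + hG - (P.c5 * P.c7 * Real.exp (-(P.c2 * x))) * hV' - hZ1 - e1
    + e2 + e3 + e4

end ARZ

/-! ### Insensitivity of the feedback to null sets, and the delay-free law after one delay. -/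

namespace ARZ

section Congr

variable {L D : ℝ} {φ φ' : ℝ → ℝ → ℝ}

/-- The content of the delay line is known only at almost every position. A line with q ≠ 0 crosses
positions transversally, so the exceptional ones occupy a null set of r. -/
theorem integral_line_congr
    (h : ∀ᵐ y : ℝ, y ∈ Icc 0 L → ∀ s ∈ Icc 0 D, φ y s = φ' y s) {a b q : ℝ} (p : ℝ) (hq : q ≠ 0)
    (ha : 0 ≤ a) (hab : a ≤ b) (hb : b ≤ D) (hr : ∀ r ∈ Icc a b, p + q * r ∈ Icc 0 L)
    (w : ℝ → ℝ) :
    ∫ r in a..b, w r * φ (p + q * r) (D - r) = ∫ r in a..b, w r * φ' (p + q * r) (D - r) := by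
  refine intervalIntegral.integral_congr_ae ?_
  filter_upwards [ae_comp_affine h hq p] with r hr' hrm
  rw [uIoc_of_le hab] at hrm
  rw [hr' (hr r (Ioc_subset_Icc_self hrm)) _ ⟨by linarith [hrm.2], by linarith [hrm.1]⟩]

theorem integral_region_congr
    (h : ∀ᵐ y : ℝ, y ∈ Icc 0 L → ∀ s ∈ Icc 0 D, φ y s = φ' y s) {a b : ℝ}
    (ha : 0 ≤ a) (hab : a ≤ b) (hb : b ≤ D) {A B : ℝ → ℝ} (hA : ∀ r ∈ Icc a b, A r ∈ Icc 0 L)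
    (hB : ∀ r ∈ Icc a b, B r ∈ Icc 0 L) (w : ℝ → ℝ → ℝ) :
    ∫ r in a..b, ∫ y in (A r)..(B r), w r y * φ y (D - r)
      = ∫ r in a..b, ∫ y in (A r)..(B r), w r y * φ' y (D - r) := by
  refine intervalIntegral.integral_congr fun r hr => ?_
  rw [uIcc_of_le hab] at hr
  refine intervalIntegral.integral_congr_ae ?_
  filter_upwards [h] with y hy hym
  rw [hy (uIcc_subset_Icc (hA r hr) (hB r hr) (uIoc_subset_uIcc hym)) _
    ⟨by linarith [hr.2], by linarith [hr.1]⟩]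

variable {P : ARZParams} {k : ℝ}

theorem U1_congr (hP : P.Valid) (hLD : (P.c1 + P.c4) * D < L)
    (h : ∀ᵐ y : ℝ, y ∈ Icc 0 L → ∀ s ∈ Icc 0 D, φ y s = φ' y s) {x : ℝ} (hx0 : 0 ≤ x)
    (hx1 : x ≤ P.c1 * D) : U1 P D k φ x = U1 P D k φ' x := by
  have h1 := hP.c1_pos; have h4 := hP.c4_pos
  set r₀ := x / P.c1 with hr₀
  have hr0x : P.c1 * r₀ = x := by rw [hr₀]; field_simp
  have hr0 : 0 ≤ r₀ := div_nonneg hx0 h1.le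
  have hrD : r₀ ≤ D := by rw [hr₀, div_le_iff₀ h1]; linarith
  have hD : 0 ≤ D := hr0.trans hrD
  have h4D : 0 ≤ P.c4 * D := mul_nonneg h4.le hD
  have i1 := integral_line_congr h (q := -P.c1) x (neg_ne_zero.2 h1.ne') le_rfl hr0 hrD
    (fun r hr => ⟨by nlinarith [hr.2], by nlinarith [hr.1]⟩)
    (fun r => P.c1 * P.c2 * Real.exp (-(P.c1 * P.c2 * r)))
  have i2 := integral_line_congr h (q := P.c4) (-(P.c4 * r₀)) h4.ne' hr0 hrD le_rfl
    (fun r hr => ⟨by nlinarith [hr.1], by nlinarith [hr.2]⟩)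
    (fun r => P.c5 * P.c7 * Real.exp (-(P.c2 * x)))
  have i3 := integral_line_congr h (q := P.c4) x h4.ne' le_rfl hD le_rfl
    (fun r hr => ⟨by nlinarith [hr.1], by nlinarith [hr.2]⟩) (fun _ => k)
  have i4 := integral_region_congr h le_rfl hD le_rfl
    (A := fun r => max (x - P.c1 * r) (P.c4 * (r - r₀))) (B := fun r => x + P.c4 * r)
    (fun r hr => ⟨by
        rcases le_total r r₀ with hle | hle
        · exact le_max_of_le_left (by nlinarith)
        · exact le_max_of_le_right (mul_nonneg h4.le (sub_nonneg.2 hle)),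
      max_le (by nlinarith [hr.1]) (by nlinarith [hr.2])⟩)
    (fun r hr => ⟨by nlinarith [hr.1], by nlinarith [hr.2]⟩) (fun r y => kerG P k x y r)
  have e1 : ∀ r, x + -P.c1 * r = x - P.c1 * r := fun r => by ring
  have e2 : ∀ r, -(P.c4 * r₀) + P.c4 * r = P.c4 * (r - r₀) := fun r => by ring
  simp only [e1] at i1
  simp only [e2] at i2
  unfold U1
  rw [← hr₀, i1, i2, i3, i4]

theorem U2_congr (hP : P.Valid) (hD : 0 ≤ D)
    (h : ∀ᵐ y : ℝ, y ∈ Icc 0 L → ∀ s ∈ Icc 0 D, φ y s = φ' y s) {x : ℝ} (hx0 : P.c1 * D ≤ x)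
    (hx1 : x ≤ L - P.c4 * D) : U2 P D k φ x = U2 P D k φ' x := by
  have h1 := hP.c1_pos; have h4 := hP.c4_pos
  have hr : ∀ r ∈ Icc 0 D, x - P.c1 * r ∈ Icc 0 L ∧ x + P.c4 * r ∈ Icc 0 L := fun r hr =>
    ⟨⟨by nlinarith [hr.2], by nlinarith [hr.1]⟩, by nlinarith [hr.1], by nlinarith [hr.2]⟩
  have e1 : ∀ r, x + -P.c1 * r = x - P.c1 * r := fun r => by ring
  have i1 := integral_line_congr h (q := -P.c1) x (neg_ne_zero.2 h1.ne') le_rfl hD le_rfl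
    (fun r hr' => by rw [e1]; exact (hr r hr').1)
    (fun r => P.c1 * P.c2 * Real.exp (-(P.c1 * P.c2 * r)))
  have i3 := integral_line_congr h (q := P.c4) x h4.ne' le_rfl hD le_rfl
    (fun r hr' => (hr r hr').2) (fun _ => k)
  have i4 := integral_region_congr h le_rfl hD le_rfl
    (A := fun r => x - P.c1 * r) (B := fun r => x + P.c4 * r)
    (fun r hr' => (hr r hr').1) (fun r hr' => (hr r hr').2) (fun r y => kerG P k x y r)
  simp only [e1] at i1
  unfold U2
  rw [i1, i3, i4]

/-- This branch integrates along the single position x = L, which almost everywhere agreement does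
not see; hence the separate hypothesis at the outlet. -/
theorem U3_congr (hP : P.Valid) (hD : 0 ≤ D) (hLD : (P.c1 + P.c4) * D < L)
    (h : ∀ᵐ y : ℝ, y ∈ Icc 0 L → ∀ s ∈ Icc 0 D, φ y s = φ' y s)
    (hL : ∀ s ∈ Icc 0 D, φ L s = φ' L s) {x : ℝ}
    (hx0 : L - P.c4 * D ≤ x) (hx1 : x ≤ L) : U3 P L D k φ x = U3 P L D k φ' x := by
  have h1 := hP.c1_pos; have h4 := hP.c4_pos
  set r₁ := (L - x) / P.c4 with hr₁
  have hr1x : P.c4 * r₁ = L - x := by rw [hr₁]; field_simp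
  have hr0 : 0 ≤ r₁ := div_nonneg (by linarith) h4.le
  have hrD : r₁ ≤ D := by rw [hr₁, div_le_iff₀ h4]; linarith
  have h1D : 0 ≤ P.c1 * D := mul_nonneg h1.le hD
  have h4D : 0 ≤ P.c4 * D := mul_nonneg h4.le hD
  have c1r : P.c1 * r₁ ≤ P.c1 * D := by nlinarith
  have c1r' : 0 ≤ P.c1 * r₁ := mul_nonneg h1.le hr0
  have hbrk : ∀ r, brk P L x r = L + P.c1 * r₁ - P.c1 * r := fun r => by
    unfold brk; rw [hr₁]; field_simp; ring
  have hr : ∀ r ∈ Icc 0 D, x - P.c1 * r ∈ Icc 0 L := fun r hr =>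
    ⟨by nlinarith [hr.2], by nlinarith [hr.1]⟩
  have e1 : ∀ r, x + -P.c1 * r = x - P.c1 * r := fun r => by ring
  have i1 := integral_line_congr h (q := -P.c1) x (neg_ne_zero.2 h1.ne') le_rfl hD le_rfl
    (fun r hr' => by rw [e1]; exact hr r hr')
    (fun r => P.c1 * P.c2 * Real.exp (-(P.c1 * P.c2 * r)))
  have i2 := integral_line_congr h (q := P.c4) x h4.ne' le_rfl hr0 hrD
    (fun r hr' => ⟨by nlinarith [hr'.1], by nlinarith [hr'.2]⟩) (fun _ => k)
  have i3 : ∫ r in r₁..D, k * φ L (D - r) = ∫ r in r₁..D, k * φ' L (D - r) :=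
    intervalIntegral.integral_congr fun r hr' => by
      rw [uIcc_of_le hrD] at hr'
      simp only [hL (D - r) ⟨by linarith [hr'.2], by linarith [hr'.1]⟩]
  have i4 := integral_region_congr h le_rfl hD le_rfl
    (A := fun r => x - P.c1 * r) (B := fun r => min (x + P.c4 * r) (brk P L x r))
    (fun r hr' => hr r hr') (fun r hr' => ⟨le_min (by nlinarith [hr'.1])
      (by rw [hbrk]; nlinarith [hr'.2]), by
        rw [hbrk]
        rcases le_total r r₁ with hle | hle
        · exact min_le_of_left_le (by nlinarith)
        · exact min_le_of_right_le (by nlinarith)⟩) (fun r y => kerG P k x y r)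
  have i5 := integral_region_congr h hr0 hrD le_rfl
    (A := fun r => brk P L x r) (B := fun _ => L)
    (fun r hr' => by rw [hbrk]; exact ⟨by nlinarith [hr'.2], by nlinarith [hr'.1]⟩)
    (fun r hr' => ⟨by linarith, le_rfl⟩)
    (fun r y => k * P.c2 * Real.exp (-(P.c2 * (L - y))))
  simp only [e1] at i1
  unfold U3
  rw [← hr₁, i1, i2, i3, i4, i5]

theorem control_congr (hP : P.Valid) (hD : 0 ≤ D) (hLD : (P.c1 + P.c4) * D < L)
    (h : ∀ᵐ y : ℝ, y ∈ Icc 0 L → ∀ s ∈ Icc 0 D, φ y s = φ' y s)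
    (hL : ∀ s ∈ Icc 0 D, φ L s = φ' L s) (z v : ℝ → ℝ) {x : ℝ} (hx : x ∈ Icc 0 L) :
    control P L D k z v φ x = control P L D k z v φ' x := by
  unfold control
  split_ifs with ha hb
  · rw [U1_congr hP hLD h hx.1 ha]
  · rw [U2_congr hP hD h (not_le.1 ha).le hb]
  · rw [U3_congr hP hD hLD h hL (not_le.1 hb).le hx.2]

end Congr

variable {P : ARZParams} {L D k : ℝ}

/-- The feedback law, evaluated along a solution of the plant, is the delay-free feedback law
evaluated at the state one delay ahead. -/
theorem MildPlant.ae_control {z v f : ℝ → ℝ → ℝ} (h : MildPlant P L z v f) (hP : P.Valid)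
    (hD : 0 ≤ D) (hLD : (P.c1 + P.c4) * D < L) {x : ℝ} (hx : x ∈ Icc 0 L) :
    ∀ᵐ t : ℝ, 0 ≤ t →
      P.c6 * control P L D k (fun y => z y t) (fun y => v y t) (fun y s => f y (t + s)) x
        = k * v x (t + D) - P.c5 * Real.exp (-(P.c2 * x)) * z x (t + D) := by
  have h1 := hP.c1_pos; have h4 := hP.c4_pos
  -- For fixed x the labels of the three characteristics involved are affine in t with nonzero
  -- slope, so all three are good for almost every t.
  have g1 := ae_comp_affine h.ae_zGood (neg_ne_zero.2 h1.ne') (x - P.c1 * D)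
  have g2 := ae_comp_affine h.ae_vGood h4.ne' (x + P.c4 * D)
  have g3 := ae_comp_affine h.ae_vGood h4.ne' (-(P.c4 * (x / P.c1)) + P.c4 * D)
  filter_upwards [g1, g2, g3] with t a1 a2 a3 ht
  rw [show x - P.c1 * D + -P.c1 * t = x - P.c1 * (t + D) by ring] at a1
  rw [show x + P.c4 * D + P.c4 * t = x + P.c4 * (t + D) by ring] at a2
  rw [show -(P.c4 * (x / P.c1)) + P.c4 * D + P.c4 * t
    = -(P.c4 * (x / P.c1)) + P.c4 * (t + D) by ring] at a3
  unfold control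
  split_ifs with ha hb
  · exact h.control_inlet hP hLD.le ht hx.1 ha a1 a2 a3
  · exact h.control_middle hP hD ht (not_le.1 ha).le hb a1 a2
  · exact h.control_outlet hP hD ht (not_le.1 ha).le (not_le.1 hb).le hx.2 a1 a2

variable {z₀ v₀ : ℝ → ℝ} {ϑ₀ : ℝ → ℝ → ℝ} {z v : ℝ → ℝ → ℝ} {ψ : ℝ → ℝ → ℝ → ℝ}

/-- After one delay the actuation coincides with the delay-free feedback law. -/
theorem IsClosedLoopSolution.actuation_eq (h : IsClosedLoopSolution P L D k z₀ v₀ ϑ₀ z v ψ)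
    (hP : P.Valid) (hD : 0 ≤ D) (hL : 0 ≤ L) (hLD : (P.c1 + P.c4) * D < L) :
    AEAndOutlet L fun x => ∀ t, D ≤ t →
      P.c6 * ψ x 0 t = k * v x t - P.c5 * Real.exp (-(P.c2 * x)) * z x t := by
  have hm := h.mildPlant hP hL hD
  have htr := h.transport
  have htr' := (ae_restrict_iff' measurableSet_Icc).1 htr.1
  have main : ∀ x ∈ Icc 0 L, ContinuousOn (ψ x 0) (Ici 0) →
      (∀ s ∈ Icc 0 D, ∀ t, 0 ≤ t → ψ x s t = ψ x 0 (s + t)) →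
      (∀ t, 0 ≤ t → ψ x D t = control P L D k (fun y => z y t) (fun y => v y t)
        (fun y s => ψ y s t) x) →
      ∀ t, D ≤ t → P.c6 * ψ x 0 t = k * v x t - P.c5 * Real.exp (-(P.c2 * x)) * z x t := by
    intro x hx hc ht hu t hDt
    -- Both sides are continuous in time, so equality for almost every t is equality for every t ≥
    -- 0.
    have hEq : EqOn (fun t => P.c6 * ψ x 0 (D + t))
        (fun t => k * v x (t + D) - P.c5 * Real.exp (-(P.c2 * x)) * z x (t + D)) (Ici 0) := by
      refine Measure.eqOn_of_ae_eq (μ := volume) ?_ ?_ ?_ ?_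
      · rw [Filter.EventuallyEq, ae_restrict_iff' measurableSet_Ici]
        filter_upwards [hm.ae_control (k := k) hP hD hLD hx] with τ hτ hτ0
        rw [← hτ hτ0, ← ht D ⟨hD, le_rfl⟩ τ hτ0, hu τ hτ0]
        congr 1
        refine control_congr hP hD hLD ?_ ?_ _ _ hx
        · filter_upwards [htr'] with y hy hyI s hs
          rw [hy hyI s hs τ hτ0, add_comm]
        · intro s hs
          rw [htr.2 s hs τ hτ0, add_comm]
      · exact continuousOn_const.mul (hc.comp (by fun_prop) fun τ hτ => add_nonneg hD hτ)
      · exact (continuousOn_const.mul (continuousOn_comp_path hm.v_cont continuousOn_const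
          (by fun_prop) (fun _ _ => hx) fun τ hτ => add_nonneg hτ hD)).sub
          (continuousOn_const.mul (continuousOn_comp_path hm.z_cont continuousOn_const
          (by fun_prop) (fun _ _ => hx) fun τ hτ => add_nonneg hτ hD))
      · rw [interior_Ici, closure_Ioi]
    have := hEq (show t - D ∈ Ici (0 : ℝ) from sub_nonneg.2 hDt)
    simpa using this
  have hc := h.actuation_continuousOn hD
  refine ⟨?_, main L ⟨hL, le_rfl⟩ hc.2 htr.2 h.actuator.2⟩
  rw [ae_restrict_iff' measurableSet_Icc]
  filter_upwards [(ae_restrict_iff' measurableSet_Icc).1 hc.1, htr',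
    (ae_restrict_iff' measurableSet_Icc).1 h.actuator.1] with x h1 h2 h3 hx
  exact main x hx (h1 hx) (h2 hx) (h3 hx)

end ARZ

namespace ARZ

/-! ### Square integrals along characteristics -/

/-- Cauchy–Schwarz, from the nonnegative integral of (g - mean)². If g itself is not integrable, its
integral is 0 by convention and the bound is trivial. -/
theorem sq_integral_le {a b : ℝ} (hab : a ≤ b) {g : ℝ → ℝ}
    (hg : IntervalIntegrable (fun x => g x ^ 2) volume a b) :
    (∫ x in a..b, g x) ^ 2 ≤ (b - a) * ∫ x in a..b, g x ^ 2 := by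
  have hnn : 0 ≤ ∫ x in a..b, g x ^ 2 :=
    intervalIntegral.integral_nonneg hab fun x _ => sq_nonneg _
  by_cases hgi : IntervalIntegrable g volume a b
  · rcases hab.eq_or_lt with rfl | hlt
    · simp
    have hpos : 0 < b - a := sub_pos.2 hlt
    set I := ∫ x in a..b, g x with hI
    set m := I / (b - a) with hm
    have h0 : 0 ≤ ∫ x in a..b, (g x - m) ^ 2 :=
      intervalIntegral.integral_nonneg hab fun x _ => sq_nonneg _
    have h1 : ∫ x in a..b, (g x - m) ^ 2 = (∫ x in a..b, g x ^ 2) - 2 * m * I + (b - a) * m ^ 2 := by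
      have e : ∀ x, (g x - m) ^ 2 = (g x ^ 2 - 2 * m * g x) + m ^ 2 := fun x => by ring
      simp only [e]
      rw [intervalIntegral.integral_add (hg.sub (hgi.const_mul _)) intervalIntegrable_const,
        intervalIntegral.integral_sub hg (hgi.const_mul _), intervalIntegral.integral_const_mul,
        intervalIntegral.integral_const, smul_eq_mul]
    have hmI : (b - a) * m = I := by rw [hm]; field_simp
    rw [h1] at h0
    have : (b - a) * ((∫ x in a..b, g x ^ 2) - 2 * m * I + (b - a) * m ^ 2)
        = (b - a) * (∫ x in a..b, g x ^ 2) - I ^ 2 := by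
      rw [← hmI]; ring
    nlinarith
  · rw [intervalIntegral.integral_undef hgi]
    nlinarith [mul_nonneg (sub_nonneg.2 hab) hnn]

theorem integrableOn_sq_of_memLp {A T : ℝ} {g : ℝ → ℝ → ℝ}
    (h : MemLp (Function.uncurry g) 2 (volume.restrict (Icc 0 A ×ˢ Icc 0 T))) :
    IntegrableOn (Function.uncurry fun x t => g x t ^ 2) (Icc 0 A ×ˢ Icc 0 T) := by
  exact h.integrable_sq

theorem integral_rect {A T : ℝ} (hA : 0 ≤ A) (hT : 0 ≤ T) {g : ℝ → ℝ → ℝ}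
    (h : IntegrableOn (Function.uncurry g) (Icc 0 A ×ˢ Icc 0 T)) :
    ∫ q in Icc 0 A ×ˢ Icc 0 T, g q.1 q.2 = ∫ x in (0 : ℝ)..A, ∫ t in (0 : ℝ)..T, g x t := by
  rw [Measure.volume_eq_prod] at h ⊢
  refine (setIntegral_prod _ h).trans ?_
  rw [intervalIntegral.integral_of_le hA, integral_Icc_eq_integral_Ioc]
  simp only [intervalIntegral.integral_of_le hT, integral_Icc_eq_integral_Ioc]
  rfl

theorem integral_rect_swap {A T : ℝ} (hA : 0 ≤ A) (hT : 0 ≤ T) {g : ℝ → ℝ → ℝ}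
    (h : IntegrableOn (Function.uncurry g) (Icc 0 A ×ˢ Icc 0 T)) :
    ∫ x in (0 : ℝ)..A, ∫ t in (0 : ℝ)..T, g x t = ∫ t in (0 : ℝ)..T, ∫ x in (0 : ℝ)..A, g x t := by
  refine integral_swap_region (α := fun _ => 0) (β := fun _ => T) (lo := fun _ => 0)
    (hi := fun _ => A) (by fun_prop) (by fun_prop) hA hT (fun _ _ => hT) (fun _ _ => hA)
    (fun x t => and_comm) (h.mono_set fun q hq =>
      ⟨Ioo_subset_Icc_self hq.1, Ioo_subset_Icc_self hq.2⟩)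

/-- The integral of `g²` over the part of the line `x - c t = l` inside `[0, A] × [0, T]`. -/
noncomputable def lineEnergy (A T c : ℝ) (g : ℝ → ℝ → ℝ) (l : ℝ) : ℝ :=
  ∫ τ, {q : ℝ × ℝ | q.1 + c * q.2 ∈ Icc 0 A ∧ q.2 ∈ Icc 0 T}.indicator
    (fun q => g (q.1 + c * q.2) q.2 ^ 2) (l, τ)

section LineEnergy

variable {A T : ℝ} (c : ℝ) {g : ℝ → ℝ → ℝ}
  (hg : MemLp (Function.uncurry g) 2 (volume.restrict (Icc 0 A ×ˢ Icc 0 T)))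
include hg

theorem integrable_lineEnergy_indicator :
    Integrable ({q : ℝ × ℝ | q.1 + c * q.2 ∈ Icc 0 A ∧ q.2 ∈ Icc 0 T}.indicator
      fun q => g (q.1 + c * q.2) q.2 ^ 2) := by
  have hm : MeasurableSet {q : ℝ × ℝ | q.1 + c * q.2 ∈ Icc 0 A ∧ q.2 ∈ Icc 0 T} :=
    (measurableSet_Icc.preimage (f := fun q : ℝ × ℝ => q.1 + c * q.2) (by fun_prop)).inter
      (measurableSet_Icc.preimage measurable_snd)
  rw [integrable_indicator_iff hm]
  exact integrableOn_shear (g := fun x t => g x t ^ 2) c (integrableOn_sq_of_memLp hg)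

theorem integrable_lineEnergy : Integrable (lineEnergy A T c g) :=
  Integrable.integral_prod_left (integrable_lineEnergy_indicator c hg)

theorem integral_lineEnergy (hA : 0 ≤ A) (hT : 0 ≤ T) :
    ∫ l, lineEnergy A T c g l = ∫ x in (0 : ℝ)..A, ∫ t in (0 : ℝ)..T, g x t ^ 2 := by
  have hi := integrable_lineEnergy_indicator c hg
  rw [← integral_rect hA hT (g := fun x t => g x t ^ 2) (integrableOn_sq_of_memLp hg)]
  have h1 := integral_prod _ hi
  rw [show (∫ l, lineEnergy A T c g l) = _ from h1.symm]
  have hr : MeasurableSet (Icc (0 : ℝ) A ×ˢ Icc (0 : ℝ) T) :=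
    measurableSet_Icc.prod measurableSet_Icc
  have h2 := integral_shear c ((integrable_indicator_iff hr).2 (integrableOn_sq_of_memLp hg))
  rw [integral_indicator hr] at h2
  exact h2

omit hg in
theorem lineEnergy_nonneg (l : ℝ) : 0 ≤ lineEnergy A T c g l :=
  integral_nonneg fun _ => indicator_nonneg (fun _ _ => sq_nonneg _) _

/-- The squared contribution of a source is bounded by a function of the label alone, whose integral
over all labels is T times the squared L² norm of the source. -/
theorem ae_sq_integral_le_lineEnergy :
    ∀ᵐ l : ℝ, ∀ t₁ t₂ : ℝ, 0 ≤ t₁ → t₁ ≤ t₂ → t₂ ≤ T → l + c * t₁ ∈ Icc 0 A →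
      l + c * t₂ ∈ Icc 0 A →
      (∫ τ in t₁..t₂, g (l + c * τ) τ) ^ 2 ≤ T * lineEnergy A T c g l := by
  filter_upwards [Integrable.prod_right_ae (integrable_lineEnergy_indicator c hg)]
    with l hl t₁ t₂ h0 h12 hT h1 h2
  have hsub : ∀ τ ∈ Icc t₁ t₂, (l, τ) ∈ {q : ℝ × ℝ | q.1 + c * q.2 ∈ Icc 0 A ∧ q.2 ∈ Icc 0 T} :=
    fun τ hτ => ⟨mem_Icc_line h1 h2 hτ, h0.trans hτ.1, hτ.2.trans hT⟩
  have hi : IntegrableOn (fun τ => g (l + c * τ) τ ^ 2) (Icc t₁ t₂) := by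
    refine (hl.integrableOn (s := Icc t₁ t₂)).congr_fun (fun τ hτ => ?_) measurableSet_Icc
    exact indicator_of_mem (hsub τ hτ) _
  have hle : ∫ τ in t₁..t₂, g (l + c * τ) τ ^ 2 ≤ lineEnergy A T c g l := by
    rw [intervalIntegral.integral_of_le h12, ← integral_Icc_eq_integral_Ioc,
      ← integral_indicator measurableSet_Icc]
    refine integral_mono ((integrable_indicator_iff measurableSet_Icc).2 hi) hl fun τ => ?_
    by_cases hτ : τ ∈ Icc t₁ t₂
    · simp only [indicator_of_mem hτ, indicator_of_mem (hsub τ hτ), le_refl]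
    · rw [indicator_of_notMem hτ]
      exact indicator_nonneg (fun _ _ => sq_nonneg _) _
  have hnn : 0 ≤ ∫ τ in t₁..t₂, g (l + c * τ) τ ^ 2 :=
    intervalIntegral.integral_nonneg h12 fun _ _ => sq_nonneg _
  calc _ ≤ (t₂ - t₁) * ∫ τ in t₁..t₂, g (l + c * τ) τ ^ 2 :=
        sq_integral_le h12 ((intervalIntegrable_iff_integrableOn_Icc_of_le h12).2 hi)
    _ ≤ T * lineEnergy A T c g l :=
        mul_le_mul (by linarith) hle hnn (h0.trans (h12.trans hT))

end LineEnergy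

/-- An integral over an interval is bounded by the integral over the line of a majorant, after an
affine reparametrization. -/
theorem integral_le_of_affine_bound {a b q : ℝ} (p : ℝ) (hab : a ≤ b) (hq : q ≠ 0) {g B : ℝ → ℝ}
    (hB : Integrable B) (hB0 : ∀ l, 0 ≤ B l) (hg0 : ∀ x ∈ Icc a b, 0 ≤ g x)
    (hg : ∀ᵐ x : ℝ, x ∈ Icc a b → g x ≤ B (p + q * x)) :
    ∫ x in a..b, g x ≤ |q|⁻¹ * ∫ l, B l := by
  have hBi : Integrable fun x => B (p + q * x) :=
    Integrable.comp_mul_left' (g := fun y => B (p + y)) (hB.comp_add_left p) hq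
  have hBe : ∫ x, B (p + q * x) = |q|⁻¹ * ∫ l, B l := by
    rw [Measure.integral_comp_mul_left (fun y => B (p + y)), integral_add_left_eq_self, abs_inv,
      smul_eq_mul]
  rw [intervalIntegral.integral_of_le hab, ← hBe]
  calc ∫ x in Ioc a b, g x ≤ ∫ x in Ioc a b, B (p + q * x) := by
        refine integral_mono_of_nonneg ?_ hBi.integrableOn ?_
        · rw [Filter.EventuallyLE, ae_restrict_iff' measurableSet_Ioc]
          exact Filter.Eventually.of_forall fun x hx => hg0 x (Ioc_subset_Icc_self hx)
        · rw [Filter.EventuallyLE, ae_restrict_iff' measurableSet_Ioc]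
          filter_upwards [hg] with x hx hxm using hx (Ioc_subset_Icc_self hxm)
    _ ≤ ∫ x, B (p + q * x) :=
        setIntegral_le_integral hBi (Filter.Eventually.of_forall fun x => hB0 _)

end ARZ

/-! ### The inlet trace of v during the first delay interval. -/

namespace ARZ

theorem integral_indicator_Icc {a b : ℝ} (hab : a ≤ b) (g : ℝ → ℝ) :
    ∫ x, (Icc a b).indicator g x = ∫ x in a..b, g x := by
  rw [integral_indicator measurableSet_Icc, integral_Icc_eq_integral_Ioc,
    intervalIntegral.integral_of_le hab]

theorem integrable_indicator_Icc {a b : ℝ} {g : ℝ → ℝ} (hg : ContinuousOn g (Icc a b)) :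
    Integrable ((Icc a b).indicator g) :=
  (integrable_indicator_iff measurableSet_Icc).2 hg.integrableOn_Icc

theorem integral_sum_three (K : ℝ) {b₁ b₂ b₃ : ℝ → ℝ} (h₁ : Integrable b₁) (h₂ : Integrable b₂)
    (h₃ : Integrable b₃) : Integrable (fun l => K * (b₁ l + b₂ l + b₃ l)) ∧
      ∫ l, K * (b₁ l + b₂ l + b₃ l) = K * ((∫ l, b₁ l) + (∫ l, b₂ l) + ∫ l, b₃ l) := by
  refine ⟨((h₁.add h₂).add h₃).const_mul K, ?_⟩
  have h := integral_add (h₁.add h₂) h₃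
  simp only [Pi.add_apply] at h
  rw [integral_const_mul, h, integral_add h₁ h₂]

theorem integral_rect_le {A T K : ℝ} (hA : 0 ≤ A) (hT : 0 ≤ T) {g f : ℝ → ℝ → ℝ}
    (hg : IntegrableOn (Function.uncurry g) (Icc 0 A ×ˢ Icc 0 T))
    (hf : IntegrableOn (Function.uncurry f) (Icc 0 A ×ˢ Icc 0 T))
    (hle : ∀ x ∈ Icc 0 A, ∀ t ∈ Icc 0 T, g x t ≤ K * f x t) :
    ∫ x in (0 : ℝ)..A, ∫ t in (0 : ℝ)..T, g x t
      ≤ K * ∫ x in (0 : ℝ)..A, ∫ t in (0 : ℝ)..T, f x t := by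
  rw [← integral_rect hA hT hg, ← integral_rect hA hT hf, ← integral_const_mul]
  exact setIntegral_mono_on hg (hf.const_mul K) (measurableSet_Icc.prod measurableSet_Icc)
    fun q hq => hle _ hq.1 _ hq.2

variable {P : ARZParams} {L D : ℝ}

section EnergyParts

variable (hL : 0 ≤ L) (hD : 0 ≤ D) (z v : ℝ → ℝ) (φ : ℝ → ℝ → ℝ)
include hL hD

theorem energy_parts_nonneg :
    0 ≤ (∫ x in (0 : ℝ)..L, z x ^ 2) ∧ 0 ≤ (∫ x in (0 : ℝ)..L, v x ^ 2) ∧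
      0 ≤ (∫ x in (0 : ℝ)..L, ∫ s in (0 : ℝ)..D, φ x s ^ 2) ∧
      0 ≤ ∫ s in (0 : ℝ)..D, φ L s ^ 2 :=
  ⟨intervalIntegral.integral_nonneg hL fun _ _ => sq_nonneg _,
    intervalIntegral.integral_nonneg hL fun _ _ => sq_nonneg _,
    intervalIntegral.integral_nonneg hL fun _ _ =>
      intervalIntegral.integral_nonneg hD fun _ _ => sq_nonneg _,
    intervalIntegral.integral_nonneg hD fun _ _ => sq_nonneg _⟩

theorem energy_parts_le :
    (∫ x in (0 : ℝ)..L, z x ^ 2) ≤ energy L D z v φ ∧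
      (∫ x in (0 : ℝ)..L, v x ^ 2) ≤ energy L D z v φ ∧ v L ^ 2 ≤ energy L D z v φ ∧
      (∫ x in (0 : ℝ)..L, ∫ s in (0 : ℝ)..D, φ x s ^ 2) ≤ energy L D z v φ ∧
      (∫ s in (0 : ℝ)..D, φ L s ^ 2) ≤ energy L D z v φ ∧ 0 ≤ energy L D z v φ := by
  obtain ⟨h1, h2, h3, h4⟩ := energy_parts_nonneg hL hD z v φ
  have h5 := sq_nonneg (v L)
  unfold energy
  refine ⟨?_, ?_, ?_, ?_, ?_, ?_⟩ <;> linarith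

end EnergyParts

theorem add_three_sq_le (a b c : ℝ) : (a - b - c) ^ 2 ≤ 3 * (a ^ 2 + b ^ 2 + c ^ 2) := by
  nlinarith [sq_nonneg (a + b), sq_nonneg (a + c), sq_nonneg (b - c)]

theorem add_sq_le_two (a b : ℝ) : (a + b) ^ 2 ≤ 2 * (a ^ 2 + b ^ 2) := by
  nlinarith [sq_nonneg (a - b)]

/-- The trace of `v` at the inlet during the first delay interval. -/
theorem exists_inlet_bound (hP : P.Valid) (hD : 0 ≤ D) (hLD : (P.c1 + P.c4) * D ≤ L) :
    ∃ C, 0 ≤ C ∧ ∀ z v f : ℝ → ℝ → ℝ, MildPlant P L z v f →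
      ∫ t in (0 : ℝ)..D, v 0 t ^ 2 ≤ C * energy L D (fun x => z x 0) (fun x => v x 0) f := by
  have h1 := hP.c1_pos; have h4 := hP.c4_pos; have h6 := hP.c6_pos
  have h1D : 0 ≤ P.c1 * D := mul_nonneg h1.le hD
  have h4D : 0 ≤ P.c4 * D := mul_nonneg h4.le hD
  have hL4 : P.c4 * D ≤ L := by linarith
  have hL : 0 ≤ L := by linarith
  have hs : 0 < P.c1 + P.c4 := add_pos h1 h4
  -- a E bounds the square of the integral of c₅ e^{-c₂y} z along a v-characteristic reaching the
  -- inlet: (c₁+c₄)² is from the conservation law, L from Cauchy–Schwarz, the rest from the squared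
  -- density.
  set a : ℝ := L * (2 * (P.c5 ^ 2 + (P.c1 * P.c2) ^ 2)) / (P.c1 + P.c4) ^ 2 with ha
  have ha0 : 0 ≤ a := by positivity
  refine ⟨P.c4⁻¹ * (3 * (1 + a * (P.c4 * D) + P.c6 ^ 2 * D)), by positivity, ?_⟩
  intro z v f h
  obtain ⟨Ez, Ev, -, Ef, -, E0⟩ := energy_parts_le hL hD (fun x => z x 0) (fun x => v x 0) f
  set E := energy L D (fun x => z x 0) (fun x => v x 0) f with hE
  have hcx : ∀ {g : ℝ → ℝ → ℝ}, ContinuousOn (Function.uncurry g) (Icc 0 L ×ˢ Ici 0) →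
      ContinuousOn (fun y => g y 0) (Icc 0 L) := fun hg =>
    continuousOn_comp_path hg continuousOn_id continuousOn_const (fun y hy => hy) fun _ _ => le_rfl
  have hzc := hcx h.z_cont
  have hvc := hcx h.v_cont
  set w : ℝ → ℝ := fun y => P.c5 * Real.exp (-(P.c2 * y)) * z y 0 - P.c1 * P.c2 * v y 0 with hw
  have hwc : ContinuousOn w (Icc 0 L) :=
    (ContinuousOn.mul (by fun_prop) hzc).sub (continuousOn_const.mul hvc)
  have hwsq : ∫ y in (0 : ℝ)..L, w y ^ 2 ≤ 2 * (P.c5 ^ 2 + (P.c1 * P.c2) ^ 2) * E := by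
    have hi1 : IntervalIntegrable (fun y => z y 0 ^ 2) volume 0 L :=
      ContinuousOn.intervalIntegrable (by rw [uIcc_of_le hL]; exact hzc.pow 2)
    have hi2 : IntervalIntegrable (fun y => v y 0 ^ 2) volume 0 L :=
      ContinuousOn.intervalIntegrable (by rw [uIcc_of_le hL]; exact hvc.pow 2)
    have hi3 : IntervalIntegrable (fun y => w y ^ 2) volume 0 L :=
      ContinuousOn.intervalIntegrable (by rw [uIcc_of_le hL]; exact hwc.pow 2)
    calc ∫ y in (0 : ℝ)..L, w y ^ 2
        ≤ ∫ y in (0 : ℝ)..L, (2 * P.c5 ^ 2 * z y 0 ^ 2 + 2 * (P.c1 * P.c2) ^ 2 * v y 0 ^ 2) := by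
          refine intervalIntegral.integral_mono_on hL hi3
            ((hi1.const_mul _).add (hi2.const_mul _)) fun y hy => ?_
          have he : Real.exp (-(P.c2 * y)) ≤ 1 :=
            Real.exp_le_one_iff.2 (by nlinarith [hP.c2_pos, hy.1])
          have he0 := Real.exp_pos (-(P.c2 * y))
          have he2 : Real.exp (-(P.c2 * y)) ^ 2 ≤ 1 := by nlinarith
          have := add_sq_le_two (P.c5 * Real.exp (-(P.c2 * y)) * z y 0) (-(P.c1 * P.c2 * v y 0))
          have h3 : (P.c5 * Real.exp (-(P.c2 * y)) * z y 0) ^ 2 ≤ P.c5 ^ 2 * z y 0 ^ 2 := by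
            have : 0 ≤ P.c5 ^ 2 * z y 0 ^ 2 := by positivity
            nlinarith
          simp only [hw]
          nlinarith
      _ = 2 * P.c5 ^ 2 * (∫ y in (0 : ℝ)..L, z y 0 ^ 2)
          + 2 * (P.c1 * P.c2) ^ 2 * ∫ y in (0 : ℝ)..L, v y 0 ^ 2 := by
          rw [intervalIntegral.integral_add (hi1.const_mul _) (hi2.const_mul _),
            intervalIntegral.integral_const_mul, intervalIntegral.integral_const_mul]
      _ ≤ 2 * P.c5 ^ 2 * E + 2 * (P.c1 * P.c2) ^ 2 * E := by gcongr
      _ = _ := by ring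
  -- The three terms bound, as functions of the label l = c₄t, the initial value, the integral of z
  -- and the integral of f in the formula for v(0,t).
  set B : ℝ → ℝ := fun l => 3 * ((Icc 0 L).indicator (fun y => v y 0 ^ 2) l
    + (Icc 0 (P.c4 * D)).indicator (fun _ => a * E) l + P.c6 ^ 2 * D * lineEnergy L D (-P.c4) f l)
    with hB
  have b1 : Integrable ((Icc 0 L).indicator fun y => v y 0 ^ 2) :=
    integrable_indicator_Icc (hvc.pow 2)
  have b2 : Integrable ((Icc 0 (P.c4 * D)).indicator fun _ => a * E) :=
    integrable_indicator_Icc continuousOn_const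
  have b3 := (integrable_lineEnergy (-P.c4) (h.f_memLp D)).const_mul (P.c6 ^ 2 * D)
  obtain ⟨hBi, hBI⟩ := integral_sum_three 3 b1 b2 b3
  have hB0 : ∀ l, 0 ≤ B l := fun l => by
    have n1 : 0 ≤ (Icc 0 L).indicator (fun y => v y 0 ^ 2) l :=
      indicator_nonneg (fun _ _ => sq_nonneg _) _
    have n2 : 0 ≤ (Icc 0 (P.c4 * D)).indicator (fun _ => a * E) l :=
      indicator_nonneg (fun _ _ => mul_nonneg ha0 E0) _
    have n3 := lineEnergy_nonneg (A := L) (T := D) (-P.c4) (g := f) l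
    simp only [hB]; positivity
  have e3 : ∫ l, P.c6 ^ 2 * D * lineEnergy L D (-P.c4) f l = _ := integral_const_mul _ _
  rw [e3, integral_lineEnergy (-P.c4) (h.f_memLp D) hL hD, integral_indicator_Icc hL, integral_indicator_Icc h4D, intervalIntegral.integral_const,
    smul_eq_mul, sub_zero] at hBI
  have key : ∫ t in (0 : ℝ)..D, v 0 t ^ 2 ≤ |P.c4|⁻¹ * ∫ l, B l := by
    refine integral_le_of_affine_bound 0 hD h4.ne' hBi hB0 (fun _ _ => sq_nonneg _) ?_
    filter_upwards [ae_comp_affine h.ae_vGood h4.ne' 0,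
      ae_comp_affine (ae_sq_integral_le_lineEnergy (-P.c4) (h.f_memLp D)) h4.ne' 0]
      with t hgood hle ht
    have hct0 : 0 ≤ P.c4 * t := mul_nonneg h4.le ht.1
    have hctD : P.c4 * t ≤ P.c4 * D := by nlinarith [ht.2]
    obtain ⟨-, hV⟩ := VGood.backward (m := 0) (T := t) (ρ := 0) (R := t) h6.ne' h.z_cont hgood ht.1
      le_rfl (by simpa using hL) ⟨by linarith, by linarith⟩
    -- Near the inlet z depends on the very trace that is being estimated. The conservation law
    -- avoids this circularity: it gives the integral of z from the initial profiles alone.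
    have hC := h.conservation 0 t le_rfl ht.1 (by rw [sub_zero]; linarith)
    have hF := hle 0 t le_rfl ht.1 ht.2 ⟨by linarith, by linarith⟩ ⟨by linarith, by linarith⟩
    have eF : ∫ τ in (0 : ℝ)..t, f (0 + P.c4 * t + -P.c4 * τ) τ
        = ∫ r in (0 : ℝ)..t, f (0 + P.c4 * r) (t - r) := by
      have := intervalIntegral.integral_comp_sub_left (a := 0) (b := t)
        (fun τ => f (0 + P.c4 * t + -P.c4 * τ) τ) t
      rw [sub_self, sub_zero] at this
      rw [← this]
      congr 1; ext r; congr 1; ring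
    have eZ : ∫ τ in (0 : ℝ)..t, P.c5 * Real.exp (-(P.c2 * (P.c4 * (t - τ)))) *
        z (P.c4 * (t - τ)) τ = ∫ r in (0 : ℝ)..t, P.c5 * Real.exp (-(P.c2 * (0 + P.c4 * r))) *
        z (0 + P.c4 * r) (t - r) := by
      have := intervalIntegral.integral_comp_sub_left (a := 0) (b := t)
        (fun τ => P.c5 * Real.exp (-(P.c2 * (P.c4 * (t - τ)))) * z (P.c4 * (t - τ)) τ) t
      rw [sub_self, sub_zero] at this
      rw [← this]
      congr 1; ext r; rw [sub_sub_cancel, zero_add]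
    rw [eF] at hF
    rw [sub_zero, eZ] at hC
    set IZ := ∫ r in (0 : ℝ)..t, P.c5 * Real.exp (-(P.c2 * (0 + P.c4 * r))) *
      z (0 + P.c4 * r) (t - r)
    set IF := ∫ r in (0 : ℝ)..t, f (0 + P.c4 * r) (t - r)
    rw [mul_zero, add_zero, sub_zero, sub_self, zero_add] at hV
    have hX : IZ ^ 2 ≤ a * E := by
      have hwi : IntervalIntegrable (fun y => w y ^ 2) volume 0 L :=
        ContinuousOn.intervalIntegrable (by rw [uIcc_of_le hL]; exact hwc.pow 2)
      have hm : P.c4 * t ∈ uIcc 0 L := by rw [uIcc_of_le hL]; exact ⟨hct0, by linarith⟩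
      have q1 := sq_integral_le hct0 (hwi.mono_set (uIcc_subset_uIcc_left hm))
      have q2 : ∫ y in (0 : ℝ)..(P.c4 * t), w y ^ 2 ≤ ∫ y in (0 : ℝ)..L, w y ^ 2 :=
        intervalIntegral.integral_mono_interval le_rfl hct0 (by linarith)
          (Filter.Eventually.of_forall fun _ => sq_nonneg _) hwi
      have q3 : 0 ≤ ∫ y in (0 : ℝ)..L, w y ^ 2 :=
        intervalIntegral.integral_nonneg hL fun _ _ => sq_nonneg _
      have q4 : ((P.c1 + P.c4) * IZ) ^ 2 ≤ L * (2 * (P.c5 ^ 2 + (P.c1 * P.c2) ^ 2) * E) := by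
        rw [← hC]
        calc _ ≤ (P.c4 * t - 0) * ∫ y in (0 : ℝ)..(P.c4 * t), w y ^ 2 := q1
          _ ≤ L * ∫ y in (0 : ℝ)..L, w y ^ 2 :=
            mul_le_mul (by linarith) q2 (intervalIntegral.integral_nonneg hct0
              fun _ _ => sq_nonneg _) hL
          _ ≤ _ := by gcongr
      rw [ha, div_mul_eq_mul_div, le_div_iff₀ (by positivity)]
      nlinarith
    have hm1 : (0 : ℝ) + P.c4 * t ∈ Icc 0 L := ⟨by linarith, by linarith⟩
    have hm2 : (0 : ℝ) + P.c4 * t ∈ Icc 0 (P.c4 * D) := ⟨by linarith, by linarith⟩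
    simp only [hB]
    rw [indicator_of_mem hm1, indicator_of_mem hm2, hV]
    refine (add_three_sq_le _ _ _).trans ?_
    rw [mul_pow, zero_add]
    rw [zero_add] at hF
    have := mul_le_mul_of_nonneg_left hF (sq_nonneg P.c6)
    rw [← mul_assoc] at this
    linarith
  refine key.trans ?_
  rw [abs_of_pos h4, hBI, mul_assoc P.c4⁻¹]
  refine mul_le_mul_of_nonneg_left ?_ (by positivity)
  have t1 : P.c6 ^ 2 * D * (∫ x in (0 : ℝ)..L, ∫ t in (0 : ℝ)..D, f x t ^ 2) ≤ P.c6 ^ 2 * D * E := by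
    gcongr
  nlinarith

end ARZ

/-! ### Bounds for the state during the first delay interval. -/

namespace ARZ

variable {P : ARZParams} {L D : ℝ}

theorem memLp_rect_mul {A T : ℝ} {w g : ℝ → ℝ → ℝ} (hw : Continuous (Function.uncurry w))
    (hg : MemLp (Function.uncurry g) 2 (volume.restrict (Icc 0 A ×ˢ Icc 0 T))) :
    MemLp (Function.uncurry fun x t => w x t * g x t) 2
      (volume.restrict (Icc 0 A ×ˢ Icc 0 T)) := by
  obtain ⟨C, hC⟩ := (isCompact_rect A T).exists_bound_of_continuousOn hw.continuousOn
  refine MemLp.of_le_mul (c := C) hg (hw.aestronglyMeasurable.mul hg.aestronglyMeasurable) ?_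
  rw [ae_restrict_iff' (measurableSet_Icc.prod measurableSet_Icc)]
  refine Filter.Eventually.of_forall fun q hq => ?_
  have := hC q hq
  simp only [Function.uncurry_def, norm_mul] at this ⊢
  gcongr

/-- A majorant of `z²` along the characteristics during the first delay interval. -/
theorem exists_z_majorant (hP : P.Valid) (hD : 0 ≤ D) (hLD : (P.c1 + P.c4) * D ≤ L) :
    ∃ C, 0 ≤ C ∧ ∀ z v f : ℝ → ℝ → ℝ, MildPlant P L z v f →
      ∃ B : ℝ → ℝ, Integrable B ∧ (∀ l, 0 ≤ B l) ∧
        ∫ l, B l ≤ C * energy L D (fun x => z x 0) (fun x => v x 0) f ∧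
        ∀ᵐ l : ℝ, ∀ t ∈ Icc 0 D, l + P.c1 * t ∈ Icc 0 L → z (l + P.c1 * t) t ^ 2 ≤ B l := by
  have h1 := hP.c1_pos; have h4 := hP.c4_pos
  have h1D : 0 ≤ P.c1 * D := mul_nonneg h1.le hD
  have h4D : 0 ≤ P.c4 * D := mul_nonneg h4.le hD
  have hL : 0 ≤ L := by linarith
  obtain ⟨C₁, hC₁, hin⟩ := exists_inlet_bound hP hD hLD
  set K := (P.c3 * Real.exp (P.c2 * L)) ^ 2 with hK
  refine ⟨2 * (1 + P.c1 * (P.c7 ^ 2 * C₁) + D * K), by positivity, ?_⟩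
  intro z v f h
  have hv0 := hin z v f h
  obtain ⟨Ez, Ev, -, Ef, -, E0⟩ := energy_parts_le hL hD (fun x => z x 0) (fun x => v x 0) f
  set E := energy L D (fun x => z x 0) (fun x => v x 0) f with hE
  have hzc : ContinuousOn (fun y => z y 0) (Icc 0 L) :=
    continuousOn_comp_path h.z_cont continuousOn_id continuousOn_const (fun y hy => hy)
      fun _ _ => le_rfl
  set G : ℝ → ℝ → ℝ := fun x t => -(P.c3 * Real.exp (P.c2 * x) * f x t) with hG
  have hGm : MemLp (Function.uncurry G) 2 (volume.restrict (Icc 0 L ×ˢ Icc 0 D)) :=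
    (memLp_rect_mul (w := fun x _ => P.c3 * Real.exp (P.c2 * x))
      (by simp only [Function.uncurry_def]; fun_prop) (h.f_memLp D)).neg
  have b1 : Integrable ((Icc 0 L).indicator fun y => z y 0 ^ 2) :=
    integrable_indicator_Icc (hzc.pow 2)
  -- A label l < 0 belongs to a characteristic that enters at x = 0 at time -l/c₁.
  have hvc : ContinuousOn (fun l => (P.c7 * v 0 (-l / P.c1)) ^ 2) (Icc (-(P.c1 * D)) 0) :=
    (continuousOn_const.mul (continuousOn_comp_path h.v_cont continuousOn_const (by fun_prop)
      (fun _ _ => ⟨le_rfl, hL⟩) fun l hl => div_nonneg (by linarith [hl.2]) h1.le)).pow 2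
  have b2 := integrable_indicator_Icc hvc
  have b3 := (integrable_lineEnergy P.c1 hGm).const_mul D
  obtain ⟨hBi, hBI⟩ := integral_sum_three 2 b1 b2 b3
  have e2 : ∫ l in (-(P.c1 * D))..0, (P.c7 * v 0 (-l / P.c1)) ^ 2
      = P.c1 * (P.c7 ^ 2 * ∫ t in (0 : ℝ)..D, v 0 t ^ 2) := by
    rw [intervalIntegral.integral_comp_neg (fun l => (P.c7 * v 0 (l / P.c1)) ^ 2), neg_zero,
      neg_neg, intervalIntegral.integral_comp_div (fun t => (P.c7 * v 0 t) ^ 2) h1.ne',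
      zero_div, mul_div_cancel_left₀ _ h1.ne', smul_eq_mul]
    simp only [mul_pow, intervalIntegral.integral_const_mul]
  have e3 : ∫ l, D * lineEnergy L D P.c1 G l = _ := integral_const_mul _ _
  rw [e3, integral_lineEnergy P.c1 hGm hL hD, integral_indicator_Icc hL,
    integral_indicator_Icc (by linarith), e2] at hBI
  have hGf : ∫ x in (0 : ℝ)..L, ∫ t in (0 : ℝ)..D, G x t ^ 2
      ≤ K * ∫ x in (0 : ℝ)..L, ∫ t in (0 : ℝ)..D, f x t ^ 2 := by
    refine integral_rect_le hL hD (integrableOn_sq_of_memLp hGm)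
      (integrableOn_sq_of_memLp (h.f_memLp D)) fun x hx t _ => ?_
    have he : Real.exp (P.c2 * x) ≤ Real.exp (P.c2 * L) :=
      Real.exp_le_exp.2 (mul_le_mul_of_nonneg_left hx.2 hP.c2_pos.le)
    have he0 := Real.exp_pos (P.c2 * x)
    simp only [hG, hK, neg_sq, mul_pow]
    gcongr
  have nB : ∀ l, 0 ≤ (Icc 0 L).indicator (fun y => z y 0 ^ 2) l ∧
      0 ≤ (Icc (-(P.c1 * D)) 0).indicator (fun l => (P.c7 * v 0 (-l / P.c1)) ^ 2) l ∧
      0 ≤ D * lineEnergy L D P.c1 G l := fun l =>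
    ⟨indicator_nonneg (fun _ _ => sq_nonneg _) _, indicator_nonneg (fun _ _ => sq_nonneg _) _,
      mul_nonneg hD (lineEnergy_nonneg _ _)⟩
  refine ⟨_, hBi, fun l => ?_, ?_, ?_⟩
  · obtain ⟨n1, n2, n3⟩ := nB l
    linarith
  · rw [hBI]
    have t1 : P.c1 * (P.c7 ^ 2 * ∫ t in (0 : ℝ)..D, v 0 t ^ 2) ≤ P.c1 * (P.c7 ^ 2 * (C₁ * E)) := by
      gcongr
    have t2 : D * (∫ x in (0 : ℝ)..L, ∫ t in (0 : ℝ)..D, G x t ^ 2) ≤ D * (K * E) :=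
      mul_le_mul_of_nonneg_left (hGf.trans (mul_le_mul_of_nonneg_left Ef (sq_nonneg _))) hD
    linarith
  · filter_upwards [h.ae_zGood, ae_sq_integral_le_lineEnergy P.c1 hGm] with l hgood hle t ht hx
    obtain ⟨n1, n2, n3⟩ := nB l
    have hct : 0 ≤ P.c1 * t := mul_nonneg h1.le ht.1
    have hctD : P.c1 * t ≤ P.c1 * D := mul_le_mul_of_nonneg_left ht.2 h1.le
    rcases le_or_gt 0 l with hl | hl
    · have hlm : l ∈ Icc 0 L := ⟨hl, by linarith [hx.2]⟩
      have hl0 : l + P.c1 * 0 ∈ Icc 0 L := by simpa using hlm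
      obtain ⟨-, hc⟩ := hgood 0 t le_rfl ht.1 hl0 hx
      have hF := hle 0 t le_rfl ht.1 ht.2 hl0 hx
      simp only [hG] at hF
      rw [hc, mul_zero, add_zero] at hF
      have := add_sq_le_two (z l 0) (z (l + P.c1 * t) t - z l 0)
      rw [add_sub_cancel] at this
      rw [indicator_of_mem hlm] at n1 ⊢
      linarith
    · have ht1 : 0 ≤ -l / P.c1 := div_nonneg (by linarith) h1.le
      have ht1t : -l / P.c1 ≤ t := by rw [div_le_iff₀ h1]; linarith [hx.1]
      have e0 : l + P.c1 * (-l / P.c1) = 0 := by field_simp; ring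
      have hl0 : l + P.c1 * (-l / P.c1) ∈ Icc 0 L := by rw [e0]; exact ⟨le_rfl, hL⟩
      obtain ⟨-, hc⟩ := hgood _ t ht1 ht1t hl0 hx
      have hF := hle _ t ht1 ht1t ht.2 hl0 hx
      simp only [hG] at hF
      rw [hc, e0, h.inlet _ ht1] at hF
      have hlm : l ∈ Icc (-(P.c1 * D)) 0 := ⟨by linarith [hx.1], hl.le⟩
      have := add_sq_le_two (-P.c7 * v 0 (-l / P.c1))
        (z (l + P.c1 * t) t - -P.c7 * v 0 (-l / P.c1))
      rw [add_sub_cancel] at this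
      rw [indicator_of_mem hlm] at n2 ⊢
      have e : (-P.c7 * v 0 (-l / P.c1)) ^ 2 = (P.c7 * v 0 (-l / P.c1)) ^ 2 := by ring
      linarith

/-- The state remains bounded by the initial energy during the first delay interval. -/
theorem exists_first_interval_bound (hP : P.Valid) (hD : 0 ≤ D) (hLD : (P.c1 + P.c4) * D ≤ L) :
    ∃ C, 0 ≤ C ∧ ∀ z v f : ℝ → ℝ → ℝ, MildPlant P L z v f → ∀ t ∈ Icc 0 D,
      (∫ x in (0 : ℝ)..L, z x t ^ 2) ≤ C * energy L D (fun x => z x 0) (fun x => v x 0) f ∧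
      (∫ x in (0 : ℝ)..L, v x t ^ 2) ≤ C * energy L D (fun x => z x 0) (fun x => v x 0) f ∧
      v L t ^ 2 ≤ C * energy L D (fun x => z x 0) (fun x => v x 0) f := by
  have h1 := hP.c1_pos; have h4 := hP.c4_pos; have h5 := hP.c5_pos; have h6 := hP.c6_pos
  have h1D : 0 ≤ P.c1 * D := mul_nonneg h1.le hD
  have h4D : 0 ≤ P.c4 * D := mul_nonneg h4.le hD
  have hL : 0 ≤ L := by linarith
  have hLm : L ∈ Icc 0 L := ⟨hL, le_rfl⟩
  obtain ⟨C₁, hC₁, hmaj⟩ := exists_z_majorant hP hD hLD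
  have hexp : ∀ x, 0 ≤ x → Real.exp (-(P.c2 * x)) ≤ 1 := fun x hx =>
    Real.exp_le_one_iff.2 (by nlinarith [hP.c2_pos])
  -- the right-hand side of the equation of `v`
  have hHsq : ∀ x, 0 ≤ x → ∀ a b : ℝ, (-(P.c5 * Real.exp (-(P.c2 * x)) * a + P.c6 * b)) ^ 2
      ≤ 2 * P.c5 ^ 2 * a ^ 2 + 2 * P.c6 ^ 2 * b ^ 2 := by
    intro x hx a b
    have he := hexp x hx
    have he0 := Real.exp_pos (-(P.c2 * x))
    have he2 : Real.exp (-(P.c2 * x)) ^ 2 ≤ 1 := by nlinarith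
    have h3 : (P.c5 * Real.exp (-(P.c2 * x)) * a) ^ 2 ≤ P.c5 ^ 2 * a ^ 2 := by
      have : 0 ≤ P.c5 ^ 2 * a ^ 2 := by positivity
      nlinarith
    have := add_sq_le_two (P.c5 * Real.exp (-(P.c2 * x)) * a) (P.c6 * b)
    nlinarith
  -- S bounds v(L,t)² and V bounds the integral of v². In V, the term c₄ D S comes from the labels
  -- in [L, L + c₄D], whose characteristics start at the outlet.
  set S : ℝ := 2 * (1 + D * (2 * P.c5 ^ 2 * (P.c1⁻¹ * C₁) + 2 * P.c6 ^ 2)) with hS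
  have hS0 : 0 ≤ S := by positivity
  set V : ℝ := 2 * (1 + P.c4 * D * S + D * (2 * P.c5 ^ 2 * (D * C₁) + 2 * P.c6 ^ 2)) with hV
  have hV0 : 0 ≤ V := by positivity
  refine ⟨C₁ + S + V, by positivity, ?_⟩
  intro z v f h
  obtain ⟨Ez, Ev, EL, Ef, EfL, E0⟩ := energy_parts_le hL hD (fun x => z x 0) (fun x => v x 0) f
  obtain ⟨B, hBi, hB0, hBE, hB⟩ := hmaj z v f h
  set E := energy L D (fun x => z x 0) (fun x => v x 0) f with hE
  have hz : ∀ t ∈ Icc 0 D, ∫ x in (0 : ℝ)..L, z x t ^ 2 ≤ C₁ * E := by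
    intro t ht
    refine (integral_le_of_affine_bound (-(P.c1 * t)) hL one_ne_zero hBi hB0
      (fun _ _ => sq_nonneg _) ?_).trans (by simpa using hBE)
    filter_upwards [ae_comp_affine hB one_ne_zero (-(P.c1 * t))] with x hx hxm
    have e : -(P.c1 * t) + 1 * x + P.c1 * t = x := by ring
    have := hx t ht (by rwa [e])
    rwa [e] at this
  -- The same majorant controls the outlet trace, since the label L - c₁t is affine in t.
  have hzL : ∫ t in (0 : ℝ)..D, z L t ^ 2 ≤ P.c1⁻¹ * (C₁ * E) := by
    refine (integral_le_of_affine_bound L hD (neg_ne_zero.2 h1.ne') hBi hB0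
      (fun _ _ => sq_nonneg _) ?_).trans ?_
    · filter_upwards [ae_comp_affine hB (neg_ne_zero.2 h1.ne') L] with t ht htm
      have e : L + -P.c1 * t + P.c1 * t = L := by ring
      have := ht t htm (by rwa [e])
      rwa [e] at this
    · rw [abs_neg, abs_of_pos h1]
      gcongr
  have hLpath : ∀ {g : ℝ → ℝ → ℝ}, ContinuousOn (Function.uncurry g) (Icc 0 L ×ˢ Ici 0) →
      ContinuousOn (fun t => g L t) (Icc 0 D) := fun hg =>
    continuousOn_comp_path hg continuousOn_const continuousOn_id (fun _ _ => hLm)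
      fun t ht => ht.1
  have hfLc : ContinuousOn (f L) (Icc 0 D) := h.f_outlet_cont.mono fun t ht => ht.1
  have hvL : ∀ t ∈ Icc 0 D, v L t ^ 2 ≤ S * E := by
    intro t ht
    have ho := h.outlet 0 t le_rfl ht.1
    set H : ℝ → ℝ := fun τ => -(P.c5 * Real.exp (-(P.c2 * L)) * z L τ + P.c6 * f L τ) with hH
    have hHc : ContinuousOn (fun τ => H τ ^ 2) (Icc 0 D) :=
      ((continuousOn_const.mul (hLpath h.z_cont)).add (continuousOn_const.mul hfLc)).neg.pow 2
    have hHi : IntervalIntegrable (fun τ => H τ ^ 2) volume 0 D :=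
      ContinuousOn.intervalIntegrable (by rwa [uIcc_of_le hD])
    have htm : t ∈ uIcc 0 D := by rwa [uIcc_of_le hD]
    have q1 := sq_integral_le ht.1 (hHi.mono_set (uIcc_subset_uIcc_left htm))
    have q2 : ∫ τ in (0 : ℝ)..t, H τ ^ 2 ≤ ∫ τ in (0 : ℝ)..D, H τ ^ 2 :=
      intervalIntegral.integral_mono_interval le_rfl ht.1 ht.2
        (Filter.Eventually.of_forall fun _ => sq_nonneg _) hHi
    have iz : IntervalIntegrable (fun τ => z L τ ^ 2) volume 0 D :=
      ContinuousOn.intervalIntegrable (by rw [uIcc_of_le hD]; exact (hLpath h.z_cont).pow 2)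
    have iff' : IntervalIntegrable (fun τ => f L τ ^ 2) volume 0 D :=
      ContinuousOn.intervalIntegrable (by rw [uIcc_of_le hD]; exact hfLc.pow 2)
    have q3 : ∫ τ in (0 : ℝ)..D, H τ ^ 2
        ≤ 2 * P.c5 ^ 2 * (P.c1⁻¹ * (C₁ * E)) + 2 * P.c6 ^ 2 * E := by
      calc ∫ τ in (0 : ℝ)..D, H τ ^ 2
          ≤ ∫ τ in (0 : ℝ)..D, (2 * P.c5 ^ 2 * z L τ ^ 2 + 2 * P.c6 ^ 2 * f L τ ^ 2) :=
            intervalIntegral.integral_mono_on hD hHi ((iz.const_mul _).add (iff'.const_mul _))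
              fun τ _ => hHsq L hL _ _
        _ = 2 * P.c5 ^ 2 * (∫ τ in (0 : ℝ)..D, z L τ ^ 2)
            + 2 * P.c6 ^ 2 * ∫ τ in (0 : ℝ)..D, f L τ ^ 2 := by
            rw [intervalIntegral.integral_add (iz.const_mul _) (iff'.const_mul _),
              intervalIntegral.integral_const_mul, intervalIntegral.integral_const_mul]
        _ ≤ _ := by gcongr
    have q4 : (v L t - v L 0) ^ 2
        ≤ D * (2 * P.c5 ^ 2 * (P.c1⁻¹ * (C₁ * E)) + 2 * P.c6 ^ 2 * E) := by
      rw [← ho]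
      refine q1.trans (mul_le_mul (by linarith [ht.2]) (q2.trans q3)
        (intervalIntegral.integral_nonneg ht.1 fun _ _ => sq_nonneg _) hD)
    have := add_sq_le_two (v L 0) (v L t - v L 0)
    rw [add_sub_cancel] at this
    rw [hS]
    linarith
  refine fun t ht => ⟨(hz t ht).trans (by gcongr; linarith), ?_, (hvL t ht).trans
    (by gcongr; linarith)⟩
  -- the interior bound of `v`
  set G : ℝ → ℝ → ℝ := fun x t => -(P.c5 * Real.exp (-(P.c2 * x)) * z x t + P.c6 * f x t) with hG
  have hzm : MemLp (Function.uncurry z) 2 (volume.restrict (Icc 0 L ×ˢ Icc 0 D)) :=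
    memLp_rect_of_continuousOn h.z_cont
  have hGm : MemLp (Function.uncurry G) 2 (volume.restrict (Icc 0 L ×ˢ Icc 0 D)) :=
    ((memLp_rect_mul (w := fun x _ => P.c5 * Real.exp (-(P.c2 * x)))
      (by simp only [Function.uncurry_def]; fun_prop) hzm).add ((h.f_memLp D).const_mul _)).neg
  have hzz : ∫ x in (0 : ℝ)..L, ∫ t in (0 : ℝ)..D, z x t ^ 2 ≤ D * (C₁ * E) := by
    rw [integral_rect_swap hL hD (g := fun x t => z x t ^ 2) (integrableOn_sq_of_memLp hzm)]
    calc ∫ t in (0 : ℝ)..D, ∫ x in (0 : ℝ)..L, z x t ^ 2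
        ≤ ∫ t in (0 : ℝ)..D, C₁ * E := by
          refine intervalIntegral.integral_mono_on hD ?_ intervalIntegrable_const hz
          exact intervalIntegrable_region_snd (H := fun x t => z x t ^ 2) (lo := fun _ => 0)
            (hi := fun _ => L) measurable_const measurable_const hD (fun _ _ => hL)
            ((integrableOn_sq_of_memLp hzm).mono_set fun q hq =>
              ⟨Ioo_subset_Icc_self hq.2, Ioo_subset_Icc_self hq.1⟩)
      _ = D * (C₁ * E) := by rw [intervalIntegral.integral_const, sub_zero, smul_eq_mul]
  have hGE : ∫ x in (0 : ℝ)..L, ∫ t in (0 : ℝ)..D, G x t ^ 2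
      ≤ 2 * P.c5 ^ 2 * (D * (C₁ * E)) + 2 * P.c6 ^ 2 * E := by
    have iz := (integrableOn_sq_of_memLp hzm).const_mul (2 * P.c5 ^ 2)
    have iff' := (integrableOn_sq_of_memLp (h.f_memLp D)).const_mul (2 * P.c6 ^ 2)
    have hadd : IntegrableOn (fun q : ℝ × ℝ => 2 * P.c5 ^ 2 * z q.1 q.2 ^ 2
        + 2 * P.c6 ^ 2 * f q.1 q.2 ^ 2) (Icc 0 L ×ˢ Icc 0 D) := by
      refine (iz.add iff').congr (Filter.Eventually.of_forall fun q => ?_)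
      simp [Function.uncurry_def]
    rw [← integral_rect hL hD (g := fun x t => G x t ^ 2) (integrableOn_sq_of_memLp hGm)]
    calc ∫ q in Icc 0 L ×ˢ Icc 0 D, G q.1 q.2 ^ 2
        ≤ ∫ q in Icc 0 L ×ˢ Icc 0 D, (2 * P.c5 ^ 2 * z q.1 q.2 ^ 2
            + 2 * P.c6 ^ 2 * f q.1 q.2 ^ 2) :=
          setIntegral_mono_on (integrableOn_sq_of_memLp hGm) hadd
            (measurableSet_Icc.prod measurableSet_Icc) fun q hq => hHsq _ hq.1.1 _ _
      _ = 2 * P.c5 ^ 2 * (∫ x in (0 : ℝ)..L, ∫ t in (0 : ℝ)..D, z x t ^ 2)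
          + 2 * P.c6 ^ 2 * ∫ x in (0 : ℝ)..L, ∫ t in (0 : ℝ)..D, f x t ^ 2 := by
          rw [← integral_rect hL hD (g := fun x t => z x t ^ 2) (integrableOn_sq_of_memLp hzm),
            ← integral_rect hL hD (g := fun x t => f x t ^ 2)
              (integrableOn_sq_of_memLp (h.f_memLp D)), ← integral_const_mul, ← integral_const_mul]
          exact integral_add iz iff'
      _ ≤ _ := by gcongr
  have hvc : ContinuousOn (fun y => v y 0) (Icc 0 L) :=
    continuousOn_comp_path h.v_cont continuousOn_id continuousOn_const (fun y hy => hy)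
      fun _ _ => le_rfl
  have b1 : Integrable ((Icc 0 L).indicator fun y => v y 0 ^ 2) :=
    integrable_indicator_Icc (hvc.pow 2)
  have b2 : Integrable ((Icc L (L + P.c4 * D)).indicator fun _ => S * E) :=
    integrable_indicator_Icc continuousOn_const
  have b3 := (integrable_lineEnergy (-P.c4) hGm).const_mul D
  obtain ⟨hBi', hBI'⟩ := integral_sum_three 2 b1 b2 b3
  have e3 : ∫ l, D * lineEnergy L D (-P.c4) G l = _ := integral_const_mul _ _
  rw [e3, integral_lineEnergy (-P.c4) hGm hL hD, integral_indicator_Icc hL,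
    integral_indicator_Icc (by linarith), intervalIntegral.integral_const, smul_eq_mul,
    add_sub_cancel_left] at hBI'
  have nB : ∀ l, 0 ≤ (Icc 0 L).indicator (fun y => v y 0 ^ 2) l ∧
      0 ≤ (Icc L (L + P.c4 * D)).indicator (fun _ => S * E) l ∧
      0 ≤ D * lineEnergy L D (-P.c4) G l := fun l =>
    ⟨indicator_nonneg (fun _ _ => sq_nonneg _) _,
      indicator_nonneg (fun _ _ => mul_nonneg hS0 E0) _, mul_nonneg hD (lineEnergy_nonneg _ _)⟩
  refine (integral_le_of_affine_bound (P.c4 * t) hL one_ne_zero hBi'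
    (fun l => by obtain ⟨n1, n2, n3⟩ := nB l; linarith) (fun _ _ => sq_nonneg _) ?_).trans ?_
  · filter_upwards [ae_comp_affine h.ae_vGood one_ne_zero (P.c4 * t),
      ae_comp_affine (ae_sq_integral_le_lineEnergy (-P.c4) hGm) one_ne_zero (P.c4 * t)]
      with x hgood hle hx
    set l := P.c4 * t + 1 * x with hl
    obtain ⟨n1, n2, n3⟩ := nB l
    have hct : 0 ≤ P.c4 * t := mul_nonneg h4.le ht.1
    have hctD : P.c4 * t ≤ P.c4 * D := mul_le_mul_of_nonneg_left ht.2 h4.le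
    have ex : l + -P.c4 * t = x := by rw [hl]; ring
    have hxm : l + -P.c4 * t ∈ Icc 0 L := by rwa [ex]
    rcases le_or_gt l L with hlL | hlL
    · have hlm : l ∈ Icc 0 L := ⟨by linarith [hx.1], hlL⟩
      have hl0 : l + -P.c4 * 0 ∈ Icc 0 L := by simpa using hlm
      obtain ⟨-, hc⟩ := hgood 0 t le_rfl ht.1 hl0 hxm
      have hF := hle 0 t le_rfl ht.1 ht.2 hl0 hxm
      simp only [hG] at hF
      rw [hc, mul_zero, add_zero, ex] at hF
      have := add_sq_le_two (v l 0) (v x t - v l 0)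
      rw [add_sub_cancel] at this
      rw [indicator_of_mem hlm] at n1 ⊢
      linarith
    · have ht1 : 0 ≤ (l - L) / P.c4 := div_nonneg (by linarith) h4.le
      have ht1t : (l - L) / P.c4 ≤ t := by rw [div_le_iff₀ h4]; linarith [hx.2]
      have e0 : l + -P.c4 * ((l - L) / P.c4) = L := by field_simp; ring
      have hl0 : l + -P.c4 * ((l - L) / P.c4) ∈ Icc 0 L := by rw [e0]; exact hLm
      obtain ⟨-, hc⟩ := hgood _ t ht1 ht1t hl0 hxm
      have hF := hle _ t ht1 ht1t ht.2 hl0 hxm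
      simp only [hG] at hF
      rw [hc, e0, ex] at hF
      have hlm : l ∈ Icc L (L + P.c4 * D) := ⟨hlL.le, by linarith [hx.2]⟩
      have hst := hvL _ ⟨ht1, ht1t.trans ht.2⟩
      have := add_sq_le_two (v L ((l - L) / P.c4)) (v x t - v L ((l - L) / P.c4))
      rw [add_sub_cancel] at this
      rw [indicator_of_mem hlm] at n2 ⊢
      linarith
  · rw [hBI', abs_one, inv_one, one_mul]
    have t1 : D * (∫ x in (0 : ℝ)..L, ∫ t in (0 : ℝ)..D, G x t ^ 2)
        ≤ D * (2 * P.c5 ^ 2 * (D * (C₁ * E)) + 2 * P.c6 ^ 2 * E) :=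
      mul_le_mul_of_nonneg_left hGE hD
    have t2 : 0 ≤ (C₁ + S) * E := by positivity
    have t3 : (C₁ + S + V) * E = (C₁ + S) * E + V * E := by ring
    rw [t3, hV]
    linarith

end ARZ

/-! ### The state along characteristics under the delay-free law. -/

namespace ARZ

/-- Variation of constants for `g' = κ g + m`, in integrated form. -/
theorem variation_of_constants {a b κ : ℝ} (hab : a ≤ b) {g r m : ℝ → ℝ}
    (hg : ∀ t ∈ Icc a b, g t = g a + ∫ s in a..t, r s)
    (hr : ∀ᵐ s : ℝ, s ∈ Icc a b → r s = κ * g s + m s) (hgc : ContinuousOn g (Icc a b))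
    (hmc : ContinuousOn m (Icc a b)) :
    g b = Real.exp (κ * (b - a)) * g a + ∫ s in a..b, Real.exp (κ * (b - s)) * m s := by
  -- Replacing r by the continuous r' makes g differentiable in the interior, and then e^{κ(b-s)}
  -- g(s) has derivative e^{κ(b-s)} m(s).
  set r' : ℝ → ℝ := fun s => κ * g s + m s with hr'
  have hrc : ContinuousOn r' (Icc a b) := (continuousOn_const.mul hgc).add hmc
  have hg' : ∀ t ∈ Icc a b, g t = g a + ∫ s in a..t, r' s := fun t ht => by
    rw [hg t ht]
    congr 1
    refine intervalIntegral.integral_congr_ae ?_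
    filter_upwards [hr] with s hs hsm
    rw [uIoc_of_le ht.1] at hsm
    exact hs ⟨hsm.1.le, hsm.2.trans ht.2⟩
  have hd : ∀ t ∈ Ioo a b, HasDerivAt g (r' t) t := fun t ht => by
    have h1 : HasDerivAt (fun t => g a + ∫ s in a..t, r' s) (r' t) t :=
      (intervalIntegral.integral_hasDerivAt_right
        (ContinuousOn.intervalIntegrable (by
          rw [uIcc_of_le ht.1.le]; exact hrc.mono (Icc_subset_Icc_right ht.2.le)))
        (ContinuousOn.stronglyMeasurableAtFilter isOpen_Ioo (hrc.mono Ioo_subset_Icc_self) t ht)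
        (hrc.continuousAt (Icc_mem_nhds ht.1 ht.2))).const_add _
    refine h1.congr_of_eventuallyEq ?_
    filter_upwards [Ioo_mem_nhds ht.1 ht.2] with s hs using hg' s (Ioo_subset_Icc_self hs)
  have key : ∫ s in a..b, Real.exp (κ * (b - s)) * m s
      = Real.exp (κ * (b - b)) * g b - Real.exp (κ * (b - a)) * g a := by
    refine intervalIntegral.integral_eq_sub_of_hasDerivAt_of_le
      (f := fun s => Real.exp (κ * (b - s)) * g s) hab
      (ContinuousOn.mul (by fun_prop) hgc) (fun s hs => ?_)
      (ContinuousOn.intervalIntegrable (by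
        rw [uIcc_of_le hab]; exact ContinuousOn.mul (by fun_prop) hmc))
    have he : HasDerivAt (fun s => Real.exp (κ * (b - s)))
        (Real.exp (κ * (b - s)) * (κ * (-1))) s :=
      (((hasDerivAt_id s).const_sub b).const_mul κ).exp
    refine (he.mul (hd s hs)).congr_deriv ?_
    simp only [hr']; ring
  rw [key, sub_self, mul_zero, Real.exp_zero]
  ring

/-- The constant κ accommodates the outlet value v(L,D), which bounds v on an unbounded set of
labels and so cannot be part of an integrable majorant. -/
theorem integral_le_of_affine_bound_add {a b q κ : ℝ} (p : ℝ) (hab : a ≤ b) (hq : q ≠ 0)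
    {g B : ℝ → ℝ} (hB : Integrable B) (hB0 : ∀ l, 0 ≤ B l)
    (hg0 : ∀ x ∈ Icc a b, 0 ≤ g x) (hg : ∀ᵐ x : ℝ, x ∈ Icc a b → g x ≤ B (p + q * x) + κ) :
    ∫ x in a..b, g x ≤ |q|⁻¹ * (∫ l, B l) + κ * (b - a) := by
  have hBi : IntervalIntegrable (fun x => B (p + q * x)) volume a b :=
    (Integrable.comp_mul_left' (g := fun y => B (p + y)) (hB.comp_add_left p) hq).intervalIntegrable
  have h1 : ∫ x in a..b, g x ≤ ∫ x in a..b, (B (p + q * x) + κ) := by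
    rw [intervalIntegral.integral_of_le hab, intervalIntegral.integral_of_le hab]
    refine integral_mono_of_nonneg ?_ (hBi.add intervalIntegrable_const).1 ?_
    · rw [Filter.EventuallyLE, ae_restrict_iff' measurableSet_Ioc]
      exact Filter.Eventually.of_forall fun x hx => hg0 x (Ioc_subset_Icc_self hx)
    · rw [Filter.EventuallyLE, ae_restrict_iff' measurableSet_Ioc]
      filter_upwards [hg] with x hx hxm using hx (Ioc_subset_Icc_self hxm)
  have h2 := integral_le_of_affine_bound p hab hq hB hB0 (g := fun x => B (p + q * x))
    (fun x _ => hB0 _) (Filter.Eventually.of_forall fun _ _ => le_rfl)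
  rw [intervalIntegral.integral_add hBi intervalIntegrable_const,
    intervalIntegral.integral_const, smul_eq_mul, mul_comm (b - a)] at h1
  linarith

/-- From time `D` on, the actuation renders `v` exponentially stable along its characteristics. -/
def IsStabilized (P : ARZParams) (L D k : ℝ) (z v f : ℝ → ℝ → ℝ) : Prop :=
  AEAndOutlet L fun x => ∀ t, D ≤ t →
    P.c6 * f x t = k * v x t - P.c5 * Real.exp (-(P.c2 * x)) * z x t

namespace MildPlant

variable {P : ARZParams} {L D k : ℝ} {z v f : ℝ → ℝ → ℝ}

/-- At x = L the delay-free law cancels the z-term of the outlet equation and leaves v_t = -k v. -/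
theorem outlet_decay (h : MildPlant P L z v f) (hf : IsStabilized P L D k z v f) (hL : 0 ≤ L)
    (hD : 0 ≤ D) {t : ℝ} (ht : D ≤ t) : v L t = Real.exp (-k * (t - D)) * v L D := by
  have hvc : ContinuousOn (fun s => v L s) (Icc D t) :=
    continuousOn_comp_path h.v_cont continuousOn_const continuousOn_id (fun _ _ => ⟨hL, le_rfl⟩)
      fun s hs => hD.trans hs.1
  have := variation_of_constants (κ := -k) (m := fun _ => 0) ht (g := fun s => v L s)
    (r := fun τ => -(P.c5 * Real.exp (-(P.c2 * L)) * z L τ + P.c6 * f L τ))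
    (fun s hs => by rw [h.outlet D s hD hs.1]; ring)
    (Filter.Eventually.of_forall fun s hs => by rw [hf.2 s hs.1]; ring) hvc continuousOn_const
  simpa using this

theorem ae_v_decay (h : MildPlant P L z v f) (hf : IsStabilized P L D k z v f) (hP : P.Valid)
    (hD : 0 ≤ D) : ∀ᵐ l : ℝ, ∀ t₁ t₂ : ℝ, D ≤ t₁ → t₁ ≤ t₂ → l + -P.c4 * t₁ ∈ Icc 0 L →
      l + -P.c4 * t₂ ∈ Icc 0 L →
        v (l + -P.c4 * t₂) t₂ = Real.exp (-k * (t₂ - t₁)) * v (l + -P.c4 * t₁) t₁ := by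
  filter_upwards [h.v_char] with l hl t₁ t₂ h1 h12 hx1 hx2
  have hm : ∀ s ∈ Icc t₁ t₂, l + -P.c4 * s ∈ Icc 0 L := fun s hs => mem_Icc_line hx1 hx2 hs
  have hvc : ContinuousOn (fun s => v (l + -P.c4 * s) s) (Icc t₁ t₂) :=
    continuousOn_comp_path h.v_cont (by fun_prop) continuousOn_id hm
      fun s hs => (hD.trans h1).trans hs.1
  have hae := ae_comp_affine ((ae_restrict_iff' measurableSet_Icc).1 hf.1)
    (neg_ne_zero.2 hP.c4_pos.ne') l
  have := variation_of_constants (κ := -k) (m := fun _ => 0) h12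
    (g := fun s => v (l + -P.c4 * s) s)
    (fun s hs => by rw [(hl t₁ s (hD.trans h1) hs.1 hx1 (hm s hs)).2]; ring)
    (by
      filter_upwards [hae] with s hs hsm
      rw [hs (hm s hsm) s (h1.trans hsm.1)]; ring) hvc continuousOn_const
  simpa using this

/-- The z-part of the delay-free law turns the source of z into (c₃c₅/c₆) z = c₁c₂ z; the v-part
remains as forcing. -/
theorem ae_z_variation (h : MildPlant P L z v f) (hf : IsStabilized P L D k z v f) (hP : P.Valid)
    (hD : 0 ≤ D) : ∀ᵐ l : ℝ, ∀ t₁ t₂ : ℝ, D ≤ t₁ → t₁ ≤ t₂ → l + P.c1 * t₁ ∈ Icc 0 L →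
      l + P.c1 * t₂ ∈ Icc 0 L →
        z (l + P.c1 * t₂) t₂ = Real.exp (P.c1 * P.c2 * (t₂ - t₁)) * z (l + P.c1 * t₁) t₁
          + ∫ s in t₁..t₂, Real.exp (P.c1 * P.c2 * (t₂ - s)) *
            (-(P.c3 / P.c6 * k) * Real.exp (P.c2 * (l + P.c1 * s)) * v (l + P.c1 * s) s) := by
  have h6 := hP.c6_pos.ne'
  filter_upwards [h.z_char] with l hl t₁ t₂ h1 h12 hx1 hx2
  have hm : ∀ s ∈ Icc t₁ t₂, l + P.c1 * s ∈ Icc 0 L := fun s hs => mem_Icc_line hx1 hx2 hs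
  have hc : ∀ {g : ℝ → ℝ → ℝ}, ContinuousOn (Function.uncurry g) (Icc 0 L ×ˢ Ici 0) →
      ContinuousOn (fun s => g (l + P.c1 * s) s) (Icc t₁ t₂) := fun hg =>
    continuousOn_comp_path hg (by fun_prop) continuousOn_id hm
      fun s hs => (hD.trans h1).trans hs.1
  have hae := ae_comp_affine ((ae_restrict_iff' measurableSet_Icc).1 hf.1) hP.c1_pos.ne' l
  refine variation_of_constants (κ := P.c1 * P.c2)
    (m := fun s => -(P.c3 / P.c6 * k) * Real.exp (P.c2 * (l + P.c1 * s)) * v (l + P.c1 * s) s)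
    h12 (g := fun s => z (l + P.c1 * s) s)
    (fun s hs => by rw [(hl t₁ s (hD.trans h1) hs.1 hx1 (hm s hs)).2]; ring)
    ?_ (hc h.z_cont) (ContinuousOn.mul (by fun_prop) (hc h.v_cont))
  filter_upwards [hae] with s hs hsm
  have e := hs (hm s hsm) s (h1.trans hsm.1)
  have e35 := hP.c3_mul_c5
  have ee : Real.exp (P.c2 * (l + P.c1 * s)) * Real.exp (-(P.c2 * (l + P.c1 * s))) = 1 := by
    rw [← Real.exp_add, add_neg_cancel, Real.exp_zero]
  set X := Real.exp (P.c2 * (l + P.c1 * s))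
  set Y := Real.exp (-(P.c2 * (l + P.c1 * s)))
  have ef : f (l + P.c1 * s) s
      = (k * v (l + P.c1 * s) s - P.c5 * Y * z (l + P.c1 * s) s) / P.c6 := by
    rw [← e]; field_simp
  rw [ef]
  field_simp
  linear_combination (P.c3 * P.c5 * z (l + P.c1 * s) s) * ee + z (l + P.c1 * s) s * e35

/-- A majorant of the weighted `v²` along the characteristics from time `D` on. -/
theorem ae_v_majorant (h : MildPlant P L z v f) (hf : IsStabilized P L D k z v f) (hP : P.Valid)
    (hL : 0 ≤ L) (hD : 0 ≤ D) : ∀ᵐ l : ℝ, ∀ t, D ≤ t → l + -P.c4 * t ∈ Icc 0 L →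
      (Real.exp (k * (t - D)) * v (l + -P.c4 * t) t) ^ 2
        ≤ (Icc 0 L).indicator (fun y => v y D ^ 2) (-(P.c4 * D) + 1 * l) + v L D ^ 2 := by
  have h4 := hP.c4_pos
  filter_upwards [h.ae_v_decay hf hP hD] with l hl t ht hx
  have n1 : 0 ≤ (Icc 0 L).indicator (fun y => v y D ^ 2) (-(P.c4 * D) + 1 * l) :=
    indicator_nonneg (fun _ _ => sq_nonneg _) _
  have hct : P.c4 * D ≤ P.c4 * t := mul_le_mul_of_nonneg_left ht h4.le
  have hw : ∀ t₁, Real.exp (k * (t - D)) * Real.exp (-k * (t - t₁)) = Real.exp (k * (t₁ - D)) :=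
    fun t₁ => by rw [← Real.exp_add]; congr 1; ring
  -- Backwards in time the characteristic reaches either time D inside [0, L], or the outlet at time
  -- (l - L)/c₄ > D, where `outlet_decay` goes on to time D.
  rcases le_or_gt l (L + P.c4 * D) with hlL | hlL
  · have e : l + -P.c4 * D = -(P.c4 * D) + 1 * l := by ring
    have hm : l + -P.c4 * D ∈ Icc 0 L := ⟨by linarith [hx.1], by linarith⟩
    rw [hl D t le_rfl ht hm hx, ← mul_assoc, hw, sub_self, mul_zero, Real.exp_zero, one_mul]
    rw [e] at hm ⊢
    rw [indicator_of_mem hm]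
    linarith [sq_nonneg (v L D)]
  · have hDt : D ≤ (l - L) / P.c4 := by rw [le_div_iff₀ h4]; linarith
    have htt : (l - L) / P.c4 ≤ t := by rw [div_le_iff₀ h4]; linarith [hx.2]
    have e0 : l + -P.c4 * ((l - L) / P.c4) = L := by field_simp; ring
    rw [hl _ t hDt htt (by rw [e0]; exact ⟨hL, le_rfl⟩) hx, e0, h.outlet_decay hf hL hD hDt,
      ← mul_assoc, hw, ← mul_assoc, ← Real.exp_add]
    rw [show k * ((l - L) / P.c4 - D) + -k * ((l - L) / P.c4 - D) = 0 by ring, Real.exp_zero,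
      one_mul]
    linarith

end MildPlant

end ARZ

/-! ### Growth of z over the bounded residence time. -/

namespace ARZ

/-- The energy of the plant state, without the delay line. -/
noncomputable def plantEnergy (L : ℝ) (z v : ℝ → ℝ) : ℝ :=
  (∫ x in (0 : ℝ)..L, z x ^ 2) + (∫ x in (0 : ℝ)..L, v x ^ 2) + v L ^ 2

theorem plantEnergy_parts_le {L : ℝ} (hL : 0 ≤ L) (z v : ℝ → ℝ) :
    (∫ x in (0 : ℝ)..L, z x ^ 2) ≤ plantEnergy L z v ∧
      (∫ x in (0 : ℝ)..L, v x ^ 2) ≤ plantEnergy L z v ∧ v L ^ 2 ≤ plantEnergy L z v ∧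
      0 ≤ plantEnergy L z v := by
  have h1 : 0 ≤ ∫ x in (0 : ℝ)..L, z x ^ 2 :=
    intervalIntegral.integral_nonneg hL fun _ _ => sq_nonneg _
  have h2 : 0 ≤ ∫ x in (0 : ℝ)..L, v x ^ 2 :=
    intervalIntegral.integral_nonneg hL fun _ _ => sq_nonneg _
  have h3 := sq_nonneg (v L)
  unfold plantEnergy
  refine ⟨?_, ?_, ?_, ?_⟩ <;> linarith

namespace MildPlant

variable {P : ARZParams} {L D k : ℝ} {z v f : ℝ → ℝ → ℝ}

theorem continuousOn_slice {g : ℝ → ℝ → ℝ}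
    (hg : ContinuousOn (Function.uncurry g) (Icc 0 L ×ˢ Ici 0)) {t : ℝ} (ht : 0 ≤ t) :
    ContinuousOn (fun y => g y t) (Icc 0 L) :=
  continuousOn_comp_path hg continuousOn_id continuousOn_const (fun _ hy => hy) fun _ _ => ht

/-- The weighted `v²` is integrable along the characteristics of `z`. -/
theorem integral_v_sq_le (h : MildPlant P L z v f) (hf : IsStabilized P L D k z v f)
    (hP : P.Valid) (hL : 0 ≤ L) (hD : 0 ≤ D) {l t₁ t₂ : ℝ} (h1 : D ≤ t₁) (h12 : t₁ ≤ t₂)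
    (hx1 : l + P.c1 * t₁ ∈ Icc 0 L) (hx2 : l + P.c1 * t₂ ∈ Icc 0 L) :
    ∫ s in t₁..t₂, (Real.exp (k * (s - D)) * v (l + P.c1 * s) s) ^ 2
      ≤ ((P.c1 + P.c4)⁻¹ + L / P.c1) * plantEnergy L (fun x => z x D) (fun x => v x D) := by
  have hc1 := hP.c1_pos; have hc4 := hP.c4_pos
  have hs : 0 < P.c1 + P.c4 := add_pos hc1 hc4
  obtain ⟨-, Av, AL, A0⟩ := plantEnergy_parts_le hL (fun x => z x D) (fun x => v x D)
  have hlen : t₂ - t₁ ≤ L / P.c1 := by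
    rw [le_div_iff₀ hc1]; linarith [hx1.1, hx2.2]
  have hb : Integrable ((Icc 0 L).indicator fun y => v y D ^ 2) :=
    integrable_indicator_Icc ((continuousOn_slice h.v_cont hD).pow 2)
  -- A z-characteristic crosses the v-characteristics transversally, with v-label l + (c₁+c₄)s at
  -- time s, and its residence time in [0, L] is at most L/c₁.
  have key := integral_le_of_affine_bound_add (κ := v L D ^ 2) (-(P.c4 * D) + l) h12 hs.ne' hb
    (fun _ => indicator_nonneg (fun _ _ => sq_nonneg _) _)
    (g := fun s => (Real.exp (k * (s - D)) * v (l + P.c1 * s) s) ^ 2)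
    (fun _ _ => sq_nonneg _) (by
      filter_upwards [ae_comp_affine (h.ae_v_majorant hf hP hL hD) hs.ne' l] with s hs' hsm
      have e : l + (P.c1 + P.c4) * s + -P.c4 * s = l + P.c1 * s := by ring
      have e' : -(P.c4 * D) + 1 * (l + (P.c1 + P.c4) * s)
        = -(P.c4 * D) + l + (P.c1 + P.c4) * s := by ring
      have := hs' s (h1.trans hsm.1) (by rw [e]; exact mem_Icc_line hx1 hx2 hsm)
      rwa [e, e'] at this)
  rw [integral_indicator_Icc hL, abs_of_pos hs] at key
  refine key.trans ?_
  rw [add_mul]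
  refine add_le_add (mul_le_mul_of_nonneg_left Av (by positivity)) ?_
  rw [mul_comm]
  exact mul_le_mul hlen AL (sq_nonneg _) (by positivity)

/-- Growth of the weighted `z²` along a characteristic. -/
theorem ae_z_growth (h : MildPlant P L z v f) (hf : IsStabilized P L D k z v f)
    (hP : P.Valid) (hL : 0 ≤ L) (hD : 0 ≤ D) (hk : 0 ≤ k) : ∀ᵐ l : ℝ, ∀ t₁ t₂ : ℝ, D ≤ t₁ →
      t₁ ≤ t₂ → l + P.c1 * t₁ ∈ Icc 0 L → l + P.c1 * t₂ ∈ Icc 0 L →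
        (Real.exp (k * (t₂ - D)) * z (l + P.c1 * t₂) t₂) ^ 2
          ≤ 2 * Real.exp ((P.c1 * P.c2 + k) * (L / P.c1)) ^ 2 *
            ((Real.exp (k * (t₁ - D)) * z (l + P.c1 * t₁) t₁) ^ 2 +
              L / P.c1 * (P.c3 / P.c6 * k * Real.exp (P.c2 * L)) ^ 2 *
              (((P.c1 + P.c4)⁻¹ + L / P.c1) *
                plantEnergy L (fun x => z x D) (fun x => v x D))) := by
  have hc1 := hP.c1_pos; have hc2 := hP.c2_pos
  filter_upwards [h.ae_z_variation hf hP hD] with l hl t₁ t₂ h1 h12 hx1 hx2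
  have hlen : t₂ - t₁ ≤ L / P.c1 := by
    rw [le_div_iff₀ hc1]; linarith [hx1.1, hx2.2]
  have hm : ∀ s ∈ Icc t₁ t₂, l + P.c1 * s ∈ Icc 0 L := fun s hs => mem_Icc_line hx1 hx2 hs
  have hvI := h.integral_v_sq_le hf hP hL hD h1 h12 hx1 hx2
  set A := plantEnergy L (fun x => z x D) (fun x => v x D)
  -- K bounds the growth over one residence time; k is added to the rate c₁c₂ because of the weight
  -- e^{k(t-D)}.
  set K := Real.exp ((P.c1 * P.c2 + k) * (L / P.c1)) with hK
  have hK0 : 0 < K := Real.exp_pos _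
  set q := P.c3 / P.c6 * k with hq
  have hKs : ∀ s ∈ Icc t₁ t₂, Real.exp ((P.c1 * P.c2 + k) * (t₂ - s)) ≤ K := fun s hs =>
    Real.exp_le_exp.2 (mul_le_mul_of_nonneg_left (by linarith [hs.1]) (by positivity))
  have hvc : ContinuousOn (fun s => v (l + P.c1 * s) s) (Icc t₁ t₂) :=
    continuousOn_comp_path h.v_cont (by fun_prop) continuousOn_id hm
      fun s hs => (hD.trans h1).trans hs.1
  set w : ℝ → ℝ := fun s => Real.exp ((P.c1 * P.c2 + k) * (t₂ - s)) *
    (-q * Real.exp (P.c2 * (l + P.c1 * s))) * (Real.exp (k * (s - D)) * v (l + P.c1 * s) s) with hw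
  have hwc : ContinuousOn w (Icc t₁ t₂) :=
    ContinuousOn.mul (by fun_prop) (ContinuousOn.mul (by fun_prop) hvc)
  have hwi : IntervalIntegrable (fun s => w s ^ 2) volume t₁ t₂ :=
    ContinuousOn.intervalIntegrable (by rw [uIcc_of_le h12]; exact hwc.pow 2)
  have hui : IntervalIntegrable (fun s => (Real.exp (k * (s - D)) * v (l + P.c1 * s) s) ^ 2)
      volume t₁ t₂ := ContinuousOn.intervalIntegrable (by
    rw [uIcc_of_le h12]; exact (ContinuousOn.mul (by fun_prop) hvc).pow 2)
  have e1 : Real.exp (k * (t₂ - D)) * z (l + P.c1 * t₂) t₂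
      = Real.exp ((P.c1 * P.c2 + k) * (t₂ - t₁)) * (Real.exp (k * (t₁ - D)) * z (l + P.c1 * t₁) t₁)
        + ∫ s in t₁..t₂, w s := by
    rw [hl t₁ t₂ h1 h12 hx1 hx2, mul_add, ← intervalIntegral.integral_const_mul]
    have ee : ∀ s, Real.exp (k * (t₂ - D)) * Real.exp (P.c1 * P.c2 * (t₂ - s))
        = Real.exp ((P.c1 * P.c2 + k) * (t₂ - s)) * Real.exp (k * (s - D)) := fun s => by
      rw [← Real.exp_add, ← Real.exp_add]; congr 1; ring
    congr 1
    · rw [← mul_assoc, ee, mul_assoc]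
    · refine intervalIntegral.integral_congr fun s _ => ?_
      simp only [hw]
      rw [← mul_assoc, ee]; ring
  have hwle : ∫ s in t₁..t₂, w s ^ 2
      ≤ (K * (q * Real.exp (P.c2 * L))) ^ 2 *
        ∫ s in t₁..t₂, (Real.exp (k * (s - D)) * v (l + P.c1 * s) s) ^ 2 := by
    rw [← intervalIntegral.integral_const_mul]
    refine intervalIntegral.integral_mono_on h12 hwi (hui.const_mul _) fun s hs => ?_
    have he : Real.exp (P.c2 * (l + P.c1 * s)) ≤ Real.exp (P.c2 * L) :=
      Real.exp_le_exp.2 (mul_le_mul_of_nonneg_left (hm s hs).2 hc2.le)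
    have hKs' := hKs s hs
    simp only [hw, mul_pow, neg_sq]
    gcongr
  have hI : (∫ s in t₁..t₂, w s) ^ 2
      ≤ L / P.c1 * ((K * (q * Real.exp (P.c2 * L))) ^ 2 * (((P.c1 + P.c4)⁻¹ + L / P.c1) * A)) := by
    refine (sq_integral_le h12 hwi).trans (mul_le_mul hlen (hwle.trans
      (mul_le_mul_of_nonneg_left hvI (sq_nonneg _)))
      (intervalIntegral.integral_nonneg h12 fun _ _ => sq_nonneg _) (by positivity))
  have h3 : (Real.exp ((P.c1 * P.c2 + k) * (t₂ - t₁)) *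
      (Real.exp (k * (t₁ - D)) * z (l + P.c1 * t₁) t₁)) ^ 2
      ≤ K ^ 2 * (Real.exp (k * (t₁ - D)) * z (l + P.c1 * t₁) t₁) ^ 2 := by
    rw [mul_pow]
    have := hKs t₁ ⟨le_rfl, h12⟩
    gcongr
  rw [e1]
  refine (add_sq_le_two _ _).trans ?_
  rw [mul_assoc 2]
  refine mul_le_mul_of_nonneg_left ?_ zero_le_two
  refine (add_le_add h3 hI).trans (le_of_eq ?_)
  ring

end MildPlant

/-- A majorant of the weighted `z²` along the characteristics from time `D` on. -/
theorem exists_z_decay_majorant {P : ARZParams} (hP : P.Valid) {L D k : ℝ} (hL : 0 ≤ L)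
    (hD : 0 ≤ D) (hk : 0 ≤ k) :
    ∃ C, 0 ≤ C ∧ ∀ z v f : ℝ → ℝ → ℝ, MildPlant P L z v f → IsStabilized P L D k z v f →
      ∃ (B : ℝ → ℝ) (κ : ℝ), Integrable B ∧ (∀ l, 0 ≤ B l) ∧
        ∫ l, B l ≤ C * plantEnergy L (fun x => z x D) (fun x => v x D) ∧
        κ ≤ C * plantEnergy L (fun x => z x D) (fun x => v x D) ∧
        ∀ᵐ l : ℝ, ∀ t, D ≤ t → l + P.c1 * t ∈ Icc 0 L →
          (Real.exp (k * (t - D)) * z (l + P.c1 * t) t) ^ 2 ≤ B l + κ := by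
  have hc1 := hP.c1_pos; have hc4 := hP.c4_pos
  set K := 2 * Real.exp ((P.c1 * P.c2 + k) * (L / P.c1)) ^ 2 with hK
  set S := L / P.c1 * (P.c3 / P.c6 * k * Real.exp (P.c2 * L)) ^ 2 *
    ((P.c1 + P.c4)⁻¹ + L / P.c1) with hS
  have hK0 : 0 ≤ K := by positivity
  have hS0 : 0 ≤ S := by positivity
  refine ⟨K * (1 + P.c7 ^ 2 * (P.c4 / P.c1)⁻¹) + K * (P.c7 ^ 2 + S), by positivity, ?_⟩
  intro z v f h hf
  obtain ⟨Az, Av, AL, A0⟩ := plantEnergy_parts_le hL (fun x => z x D) (fun x => v x D)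
  have hgr := h.ae_z_growth hf hP hL hD hk
  set A := plantEnergy L (fun x => z x D) (fun x => v x D)
  set bz := (Icc 0 L).indicator fun y => z y D ^ 2 with hbz
  set bv := (Icc 0 L).indicator fun y => v y D ^ 2 with hbv
  have nz : ∀ y, 0 ≤ bz y := fun _ => indicator_nonneg (fun _ _ => sq_nonneg _) _
  have nv : ∀ y, 0 ≤ bv y := fun _ => indicator_nonneg (fun _ _ => sq_nonneg _) _
  have iz : Integrable bz :=
    integrable_indicator_Icc ((MildPlant.continuousOn_slice h.z_cont hD).pow 2)
  have iv : Integrable bv :=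
    integrable_indicator_Icc ((MildPlant.continuousOn_slice h.v_cont hD).pow 2)
  -- The characteristic of z with label l enters at time -l/c₁, and the v-characteristic arriving at
  -- that inlet point has label -(c₄/c₁) l.
  have hq : -(P.c4 / P.c1) ≠ 0 := neg_ne_zero.2 (div_pos hc4 hc1).ne'
  have iz' : Integrable fun l => bz (P.c1 * D + l) := iz.comp_add_left _
  have iv' : Integrable fun l => P.c7 ^ 2 * bv (-(P.c4 * D) + -(P.c4 / P.c1) * l) :=
    (Integrable.comp_mul_left' (g := fun y => bv (-(P.c4 * D) + y)) (iv.comp_add_left _)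
      hq).const_mul _
  have eI : ∫ l, K * (bz (P.c1 * D + l) + P.c7 ^ 2 * bv (-(P.c4 * D) + -(P.c4 / P.c1) * l))
      = K * ((∫ x in (0 : ℝ)..L, z x D ^ 2)
        + P.c7 ^ 2 * ((P.c4 / P.c1)⁻¹ * ∫ x in (0 : ℝ)..L, v x D ^ 2)) := by
    rw [integral_const_mul, integral_add iz' iv', integral_add_left_eq_self, integral_const_mul,
      Measure.integral_comp_mul_left (fun y => bv (-(P.c4 * D) + y)), integral_add_left_eq_self,
      hbz, hbv, integral_indicator_Icc hL, integral_indicator_Icc hL, smul_eq_mul, abs_inv, abs_neg,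
      abs_of_pos (div_pos hc4 hc1)]
  refine ⟨fun l => K * (bz (P.c1 * D + l) + P.c7 ^ 2 * bv (-(P.c4 * D) + -(P.c4 / P.c1) * l)),
    K * (P.c7 ^ 2 * v L D ^ 2 + S * A), (iz'.add iv').const_mul K,
    fun l => mul_nonneg hK0 (add_nonneg (nz _) (mul_nonneg (sq_nonneg _) (nv _))), ?_, ?_, ?_⟩
  · rw [eI]
    calc _ ≤ K * (A + P.c7 ^ 2 * ((P.c4 / P.c1)⁻¹ * A)) := by gcongr
      _ = K * (1 + P.c7 ^ 2 * (P.c4 / P.c1)⁻¹) * A + 0 := by ring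
      _ ≤ K * (1 + P.c7 ^ 2 * (P.c4 / P.c1)⁻¹) * A + K * (P.c7 ^ 2 + S) * A := by
        gcongr; positivity
      _ = _ := by ring
  · calc _ ≤ K * (P.c7 ^ 2 * A + S * A) := by gcongr
      _ = 0 + K * (P.c7 ^ 2 + S) * A := by ring
      _ ≤ K * (1 + P.c7 ^ 2 * (P.c4 / P.c1)⁻¹) * A + K * (P.c7 ^ 2 + S) * A := by
        gcongr; positivity
      _ = _ := by ring
  · filter_upwards [hgr, ae_comp_affine (h.ae_v_majorant hf hP hL hD) hq 0] with l hl hv t ht hx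
    have hct : P.c1 * D ≤ P.c1 * t := mul_le_mul_of_nonneg_left ht hc1.le
    have nz' := nz (P.c1 * D + l)
    have nv' : 0 ≤ P.c7 ^ 2 * bv (-(P.c4 * D) + -(P.c4 / P.c1) * l) :=
      mul_nonneg (sq_nonneg _) (nv _)
    have nL : 0 ≤ P.c7 ^ 2 * v L D ^ 2 := by positivity
    -- The characteristic is followed back to its start: the profile at time D, or the inlet, where
    -- the boundary condition passes to the majorant of v.
    have start : ∃ t₁, D ≤ t₁ ∧ t₁ ≤ t ∧ l + P.c1 * t₁ ∈ Icc 0 L ∧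
        (Real.exp (k * (t₁ - D)) * z (l + P.c1 * t₁) t₁) ^ 2
          ≤ bz (P.c1 * D + l) + P.c7 ^ 2 * bv (-(P.c4 * D) + -(P.c4 / P.c1) * l)
            + P.c7 ^ 2 * v L D ^ 2 := by
      rcases le_or_gt 0 (l + P.c1 * D) with h0 | h0
      · have hm : l + P.c1 * D ∈ Icc 0 L := ⟨h0, by linarith [hx.2]⟩
        refine ⟨D, le_rfl, ht, hm, ?_⟩
        rw [sub_self, mul_zero, Real.exp_zero, one_mul]
        have : bz (P.c1 * D + l) = z (l + P.c1 * D) D ^ 2 := by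
          rw [add_comm (P.c1 * D), hbz, indicator_of_mem hm]
        linarith
      · have hDt : D ≤ -l / P.c1 := by rw [le_div_iff₀ hc1]; linarith
        have htt : -l / P.c1 ≤ t := by rw [div_le_iff₀ hc1]; linarith [hx.1]
        have e0 : l + P.c1 * (-l / P.c1) = 0 := by field_simp; ring
        refine ⟨_, hDt, htt, by rw [e0]; exact ⟨le_rfl, hL⟩, ?_⟩
        have ev : 0 + -(P.c4 / P.c1) * l + -P.c4 * (-l / P.c1) = 0 := by field_simp; ring
        have := hv _ hDt (by rw [ev]; exact ⟨le_rfl, hL⟩)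
        rw [ev, zero_add, one_mul] at this
        rw [e0, h.inlet _ (hD.trans hDt)]
        have h7 := mul_le_mul_of_nonneg_left this (sq_nonneg P.c7)
        calc (Real.exp (k * (-l / P.c1 - D)) * (-P.c7 * v 0 (-l / P.c1))) ^ 2
            = P.c7 ^ 2 * (Real.exp (k * (-l / P.c1 - D)) * v 0 (-l / P.c1)) ^ 2 := by ring
          _ ≤ _ := by linarith
    obtain ⟨t₁, h1, h2, hm, hle⟩ := start
    refine (hl t₁ t h1 h2 hm hx).trans ?_
    rw [← mul_assoc, ← hS, ← mul_add]
    refine mul_le_mul_of_nonneg_left ?_ hK0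
    linarith

end ARZ

/-! ### Exponential decay of the plant state. -/

namespace ARZ

/-- Exponential decay of the plant state from time `D` on. -/
theorem exists_plant_decay {P : ARZParams} (hP : P.Valid) {L D k : ℝ} (hL : 0 ≤ L)
    (hD : 0 ≤ D) (hk : 0 ≤ k) :
    ∃ C, 0 ≤ C ∧ ∀ z v f : ℝ → ℝ → ℝ, MildPlant P L z v f → IsStabilized P L D k z v f →
      ∀ t, D ≤ t →
        (Real.exp (k * (t - D)) ^ 2 * ∫ x in (0 : ℝ)..L, z x t ^ 2)
          ≤ C * plantEnergy L (fun x => z x D) (fun x => v x D) ∧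
        (Real.exp (k * (t - D)) ^ 2 * ∫ x in (0 : ℝ)..L, v x t ^ 2)
          ≤ C * plantEnergy L (fun x => z x D) (fun x => v x D) ∧
        Real.exp (k * (t - D)) ^ 2 * v L t ^ 2
          ≤ C * plantEnergy L (fun x => z x D) (fun x => v x D) ∧
        (Real.exp (k * (t - D)) ^ 2 * ∫ s in (0 : ℝ)..D, z L (s + t) ^ 2)
          ≤ C * plantEnergy L (fun x => z x D) (fun x => v x D) := by
  have hc1 := hP.c1_pos; have hc4 := hP.c4_pos
  obtain ⟨C, hC, hmaj⟩ := exists_z_decay_majorant hP hL hD hk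
  -- The four bounds need C(1+L), 1+L, 1 and C(c₁⁻¹+D). The last one, for the outlet trace of z over
  -- a window of length D, serves the delay line at x = L.
  refine ⟨1 + L + C * (1 + L) + C * (P.c1⁻¹ + D), by positivity, ?_⟩
  intro z v f h hf t ht
  have ht0 : 0 ≤ t := hD.trans ht
  obtain ⟨B, κ, hB, hB0, hBI, hκ, hz⟩ := hmaj z v f h hf
  obtain ⟨Az, Av, AL, A0⟩ := plantEnergy_parts_le hL (fun x => z x D) (fun x => v x D)
  set A := plantEnergy L (fun x => z x D) (fun x => v x D)
  set W := Real.exp (k * (t - D)) with hW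
  have p1 : 0 ≤ C * (1 + L) * A := by positivity
  have p2 : 0 ≤ C * (P.c1⁻¹ + D) * A := by positivity
  have p3 : 0 ≤ L * A := by positivity
  have eT : (1 + L + C * (1 + L) + C * (P.c1⁻¹ + D)) * A
      = A + L * A + C * (1 + L) * A + C * (P.c1⁻¹ + D) * A := by ring
  rw [eT]
  have hin : ∀ (g : ℝ → ℝ) (a b : ℝ), W ^ 2 * ∫ x in a..b, g x ^ 2 = ∫ x in a..b, (W * g x) ^ 2 :=
    fun g a b => by
      rw [← intervalIntegral.integral_const_mul]
      exact intervalIntegral.integral_congr fun x _ => by simp only [mul_pow]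
  refine ⟨?_, ?_, ?_, ?_⟩
  · rw [hin]
    have key := integral_le_of_affine_bound_add (κ := κ) (-(P.c1 * t)) hL one_ne_zero hB hB0
      (g := fun x => (W * z x t) ^ 2) (fun _ _ => sq_nonneg _) (by
        filter_upwards [ae_comp_affine hz one_ne_zero (-(P.c1 * t))] with x hx hxm
        have e : -(P.c1 * t) + 1 * x + P.c1 * t = x := by ring
        have := hx t ht (by rwa [e])
        rwa [e] at this)
    rw [abs_one, inv_one, one_mul, sub_zero] at key
    have := mul_le_mul_of_nonneg_right hκ hL
    linarith
  · rw [hin]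
    have key := integral_le_of_affine_bound_add (κ := v L D ^ 2) (-(P.c4 * D) + P.c4 * t) hL
      one_ne_zero (integrable_indicator_Icc ((MildPlant.continuousOn_slice h.v_cont hD).pow 2))
      (fun _ => indicator_nonneg (fun _ _ => sq_nonneg _) _)
      (g := fun x => (W * v x t) ^ 2) (fun _ _ => sq_nonneg _) (by
        filter_upwards [ae_comp_affine (h.ae_v_majorant hf hP hL hD) one_ne_zero (P.c4 * t)]
          with x hx hxm
        have e : P.c4 * t + 1 * x + -P.c4 * t = x := by ring
        have e' : -(P.c4 * D) + 1 * (P.c4 * t + 1 * x) = -(P.c4 * D) + P.c4 * t + 1 * x := by ring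
        have := hx t ht (by rwa [e])
        rwa [e, e'] at this)
    rw [abs_one, inv_one, one_mul, sub_zero, integral_indicator_Icc hL] at key
    simp only [Pi.pow_apply] at key
    have := mul_le_mul_of_nonneg_right AL hL
    linarith
  · have e : W * Real.exp (-k * (t - D)) = 1 := by
      rw [hW, ← Real.exp_add, ← Real.exp_zero]; congr 1; ring
    rw [← mul_pow, h.outlet_decay hf hL hD ht, ← mul_assoc, e, one_mul]
    linarith
  · rw [hin]
    have key := integral_le_of_affine_bound_add (κ := κ) (L - P.c1 * t) hD (neg_ne_zero.2 hc1.ne')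
      hB hB0 (g := fun s => (W * z L (s + t)) ^ 2) (fun _ _ => sq_nonneg _) (by
        filter_upwards [ae_comp_affine hz (neg_ne_zero.2 hc1.ne') (L - P.c1 * t)] with s hs hsm
        have e : L - P.c1 * t + -P.c1 * s + P.c1 * (s + t) = L := by ring
        have := hs (s + t) (by linarith [hsm.1]) (by rw [e]; exact ⟨hL, le_rfl⟩)
        rw [e] at this
        refine le_trans ?_ this
        have hWs : W ≤ Real.exp (k * (s + t - D)) :=
          Real.exp_le_exp.2 (mul_le_mul_of_nonneg_left (by linarith [hsm.1]) hk)
        have hW0 : 0 ≤ W := (Real.exp_pos _).le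
        rw [mul_pow, mul_pow]
        gcongr)
    rw [abs_neg, abs_of_pos hc1, sub_zero] at key
    have q1 := mul_le_mul_of_nonneg_left hBI (inv_pos.2 hc1).le
    have q2 := mul_le_mul_of_nonneg_right hκ hD
    linarith

/-- Exponential decay of the plant state in terms of the initial energy. -/
theorem exists_state_decay {P : ARZParams} (hP : P.Valid) {L D k : ℝ} (hD : 0 ≤ D) (hk : 0 ≤ k)
    (hLD : (P.c1 + P.c4) * D ≤ L) :
    ∃ C, 0 ≤ C ∧ ∀ z v f : ℝ → ℝ → ℝ, MildPlant P L z v f → IsStabilized P L D k z v f →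
      ∀ t, 0 ≤ t →
        (∫ x in (0 : ℝ)..L, z x t ^ 2) ≤ Real.exp (-(2 * k) * t) *
          (C * energy L D (fun x => z x 0) (fun x => v x 0) f) ∧
        (∫ x in (0 : ℝ)..L, v x t ^ 2) ≤ Real.exp (-(2 * k) * t) *
          (C * energy L D (fun x => z x 0) (fun x => v x 0) f) ∧
        v L t ^ 2 ≤ Real.exp (-(2 * k) * t) *
          (C * energy L D (fun x => z x 0) (fun x => v x 0) f) ∧
        (D ≤ t → ∫ s in (0 : ℝ)..D, z L (s + t) ^ 2 ≤ Real.exp (-(2 * k) * t) *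
          (C * energy L D (fun x => z x 0) (fun x => v x 0) f)) := by
  have hc1 := hP.c1_pos; have hc4 := hP.c4_pos
  have hL : 0 ≤ L := le_trans (by positivity) hLD
  obtain ⟨C₁, hC₁, h1⟩ := exists_first_interval_bound hP hD hLD
  obtain ⟨C₂, hC₂, h2⟩ := exists_plant_decay hP hL hD hk
  -- The factor e^{2kD} compensates the missing decay on [0, D] and moves the time origin of the
  -- later decay from D to 0.
  set X := Real.exp (2 * k * D) with hX
  have hX0 : 0 ≤ X := (Real.exp_pos _).le
  refine ⟨X * (C₁ + C₂ * (3 * C₁)), by positivity, ?_⟩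
  intro z v f h hf t ht
  obtain ⟨-, -, -, -, -, E0⟩ := energy_parts_le hL hD (fun x => z x 0) (fun x => v x 0) f
  have h1' := h1 z v f h
  have h2' := h2 z v f h hf
  set E := energy L D (fun x => z x 0) (fun x => v x 0) f
  have hA : plantEnergy L (fun x => z x D) (fun x => v x D) ≤ 3 * C₁ * E := by
    obtain ⟨a, b, c⟩ := h1' D ⟨hD, le_rfl⟩
    unfold plantEnergy
    linarith
  have w0 := Real.exp_pos (-(2 * k) * t)
  have late : D ≤ t → ∀ a, Real.exp (k * (t - D)) ^ 2 * a
      ≤ C₂ * plantEnergy L (fun x => z x D) (fun x => v x D) →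
      a ≤ Real.exp (-(2 * k) * t) * (X * (C₁ + C₂ * (3 * C₁)) * E) := by
    intro _ a ha
    have e : Real.exp (-(2 * k) * t) * X * Real.exp (k * (t - D)) ^ 2 = 1 := by
      rw [hX, sq, ← Real.exp_add, ← Real.exp_add, ← Real.exp_add, ← Real.exp_zero]
      congr 1; ring
    have hb := mul_le_mul_of_nonneg_left (ha.trans (mul_le_mul_of_nonneg_left hA hC₂))
      (mul_nonneg w0.le hX0)
    rw [← mul_assoc, e, one_mul] at hb
    have p : 0 ≤ Real.exp (-(2 * k) * t) * X * (C₁ * E) := by positivity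
    linarith
  have early : t ≤ D → ∀ a, a ≤ C₁ * E →
      a ≤ Real.exp (-(2 * k) * t) * (X * (C₁ + C₂ * (3 * C₁)) * E) := by
    intro htD a ha
    have e : 1 ≤ Real.exp (-(2 * k) * t) * X := by
      rw [hX, ← Real.exp_add]
      refine Real.one_le_exp ?_
      nlinarith
    have p : 0 ≤ Real.exp (-(2 * k) * t) * X * (C₂ * (3 * C₁) * E) := by positivity
    have q : C₁ * E ≤ Real.exp (-(2 * k) * t) * X * (C₁ * E) :=
      le_mul_of_one_le_left (by positivity) e
    linarith
  rcases le_total t D with htD | htD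
  · obtain ⟨a, b, c⟩ := h1' t ⟨ht, htD⟩
    refine ⟨early htD _ a, early htD _ b, early htD _ c, fun hDt => ?_⟩
    obtain ⟨-, -, -, d⟩ := h2' t hDt
    exact late hDt _ d
  · obtain ⟨a, b, c, d⟩ := h2' t htD
    exact ⟨late htD _ a, late htD _ b, late htD _ c, fun _ => late htD _ d⟩

end ARZ

/-! ### Exponential decay of the delay line. -/

namespace ARZ

theorem intervalIntegral_mono_of_nonneg {a b : ℝ} (hab : a ≤ b) {g G : ℝ → ℝ}
    (hG : IntervalIntegrable G volume a b) (hg0 : ∀ x, 0 ≤ g x)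
    (hg : ∀ᵐ x : ℝ, x ∈ Icc a b → g x ≤ G x) : ∫ x in a..b, g x ≤ ∫ x in a..b, G x := by
  rw [intervalIntegral.integral_of_le hab, intervalIntegral.integral_of_le hab]
  refine integral_mono_of_nonneg (Filter.Eventually.of_forall hg0) hG.1 ?_
  rw [Filter.EventuallyLE, ae_restrict_iff' measurableSet_Ioc]
  filter_upwards [hg] with x hx hxm using hx (Ioc_subset_Icc_self hxm)

/-- Exponential decay of the delay line from time `D` on. -/
theorem exists_late_actuation_decay {P : ARZParams} (hP : P.Valid) {L D k : ℝ} (hD : 0 ≤ D)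
    (hk : 0 ≤ k) (hLD : (P.c1 + P.c4) * D ≤ L) :
    ∃ C, 0 ≤ C ∧ ∀ z v f : ℝ → ℝ → ℝ, MildPlant P L z v f → IsStabilized P L D k z v f →
      ∀ t, D ≤ t →
        (∫ x in (0 : ℝ)..L, ∫ s in (0 : ℝ)..D, f x (s + t) ^ 2) ≤ Real.exp (-(2 * k) * t) *
          (C * energy L D (fun x => z x 0) (fun x => v x 0) f) ∧
        (∫ s in (0 : ℝ)..D, f L (s + t) ^ 2) ≤ Real.exp (-(2 * k) * t) *
          (C * energy L D (fun x => z x 0) (fun x => v x 0) f) := by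
  have hc1 := hP.c1_pos; have hc4 := hP.c4_pos; have hc6 := hP.c6_pos
  have hL : 0 ≤ L := le_trans (by positivity) hLD
  obtain ⟨C, hC, hdec⟩ := exists_state_decay hP hD hk hLD
  -- By the delay-free law and e^{-c₂x} ≤ 1, f² ≤ K (v² + z²).
  set K := 2 * (k ^ 2 + P.c5 ^ 2) / P.c6 ^ 2 with hK
  have hK0 : 0 ≤ K := by positivity
  refine ⟨K * (2 * D * C) + K * (D * C + C), by positivity, ?_⟩
  intro z v f h hf t ht
  have ht0 : 0 ≤ t := hD.trans ht
  obtain ⟨-, -, -, -, -, E0⟩ := energy_parts_le hL hD (fun x => z x 0) (fun x => v x 0) f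
  have hd := hdec z v f h hf
  set E := energy L D (fun x => z x 0) (fun x => v x 0) f
  set w := Real.exp (-(2 * k) * t) with hw
  have hw0 : 0 < w := Real.exp_pos _
  have hsq : ∀ x, 0 ≤ x → (∀ t, D ≤ t →
      P.c6 * f x t = k * v x t - P.c5 * Real.exp (-(P.c2 * x)) * z x t) → ∀ s, 0 ≤ s →
      f x (s + t) ^ 2 ≤ K * (v x (s + t) ^ 2 + z x (s + t) ^ 2) := by
    intro x hx hfx s hs
    have e := hfx (s + t) (by linarith)
    have he : Real.exp (-(P.c2 * x)) ≤ 1 := Real.exp_le_one_iff.2 (by nlinarith [hP.c2_pos])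
    have he0 := Real.exp_pos (-(P.c2 * x))
    have he2 : Real.exp (-(P.c2 * x)) ^ 2 ≤ 1 := by nlinarith
    have h3 : (P.c5 * Real.exp (-(P.c2 * x)) * z x (s + t)) ^ 2 ≤ P.c5 ^ 2 * z x (s + t) ^ 2 := by
      have : 0 ≤ P.c5 ^ 2 * z x (s + t) ^ 2 := by positivity
      nlinarith
    have h4 : (P.c6 * f x (s + t)) ^ 2
        ≤ 2 * (k ^ 2 + P.c5 ^ 2) * (v x (s + t) ^ 2 + z x (s + t) ^ 2) := by
      rw [e, sub_eq_add_neg]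
      have := add_sq_le_two (k * v x (s + t)) (-(P.c5 * Real.exp (-(P.c2 * x)) * z x (s + t)))
      have p1 : 0 ≤ k ^ 2 * z x (s + t) ^ 2 := by positivity
      have p2 : 0 ≤ P.c5 ^ 2 * v x (s + t) ^ 2 := by positivity
      nlinarith
    rw [hK, div_mul_eq_mul_div, le_div_iff₀ (by positivity)]
    linarith [mul_pow P.c6 (f x (s + t)) 2]
  have hline : ∀ {g : ℝ → ℝ → ℝ}, ContinuousOn (Function.uncurry g) (Icc 0 L ×ˢ Ici 0) →
      ∀ x ∈ Icc 0 L, ContinuousOn (fun s => g x (s + t)) (Icc 0 D) := fun hg x hx =>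
    continuousOn_comp_path hg continuousOn_const (by fun_prop) (fun _ _ => hx)
      fun s hs => by linarith [hs.1]
  have hgi : ∀ x ∈ Icc 0 L, IntervalIntegrable
      (fun s => K * (v x (s + t) ^ 2 + z x (s + t) ^ 2)) volume 0 D := fun x hx =>
    ContinuousOn.intervalIntegrable (by
      rw [uIcc_of_le hD]
      exact continuousOn_const.mul (((hline h.v_cont x hx).pow 2).add ((hline h.z_cont x hx).pow 2)))
  set G : ℝ → ℝ → ℝ := fun x s => K * (v x (s + t) ^ 2 + z x (s + t) ^ 2) with hG
  have hws : ∀ s, 0 ≤ s → Real.exp (-(2 * k) * (s + t)) ≤ w := fun s hs =>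
    Real.exp_le_exp.2 (by nlinarith)
  constructor
  · have hshift : ContinuousOn (fun q : ℝ × ℝ => (q.1, q.2 + t)) (Icc 0 L ×ˢ Icc 0 D) := by
      fun_prop
    have hmaps : MapsTo (fun q : ℝ × ℝ => (q.1, q.2 + t)) (Icc 0 L ×ˢ Icc 0 D)
        (Icc 0 L ×ˢ Ici 0) := fun q hq => ⟨hq.1, by
          have := hq.2.1
          simp only [mem_Ici]; linarith⟩
    have hGc : ContinuousOn (Function.uncurry G) (Icc 0 L ×ˢ Icc 0 D) :=
      continuousOn_const.mul (((h.v_cont.comp hshift hmaps).pow 2).add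
        ((h.z_cont.comp hshift hmaps).pow 2))
    have hGi := hGc.integrableOn_compact (μ := volume) (isCompact_rect L D)
    have e1 : ∫ x in (0 : ℝ)..L, ∫ s in (0 : ℝ)..D, f x (s + t) ^ 2
        ≤ ∫ x in (0 : ℝ)..L, ∫ s in (0 : ℝ)..D, G x s := by
      refine intervalIntegral_mono_of_nonneg hL ?_
        (fun x => intervalIntegral.integral_nonneg hD fun _ _ => sq_nonneg _) ?_
      · exact intervalIntegrable_region_fst (α := fun _ => 0) (β := fun _ => D) measurable_const
          measurable_const hL (fun _ _ => hD) (hGi.mono_set fun q hq =>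
            ⟨Ioo_subset_Icc_self hq.1, Ioo_subset_Icc_self hq.2⟩)
      · filter_upwards [(ae_restrict_iff' measurableSet_Icc).1 hf.1] with x hx hxm
        exact intervalIntegral_mono_of_nonneg hD (hgi x hxm) (fun _ => sq_nonneg _)
          (Filter.Eventually.of_forall fun s hs => hsq x hxm.1 (hx hxm) s hs.1)
    have e2 : ∫ s in (0 : ℝ)..D, ∫ x in (0 : ℝ)..L, G x s
        ≤ ∫ s in (0 : ℝ)..D, K * (w * (2 * C * E)) := by
      refine intervalIntegral_mono_of_nonneg hD intervalIntegrable_const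
        (fun s => intervalIntegral.integral_nonneg hL fun _ _ => by simp only [hG]; positivity)
        (Filter.Eventually.of_forall fun s hs => ?_)
      have hst : 0 ≤ s + t := add_nonneg hs.1 ht0
      obtain ⟨a, b, -, -⟩ := hd (s + t) hst
      have iv : IntervalIntegrable (fun x => v x (s + t) ^ 2) volume 0 L :=
        ContinuousOn.intervalIntegrable (by
          rw [uIcc_of_le hL]; exact (MildPlant.continuousOn_slice h.v_cont hst).pow 2)
      have iz : IntervalIntegrable (fun x => z x (s + t) ^ 2) volume 0 L :=
        ContinuousOn.intervalIntegrable (by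
          rw [uIcc_of_le hL]; exact (MildPlant.continuousOn_slice h.z_cont hst).pow 2)
      simp only [hG]
      rw [intervalIntegral.integral_const_mul, intervalIntegral.integral_add iv iz]
      refine mul_le_mul_of_nonneg_left ?_ hK0
      have := mul_le_mul_of_nonneg_right (hws s hs.1) (mul_nonneg hC E0)
      linarith
    -- With time outermost, the decay of the state can be used at each instant s + t.
    rw [integral_rect_swap hL hD hGi] at e1
    rw [intervalIntegral.integral_const, sub_zero, smul_eq_mul] at e2
    have p : 0 ≤ w * (K * (D * C + C) * E) := by positivity
    linarith
  · have hLm : L ∈ Icc 0 L := ⟨hL, le_rfl⟩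
    have iv : IntervalIntegrable (fun s => v L (s + t) ^ 2) volume 0 D :=
      ContinuousOn.intervalIntegrable (by
        rw [uIcc_of_le hD]; exact (hline h.v_cont L hLm).pow 2)
    have iz : IntervalIntegrable (fun s => z L (s + t) ^ 2) volume 0 D :=
      ContinuousOn.intervalIntegrable (by
        rw [uIcc_of_le hD]; exact (hline h.z_cont L hLm).pow 2)
    have e1 : ∫ s in (0 : ℝ)..D, f L (s + t) ^ 2 ≤ ∫ s in (0 : ℝ)..D, G L s :=
      intervalIntegral_mono_of_nonneg hD (hgi L hLm) (fun _ => sq_nonneg _)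
        (Filter.Eventually.of_forall fun s hs => hsq L hL hf.2 s hs.1)
    have e2 : ∫ s in (0 : ℝ)..D, v L (s + t) ^ 2 ≤ ∫ s in (0 : ℝ)..D, w * (C * E) := by
      refine intervalIntegral_mono_of_nonneg hD intervalIntegrable_const (fun s => sq_nonneg _)
        (Filter.Eventually.of_forall fun s hs => ?_)
      obtain ⟨-, -, c, -⟩ := hd (s + t) (add_nonneg hs.1 ht0)
      exact c.trans (mul_le_mul_of_nonneg_right (hws s hs.1) (mul_nonneg hC E0))
    obtain ⟨-, -, -, e3⟩ := hd t ht0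
    have e3' := e3 ht
    simp only [hG] at e1
    rw [intervalIntegral.integral_const_mul, intervalIntegral.integral_add iv iz] at e1
    rw [intervalIntegral.integral_const, sub_zero, smul_eq_mul] at e2
    have q := mul_le_mul_of_nonneg_left (add_le_add e2 e3') hK0
    have p : 0 ≤ w * (K * (2 * D * C) * E) := by positivity
    linarith

/-- Exponential decay of the delay line. -/
theorem exists_actuation_decay {P : ARZParams} (hP : P.Valid) {L D k : ℝ} (hD : 0 ≤ D)
    (hk : 0 ≤ k) (hLD : (P.c1 + P.c4) * D ≤ L) :
    ∃ C, 0 ≤ C ∧ ∀ z v f : ℝ → ℝ → ℝ, MildPlant P L z v f → IsStabilized P L D k z v f →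
      ∀ t, 0 ≤ t →
        (∫ x in (0 : ℝ)..L, ∫ s in (0 : ℝ)..D, f x (s + t) ^ 2) ≤ Real.exp (-(2 * k) * t) *
          (C * energy L D (fun x => z x 0) (fun x => v x 0) f) ∧
        (∫ s in (0 : ℝ)..D, f L (s + t) ^ 2) ≤ Real.exp (-(2 * k) * t) *
          (C * energy L D (fun x => z x 0) (fun x => v x 0) f) := by
  have hc1 := hP.c1_pos; have hc4 := hP.c4_pos
  have hL : 0 ≤ L := le_trans (by positivity) hLD
  obtain ⟨C, hC, hlate⟩ := exists_late_actuation_decay hP hD hk hLD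
  set X := Real.exp (2 * k * D) with hX
  have hX1 : 1 ≤ X := Real.one_le_exp (by positivity)
  have hX0 : 0 ≤ X := (Real.exp_pos _).le
  refine ⟨X * (1 + C), by positivity, ?_⟩
  intro z v f h hf t ht
  obtain ⟨-, -, -, Ef, EfL, E0⟩ := energy_parts_le hL hD (fun x => z x 0) (fun x => v x 0) f
  have hl := hlate z v f h hf
  set E := energy L D (fun x => z x 0) (fun x => v x 0) f
  have w0 := Real.exp_pos (-(2 * k) * t)
  have hCE : 0 ≤ C * E := mul_nonneg hC E0
  rcases le_total D t with htD | htD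
  · obtain ⟨a, b⟩ := hl t htD
    have hle : Real.exp (-(2 * k) * t) * (C * E)
        ≤ Real.exp (-(2 * k) * t) * (X * (1 + C) * E) := by
      refine mul_le_mul_of_nonneg_left ?_ w0.le
      have := mul_le_mul_of_nonneg_right hX1 hCE
      have p : 0 ≤ X * E := by positivity
      linarith
    exact ⟨a.trans hle, b.trans hle⟩
  obtain ⟨a, b⟩ := hl D le_rfl
  have hwD : Real.exp (-(2 * k) * D) ≤ 1 := Real.exp_le_one_iff.2 (by nlinarith)
  have early : ∀ r, r ≤ E + Real.exp (-(2 * k) * D) * (C * E) →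
      r ≤ Real.exp (-(2 * k) * t) * (X * (1 + C) * E) := by
    intro r hr
    have e : 1 ≤ Real.exp (-(2 * k) * t) * X := by
      rw [hX, ← Real.exp_add]
      refine Real.one_le_exp ?_
      nlinarith
    have q := mul_le_mul_of_nonneg_right hwD hCE
    have q' : E + C * E ≤ Real.exp (-(2 * k) * t) * X * (E + C * E) :=
      le_mul_of_one_le_left (by positivity) e
    linarith
  -- For t ≤ D the window [t, t+D] lies in [0, 2D]: the first half carries the initial content of
  -- the delay line, the second is the late estimate at time D.
  have hsplit : ∀ g : ℝ → ℝ, IntervalIntegrable (fun s => g s ^ 2) volume 0 (D + D) →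
      ∫ s in (0 : ℝ)..D, g (s + t) ^ 2
        ≤ (∫ s in (0 : ℝ)..D, g s ^ 2) + ∫ s in (0 : ℝ)..D, g (s + D) ^ 2 := by
    intro g hg
    have hm : ∀ r ∈ Icc 0 (D + D), r ∈ uIcc 0 (D + D) := fun r hr => by
      rwa [uIcc_of_le (by linarith)]
    rw [intervalIntegral.integral_comp_add_right (fun s => g s ^ 2),
      intervalIntegral.integral_comp_add_right (fun s => g s ^ 2), zero_add, zero_add,
      intervalIntegral.integral_add_adjacent_intervals
        (hg.mono_set (uIcc_subset_uIcc_left (hm D ⟨hD, by linarith⟩)))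
        (hg.mono_set (uIcc_subset_uIcc_right (hm D ⟨hD, by linarith⟩)))]
    exact intervalIntegral.integral_mono_interval ht (by linarith) (by linarith)
      (Filter.Eventually.of_forall fun _ => sq_nonneg _) hg
  constructor
  · refine early _ ?_
    have hDD : 0 ≤ D + D := by linarith
    have hreg : ∀ T, 0 ≤ T → IntervalIntegrable (fun x => ∫ s in (0 : ℝ)..T, f x s ^ 2)
        volume 0 L := fun T hT =>
      intervalIntegrable_region_fst (H := fun x s => f x s ^ 2) (α := fun _ => 0) (β := fun _ => T)
        measurable_const measurable_const hL (fun _ _ => hT)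
        ((integrableOn_sq_of_memLp (h.f_memLp T)).mono_set fun q hq =>
          ⟨Ioo_subset_Icc_self hq.1, Ioo_subset_Icc_self hq.2⟩)
    have hline := (ae_restrict_iff' measurableSet_Icc).1
      (ae_intervalIntegrable_right (g := fun x s => f x s ^ 2)
        fun T => integrableOn_sq_of_memLp (h.f_memLp T))
    have hF : IntervalIntegrable (fun x => ∫ s in (0 : ℝ)..D, f x (s + D) ^ 2) volume 0 L := by
      refine ((hreg (D + D) hDD).sub (hreg D hD)).congr_ae ?_
      rw [uIoc_of_le hL, Filter.EventuallyEq, ae_restrict_iff' measurableSet_Ioc]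
      filter_upwards [hline] with x hx hxm
      have hx' := hx (Ioc_subset_Icc_self hxm)
      have hDm : D ∈ Ici (0 : ℝ) := hD
      rw [intervalIntegral.integral_comp_add_right (fun s => f x s ^ 2), zero_add,
        ← intervalIntegral.integral_add_adjacent_intervals (hx' 0 self_mem_Ici D hDm)
          (hx' D hDm (D + D) hDD), add_sub_cancel_left]
    have hle : ∫ x in (0 : ℝ)..L, ∫ s in (0 : ℝ)..D, f x (s + t) ^ 2
        ≤ ∫ x in (0 : ℝ)..L, ((∫ s in (0 : ℝ)..D, f x s ^ 2) + ∫ s in (0 : ℝ)..D, f x (s + D) ^ 2) := by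
      refine intervalIntegral_mono_of_nonneg hL ((hreg D hD).add hF)
        (fun x => intervalIntegral.integral_nonneg hD fun _ _ => sq_nonneg _) ?_
      filter_upwards [hline] with x hx hxm
      exact hsplit (f x) (hx hxm 0 self_mem_Ici (D + D) hDD)
    rw [intervalIntegral.integral_add (hreg D hD) hF] at hle
    exact hle.trans (add_le_add Ef a)
  · refine early _ ((hsplit (f L) ?_).trans (add_le_add EfL b))
    exact ContinuousOn.intervalIntegrable
      ((h.f_outlet_cont.mono fun s hs => by
        rw [uIcc_of_le (by linarith)] at hs; exact hs.1).pow 2)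

end ARZ

/-! ### Return to the delay line and the initial data; the stability estimate. -/

namespace ARZ

variable {P : ARZParams} {L D k : ℝ} {z₀ v₀ : ℝ → ℝ} {ϑ₀ : ℝ → ℝ → ℝ} {z v : ℝ → ℝ → ℝ}
  {ψ : ℝ → ℝ → ℝ → ℝ}

/-- By transport, the content of the delay line at time t is the actuation that reaches the plant
during [t, t+D]. -/
theorem IsClosedLoopSolution.integral_sq_delay_line
    (h : IsClosedLoopSolution P L D k z₀ v₀ ϑ₀ z v ψ) (hL : 0 ≤ L) (hD : 0 ≤ D) {t : ℝ}
    (ht : 0 ≤ t) :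
    (∫ x in (0 : ℝ)..L, ∫ s in (0 : ℝ)..D, ψ x s t ^ 2)
        = ∫ x in (0 : ℝ)..L, ∫ s in (0 : ℝ)..D, ψ x 0 (s + t) ^ 2 ∧
      ∫ s in (0 : ℝ)..D, ψ L s t ^ 2 = ∫ s in (0 : ℝ)..D, ψ L 0 (s + t) ^ 2 := by
  have hline : ∀ x, (∀ s ∈ Icc 0 D, ∀ t, 0 ≤ t → ψ x s t = ψ x 0 (s + t)) →
      ∫ s in (0 : ℝ)..D, ψ x s t ^ 2 = ∫ s in (0 : ℝ)..D, ψ x 0 (s + t) ^ 2 := fun x hx =>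
    intervalIntegral.integral_congr fun s hs => by
      rw [uIcc_of_le hD] at hs
      simp only [hx s hs t ht]
  refine ⟨intervalIntegral.integral_congr_ae ?_, hline L h.transport.2⟩
  filter_upwards [(ae_restrict_iff' measurableSet_Icc).1 h.transport.1] with x hx hxm
  rw [uIoc_of_le hL] at hxm
  exact hline x (hx (Ioc_subset_Icc_self hxm))

/-- The estimates are stated with the actuation on [0, D] in place of the initial delay line; the
two have the same norms by transport at time 0. -/
theorem IsClosedLoopSolution.energy_init (h : IsClosedLoopSolution P L D k z₀ v₀ ϑ₀ z v ψ)
    (hL : 0 ≤ L) (hD : 0 ≤ D) :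
    energy L D (fun x => z x 0) (fun x => v x 0) (fun x s => ψ x 0 s) = energy L D z₀ v₀ ϑ₀ := by
  obtain ⟨e4, e5⟩ := h.integral_sq_delay_line hL hD le_rfl
  simp only [add_zero] at e4 e5
  have hline : ∀ x, (∀ s ∈ Icc 0 D, ψ x s 0 = ϑ₀ x s) →
      ∫ s in (0 : ℝ)..D, ψ x s 0 ^ 2 = ∫ s in (0 : ℝ)..D, ϑ₀ x s ^ 2 := fun x hx =>
    intervalIntegral.integral_congr fun s hs => by
      rw [uIcc_of_le hD] at hs
      simp only [hx s hs]
  have e4' : ∫ x in (0 : ℝ)..L, ∫ s in (0 : ℝ)..D, ψ x s 0 ^ 2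
      = ∫ x in (0 : ℝ)..L, ∫ s in (0 : ℝ)..D, ϑ₀ x s ^ 2 := by
    refine intervalIntegral.integral_congr_ae ?_
    filter_upwards [(ae_restrict_iff' measurableSet_Icc).1 h.ψ_init.1] with x hx hxm
    rw [uIoc_of_le hL] at hxm
    exact hline x (hx (Ioc_subset_Icc_self hxm))
  have e1 : ∫ x in (0 : ℝ)..L, z x 0 ^ 2 = ∫ x in (0 : ℝ)..L, z₀ x ^ 2 :=
    intervalIntegral.integral_congr fun x hx => by
      rw [uIcc_of_le hL] at hx
      simp only [h.z_init x hx]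
  have e2 : ∫ x in (0 : ℝ)..L, v x 0 ^ 2 = ∫ x in (0 : ℝ)..L, v₀ x ^ 2 :=
    intervalIntegral.integral_congr fun x hx => by
      rw [uIcc_of_le hL] at hx
      simp only [h.v_init x hx]
  simp only [energy]
  rw [e1, e2, h.v_init L ⟨hL, le_rfl⟩, ← e4, ← e5, e4', hline L h.ψ_init.2]

end ARZ

theorem theorem1 (P : ARZParams) (hP : P.Valid) (L D k : ℝ) (hD : 0 < D) (hk : 0 < k)
    (hLD : (P.c1 + P.c4) * D < L) :
    ∃ M ϑ : ℝ, 0 < M ∧ 0 < ϑ ∧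
      ∀ (z₀ v₀ : ℝ → ℝ) (ϑ₀ : ℝ → ℝ → ℝ), ARZ.CompatibleData P L D k z₀ v₀ ϑ₀ →
        ∀ (z v : ℝ → ℝ → ℝ) (ψ : ℝ → ℝ → ℝ → ℝ),
          ARZ.IsClosedLoopSolution P L D k z₀ v₀ ϑ₀ z v ψ →
          ∀ t : ℝ, 0 < t →
            ARZ.energy L D (fun x => z x t) (fun x => v x t) (fun x s => ψ x s t) ≤
              M * Real.exp (-ϑ * t) * ARZ.energy L D z₀ v₀ ϑ₀ := by
  have hc1 := hP.c1_pos
  have hc4 := hP.c4_pos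
  have hL : 0 ≤ L := le_trans (by positivity) hLD.le
  obtain ⟨C, hC, hstate⟩ := ARZ.exists_state_decay hP hD.le hk.le hLD.le
  obtain ⟨C', hC', hact⟩ := ARZ.exists_actuation_decay hP hD.le hk.le hLD.le
  -- The energy has three state terms and two delay-line terms; the summand 1 makes the constant
  -- positive. The rate is 2k because the terms are squares.
  refine ⟨3 * C + 2 * C' + 1, 2 * k, by positivity, by positivity, ?_⟩
  intro z₀ v₀ ϑ₀ _ z v ψ h t ht
  have hm := h.mildPlant hP hL hD.le
  have hf : ARZ.IsStabilized P L D k z v fun x t => ψ x 0 t := h.actuation_eq hP hD.le hL hLD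
  obtain ⟨a, b, c, -⟩ := hstate z v _ hm hf t ht.le
  obtain ⟨d, e⟩ := hact z v _ hm hf t ht.le
  obtain ⟨e4, e5⟩ := h.integral_sq_delay_line hL hD.le ht.le
  rw [h.energy_init hL hD.le] at a b c d e
  obtain ⟨-, -, -, -, -, E0⟩ := ARZ.energy_parts_le hL hD.le z₀ v₀ ϑ₀
  have w0 := Real.exp_pos (-(2 * k) * t)
  have p := mul_nonneg w0.le E0
  calc ARZ.energy L D (fun x => z x t) (fun x => v x t) (fun x s => ψ x s t)
      = (∫ x in (0 : ℝ)..L, z x t ^ 2) + (∫ x in (0 : ℝ)..L, v x t ^ 2) + v L t ^ 2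
        + (∫ x in (0 : ℝ)..L, ∫ s in (0 : ℝ)..D, ψ x 0 (s + t) ^ 2)
        + ∫ s in (0 : ℝ)..D, ψ L 0 (s + t) ^ 2 := by rw [← e4, ← e5]; rfl
    _ ≤ _ := by linarith
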